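/- Let $D$ be a compact complex manifold of dimension $n-1$ $(n\ge 1)$ and let $\pi:E\to D$ be a holomorphic line bundle with a smooth Hermitian metric $h$ of positive curvature, i.e. $\omega_D=-\sqrt{-1}\,\partial\bar\partial\log|\sigma|_h^2$ ($\sigma$ a local nonvanishing holomorphic section) is a Kähler form. Let $E'$ be the complement of the zero section of $E$, with local holomorphic coordinates $(w^1,\dots,w^{n-1},z)$ given by a chart of $D$ and a holomorphic trivialization of $E$; let $|S|^2(e)=|e|_h^2$, $\omega_0=\sqrt{-1}\,\partial\bar\partial|S|^{-2}$ on $E'$, $V=z\partial_z+\bar z\partial_{\bar z}$, $V^{(1,0)}=z\partial_z$, and let $\delta_r:E'\to E'$ be fibrewise multiplication by $r>0$. A function or form $\alpha$ has weight $k$ if $\mathcal L_V\alpha=k\alpha$; then $\omega_0$ has weight $-2$ and $\operatorname{Ric}(\omega_0)$ has weight $0$. For a formal sum $\omega=\omega_0+\cdots$ of real $(1,1)$-forms of integral weights $\ge -2$ with lowest part $\omega_0$, $\log(\omega^n/\omega_0^n)$ denotes the formal logarithm of the formal series $\omega^n/\omega_0^n=1+\cdots$, and $\operatorname{Ric}(\omega)=\operatorname{Ric}(\omega_0)-\sqrt{-1}\,\partial\bar\partial\log(\omega^n/\omega_0^n)$.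 An equation holds formally if the parts of each weight agree. (1) Let $c_0,c_1,c_2,\dots$ be smooth real functions on $E'$ with $\mathcal L_Vc_k=kc_k$. There is a unique formal expansion $u(t)\sim\sum_{k\ge 0}u_{(k)}(t)$, $t\ge 0$, with each $u_{(k)}$ a smooth real function on $[0,\infty)\times E'$, $\mathcal L_Vu_{(k)}(t)=k\,u_{(k)}(t)$ and $u_{(k)}(0)=c_k$, that formally satisfies $$\frac{\partial u}{\partial t}=\log\frac{\left(\omega_0-t\operatorname{Ric}(\omega_0)+\sqrt{-1}\,\partial\bar\partial u\right)^n}{\omega_0^n}.\qquad(*)$$ (2) There is a formal expansion $v\sim\sum_{k>0}v_{(k)}$, with $v_{(k)}$ smooth and real on $E'$ and $\mathcal L_Vv_{(k)}=kv_{(k)}$, so that $\omega=\omega_0-\operatorname{Ric}(\omega_0)+\sqrt{-1}\,\partial\bar\partial v$ formally satisfies the expanding soliton equation $\operatorname{Ric}(\omega)+\tfrac12\mathcal L_V\omega=-\omega$; the form $\omega$ is unique, and $v$ itself is unique if $n\ge 2$. The expansion $v$ can be chosen so that the soliton is a gradient soliton: $i_{V^{(1,0)}}\omega=\sqrt{-1}\,\bar\partial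 F$ for a formal sum $F$ of smooth real functions of weights $\ge -2$; moreover, for this $v$, the following holds. For every formal solution $u$ as in (1), with any initial data, the blowdown limit $u^\infty(w,z,t)=\lim_{s\to\infty}s^{-2}u(w,s^{-1}z,s^2t)$ exists: for each $k$, the functions $s^{-2}u_{(k)}(w,s^{-1}z,s^2t)$ converge, with all derivatives in time and space and uniformly on compact subsets of $[0,\infty)\times E'$, to a function $u^\infty_{(k)}$. The expansion $u^\infty\sim\sum_k u^\infty_{(k)}$ does not depend on $u$, is itself a formal solution of $(*)$ as in (1), and equals the flow generated by the formal gradient expanding soliton $\omega$: for all $t>0$, $$u^\infty_{(k)}(t)=t\,\delta_{\sqrt t}^*v_{(k)}\ (k>0),\qquad u^\infty_{(0)}(t)=0,\qquad \omega_0-t\operatorname{Ric}(\omega_0)+\sqrt{-1}\,\partial\bar\partial u^\infty(t)=t\,\delta_{\sqrt t}^*\omega .$$ In particular $\omega_0-\operatorname{Ric}(\omega_0)+\sqrt{-1}\,\partial\bar\partial u^\infty(1)=\omega$. -/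

import Mathlib

open Set Filter Topology Bundle
open scoped Manifold ContDiff ComplexOrder

noncomputable section

namespace FormalKRF

/-! ### Wirtinger calculus on a complex vector space -/

section Wirtinger

variable {V : Type*} [NormedAddCommGroup V] [NormedSpace ℝ V] [NormedSpace ℂ V]

/-- The derivative of type `(1,0)` of `f` in the direction `v`, that is, `½ (D_v - √-1 D_{√-1 v}) f`.
If `v` is the `j`-th coordinate vector, this is `∂f/∂z^j`. -/
def dWirt (f : V → ℂ) (v x : V) : ℂ :=
  (1 / 2 : ℂ) * (fderiv ℝ f x v - Complex.I * fderiv ℝ f x (Complex.I • v))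

/-- The derivative of type `(0,1)` of `f` in the direction `v`.
If `v` is the `j`-th coordinate vector, this is `∂f/∂z̄^j`. -/
def dbarWirt (f : V → ℂ) (v x : V) : ℂ :=
  (1 / 2 : ℂ) * (fderiv ℝ f x v + Complex.I * fderiv ℝ f x (Complex.I • v))

/-- The complex Hessian `(∂² f / ∂z^i ∂z̄^j)_{ij}` with respect to the vectors `b i`; these are the
components of `√-1 ∂∂̄ f = √-1 ∑ f_{i j̄} dz^i ∧ dz̄^j`. -/
def ddbar {ι : Type*} (b : ι → V) (f : V → ℂ) (x : V) : Matrix ι ι ℂ :=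
  Matrix.of fun i j => dWirt (fun y => dbarWirt f (b j) y) (b i) x

end Wirtinger

/-! ### Coordinates `(w, z)`, with `w ∈ ℂ^d` and `z ∈ ℂ` -/

/-- The space of the coordinates `(w¹, …, w^d, z)`. -/
abbrev Coord (d : ℕ) : Type := EuclideanSpace ℂ (Fin d) × ℂ

/-- The index set of the `d + 1` coordinates: `inl α` for `w^α` and `inr ()` for `z`. -/
abbrev Idx (d : ℕ) : Type := Fin d ⊕ Unit

/-- The coordinate vectors. -/
def dir (d : ℕ) : Idx d → Coord d
  | Sum.inl α => (EuclideanSpace.single α 1, 0)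
  | Sum.inr _ => (0, 1)

/-- Component matrices of (1,1)-forms: `G` represents `√-1 ∑ G_{i j̄} dx^i ∧ dx̄^j`. -/
abbrev Form (d : ℕ) : Type := Coord d → Matrix (Idx d) (Idx d) ℂ

/-- The weight of `dx^i` under `z ↦ r z`. -/
def idxWeight (d : ℕ) : Idx d → ℕ
  | Sum.inl _ => 0
  | Sum.inr _ => 1

/-- The pullback of a (1,1)-form under the dilation `(w, z) ↦ (w, r z)`, `r` real. -/
def dilatePullback {d : ℕ} (r : ℝ) (G : Form d) : Form d := fun x =>
  Matrix.of fun i j => (r : ℂ) ^ (idxWeight d i + idxWeight d j) * G (x.1, (r : ℂ) * x.2) i j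

/-- The Lie derivative of a (1,1)-form along `V = z ∂_z + z̄ ∂_z̄`, whose flow is
`(w, z) ↦ (w, e^s z)`. -/
def lieForm {d : ℕ} (G : Form d) : Form d := fun x =>
  Matrix.of fun i j => deriv (fun s : ℝ => dilatePullback (Real.exp s) G x i j) 0

/-! ### Formal (1,1)-forms

A formal form is a sequence `G 0, G 1, G 2, …` of (1,1)-forms, where `G a` is the part of weight
`a - 2` with respect to `L_V`. Relative to the leading part `G 0`, the part `G a` has weight `a`. -/

/-- The formal volume ratio `ω^n / ω_0^n = det (∑_a G_a) / det G_0` at `x`, graded by weight. -/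
def volumeRatio {d : ℕ} (G : ℕ → Form d) (x : Coord d) : PowerSeries ℂ :=
  PowerSeries.C ((G 0 x).det)⁻¹ *
    (Matrix.of fun i j : Idx d => PowerSeries.mk fun a => G a x i j).det

/-- The formal series `log (ω^n / ω_0^n)`, graded by weight; the logarithm is that of a power series
with constant term `1`, that is, the substitution of `f - 1` into the series of `log (1 + X)`. -/
def logVolumeRatio {d : ℕ} (G : ℕ → Form d) (x : Coord d) : PowerSeries ℂ :=
  (PowerSeries.log ℂ).subst (volumeRatio G x - 1)

/-- The Ricci form `-√-1 ∂∂̄ log det g` of a Kähler metric with components `g`. -/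
def ricciForm {d : ℕ} (g : Form d) : Form d := fun x =>
  - ddbar (dir d) (fun y => Complex.log (g y).det) x

/-- The Ricci form `-√-1 ∂∂̄ log det g = Ric(ω_0) - √-1 ∂∂̄ log (ω^n / ω_0^n)` of a formal metric;
the entry `a` is the part of weight `a - 2`. -/
def formalRicci {d : ℕ} (G : ℕ → Form d) : ℕ → Form d
  | 0 => 0
  | 1 => 0
  | k + 2 => fun x => (if k = 0 then ricciForm (G 0) x else 0)
      - ddbar (dir d) (fun y => PowerSeries.coeff k (logVolumeRatio G y)) x

/-! ### The complement of the zero section of a holomorphic line bundle -/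

section Bundle

variable {d : ℕ} {D : Type*} [TopologicalSpace D] [ChartedSpace (EuclideanSpace ℂ (Fin d)) D]
  {E : D → Type*} [∀ x, AddCommGroup (E x)] [∀ x, Module ℂ (E x)] [∀ x, TopologicalSpace (E x)]
  [TopologicalSpace (TotalSpace ℂ E)] [FiberBundle ℂ E]

variable (d E) in
/-- Local holomorphic coordinates for the total space of `E`: a coordinate chart of `D` together
with a local holomorphic trivialization of `E`. -/
structure LocalCoord where
  /-- the chart of the base -/
  chart : OpenPartialHomeomorph D (EuclideanSpace ℂ (Fin d))
  chart_mem : chart ∈ atlas (EuclideanSpace ℂ (Fin d)) D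
  /-- the trivialization of the bundle -/
  triv : Trivialization ℂ (TotalSpace.proj : TotalSpace ℂ E → D)
  triv_mem : MemTrivializationAtlas triv

/-- The point of the total space with coordinates `(w, z)`. -/
def LocalCoord.param (c : LocalCoord d E) (x : Coord d) : TotalSpace ℂ E :=
  ⟨c.chart.symm x.1, c.triv.symm (c.chart.symm x.1) x.2⟩

/-- The domain of `param` over the complement of the zero section: `z ≠ 0`. -/
def LocalCoord.dom (c : LocalCoord d E) : Set (Coord d) :=
  {x | x.1 ∈ c.chart.target ∧ c.chart.symm x.1 ∈ c.triv.baseSet ∧ x.2 ≠ 0}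

/-- A real function on the total space, read in coordinates (as a complex-valued function). -/
def LocalCoord.pull (c : LocalCoord d E) (f : TotalSpace ℂ E → ℝ) : Coord d → ℂ :=
  fun x => ((f (c.param x) : ℝ) : ℂ)

/-- Fibrewise multiplication by a real number. -/
def dilate (r : ℝ) (p : TotalSpace ℂ E) : TotalSpace ℂ E := ⟨p.1, (r : ℂ) • p.2⟩

/-- The function `f` is (real) smooth on the complement of the zero section. -/
def IsSmooth (d : ℕ) [ChartedSpace (EuclideanSpace ℂ (Fin d)) D] (f : TotalSpace ℂ E → ℝ) : Prop :=
  ∀ c : LocalCoord d E, ContDiffOn ℝ ∞ (fun x => f (c.param x)) c.dom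

/-- The function `f` is smooth on `[0, ∞)` times the complement of the zero section. -/
def IsSmoothInTime (d : ℕ) [ChartedSpace (EuclideanSpace ℂ (Fin d)) D]
    (f : ℝ → TotalSpace ℂ E → ℝ) : Prop :=
  ∀ c : LocalCoord d E,
    ContDiffOn ℝ ∞ (fun q : ℝ × Coord d => f q.1 (c.param q.2)) (Ici 0 ×ˢ c.dom)

/-- `L_V f = k f` on the complement of the zero section, for `V = z ∂_z + z̄ ∂_z̄`. -/
def HasWeight (k : ℕ) (f : TotalSpace ℂ E → ℝ) : Prop :=
  ∀ p : TotalSpace ℂ E, p.2 ≠ 0 →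
    deriv (fun s : ℝ => f (dilate (Real.exp s) p)) 0 = (k : ℝ) * f p

/-- Convergence `F s → f`, as `s → ∞`, in `C^∞` on compact subsets of `[0, ∞)` times the complement
of the zero section: all derivatives in time and space converge locally uniformly. -/
def TendstoSmoothly (d : ℕ) [ChartedSpace (EuclideanSpace ℂ (Fin d)) D]
    (F : ℝ → ℝ → TotalSpace ℂ E → ℝ) (f : ℝ → TotalSpace ℂ E → ℝ) : Prop :=
  ∀ (c : LocalCoord d E) (m : ℕ),
    TendstoLocallyUniformlyOn
      (fun s => iteratedFDerivWithin ℝ m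
        (fun q : ℝ × Coord d => F s q.1 (c.param q.2)) (Ici 0 ×ˢ c.dom))
      (iteratedFDerivWithin ℝ m
        (fun q : ℝ × Coord d => f q.1 (c.param q.2)) (Ici 0 ×ˢ c.dom))
      atTop (Ici 0 ×ˢ c.dom)

variable (d E) in
/-- A smooth Hermitian metric on the line bundle `E`, given by its squared norm
`v ↦ |v|_h^2`. -/
structure HermitianMetric where
  /-- the squared norm -/
  normSq : TotalSpace ℂ E → ℝ
  normSq_pos : ∀ p : TotalSpace ℂ E, p.2 ≠ 0 → 0 < normSq p
  normSq_smul : ∀ (x : D) (a : ℂ) (v : E x), normSq ⟨x, a • v⟩ = ‖a‖ ^ 2 * normSq ⟨x, v⟩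
  smooth : IsSmooth d normSq

namespace HermitianMetric

variable (h : HermitianMetric d E)

/-- The curvature form `ω_D = √-1 F = -√-1 ∂∂̄ log |σ|_h^2` is positive, where `σ` is the local
holomorphic section `z = 1`. -/
def IsPositive : Prop :=
  ∀ (c : LocalCoord d E) (w : EuclideanSpace ℂ (Fin d)), (w, (1 : ℂ)) ∈ c.dom →
    (- ddbar (fun α : Fin d => EuclideanSpace.single α (1 : ℂ))
      (fun w' => ((Real.log (h.normSq (c.param (w', 1))) : ℝ) : ℂ)) w).PosDef

/-- The cone form `ω_0 = √-1 ∂∂̄ |S|_h^{-2}`. -/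
def omega0 (c : LocalCoord d E) : Form d :=
  ddbar (dir d) (c.pull fun p => (h.normSq p)⁻¹)

/-- The formal form `ω_0 - t Ric(ω_0) + √-1 ∂∂̄ ∑_{k ≥ 0} u_(k)`; entry `a` has weight `a - 2`. -/
def formalForm (c : LocalCoord d E) (t : ℝ) (u : ℕ → TotalSpace ℂ E → ℝ) : ℕ → Form d
  | 0 => h.omega0 c
  | 1 => 0
  | k + 2 => fun x => (if k = 0 then - (t : ℂ) • ricciForm (h.omega0 c) x else 0)
      + ddbar (dir d) (c.pull (u k)) x

/-- `∑_{k ≥ 0} u_(k)(t)`, `t ≥ 0`, with `L_V u_(k) = k u_(k)`, formally satisfies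
`∂u/∂t = log ((ω_0 - t Ric(ω_0) + √-1 ∂∂̄ u)^n / ω_0^n)`: the parts of each weight `k` agree. -/
structure IsFormalPotentialFlow (u : ℕ → ℝ → TotalSpace ℂ E → ℝ) : Prop where
  smooth : ∀ k, IsSmoothInTime d (u k)
  weight : ∀ k, ∀ t : ℝ, 0 ≤ t → HasWeight k (u k t)
  flow : ∀ k, ∀ t : ℝ, 0 ≤ t → ∀ (c : LocalCoord d E), ∀ x ∈ c.dom,
    HasDerivWithinAt (fun τ : ℝ => ((u k τ (c.param x) : ℝ) : ℂ))
      (PowerSeries.coeff k (logVolumeRatio (h.formalForm c t fun j => u j t) x)) (Ici 0) t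

/-- `v = ∑_{k > 0} v_(k)`, with `L_V v_(k) = k v_(k)`, is such that
`ω = ω_0 - Ric(ω_0) + √-1 ∂∂̄ v` formally satisfies the expanding soliton equation
`Ric(ω) + ½ L_V ω = -ω`. -/
structure IsFormalExpandingSoliton (v : ℕ → TotalSpace ℂ E → ℝ) : Prop where
  zero : ∀ p : TotalSpace ℂ E, p.2 ≠ 0 → v 0 p = 0
  smooth : ∀ k, IsSmooth d (v k)
  weight : ∀ k, HasWeight k (v k)
  soliton : ∀ (c : LocalCoord d E), ∀ x ∈ c.dom, ∀ a : ℕ,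
    formalRicci (h.formalForm c 1 v) a x + (1 / 2 : ℂ) • lieForm (h.formalForm c 1 v a) x
      = - h.formalForm c 1 v a x

/-- The formal soliton `ω = ω_0 - Ric(ω_0) + √-1 ∂∂̄ v` is a gradient soliton: there is a formal
real function `F = ∑_a F_a`, with `F_a` of weight `a - 2`, so that
`i_{V^{(1,0)}} ω = √-1 ∂̄ F`, where `V^{(1,0)} = z ∂_z`. -/
def IsGradient (v : ℕ → TotalSpace ℂ E → ℝ) : Prop :=
  ∃ F : ℕ → TotalSpace ℂ E → ℝ,
    (∀ a, IsSmooth d (F a)) ∧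
    (∀ a, ∀ p : TotalSpace ℂ E, p.2 ≠ 0 →
      deriv (fun s : ℝ => F a (dilate (Real.exp s) p)) 0 = ((a : ℝ) - 2) * F a p) ∧
    ∀ (c : LocalCoord d E), ∀ x ∈ c.dom, ∀ (a : ℕ) (j : Idx d),
      x.2 * h.formalForm c 1 v a x (Sum.inr ()) j = dbarWirt (c.pull (F a)) (dir d j) x

end HermitianMetric

end Bundle

end FormalKRF

end

set_option linter.unusedSectionVars false

noncomputable section

namespace FormalKRF

/-! ### Graded families of power series -/

section LogRatio

variable {ι : Type*} [Fintype ι] [DecidableEq ι]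

/-! The proof rests on a triangular structure. The potential `u_(j)` enters the formal form only in
entry `j + 2`, and the coefficient of weight `k` of the logarithm of the volume ratio involves only
the entries up to `k` (`logRatio_congr_coeff`). Hence `∂u_(k)/∂t` is determined by the `u_(j)` with
`j + 2 ≤ k`, and the flow is solved uniquely by successive integrations in time.

Determinant and logarithm respect every multiplicative grading of the entries. `IsGraded.logRatio`
proves this once. Different gradings then give truncation, scaling, reality, and polynomial
dependence on time. With the transformation laws of `√-1 ∂∂̄` and of the Ricci form, the scaling
case shows that the right-hand side of the flow does not depend on the coordinates and that the flow
has symmetries: two flows related at time `0` by a fibre multiplication and a rescaling of time and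
potentials stay so related (`IsPotentialFlow.symmetry`). Uniqueness and preservation of the weights
are special cases.

The zero initial condition is fixed by all parabolic scalings and by rotations, so its flow is
self-similar: `u(t) = t δ_{√t}^* u(1)`. Put `v = u(1)`. Then `u_(k)(t) = t^{1 + k/2} v_(k)`, and the
flow equation at `t = 1` says that the logarithm has weight `k` part `(k + 2)/2 · v_(k)`. Applying
`√-1 ∂∂̄` yields the soliton equation, which in entry `a` reads `Ric_a = -(a/2) ω_a`. As `Ric_a`
depends only on lower entries, this also determines `ω`. Rotation invariance and Euler's identity `z
∂_z f = (m/2) f` for weight `m` give the gradient property.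

For uniqueness of `v`, the difference of two potentials is pluriharmonic of weight `k > 0`. If such
an `f` were positive somewhere, compactness of the base would give a largest value `M` of `f
|S|^{-k}`, and `M |S|^k - f` would have a minimum. But its complex Hessian is negative on a vector
annihilated by `∂ log |S|^2`, because the curvature is positive (`nonpos_of_pluriharmonic`). Such a
vector needs a base direction, hence `n ≥ 2`.

For the blowdown, `u_(k)` is a polynomial in time of degree at most `(k + 2)/2`, and any coefficient
of degree exactly `(k + 2)/2` is the same for all flows (`IsPotentialFlow.isTimePoly`). Blowing down
multiplies the coefficient of `t^i` by `s^{2i - k - 2}`, so the difference from the self-similar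
flow is a finite sum of fixed smooth functions with factors tending to `0`. -/

/-- The logarithm of the formal ratio `det (∑ M_a X^a) / det M_0`. -/
def logRatio (M : ℕ → Matrix ι ι ℂ) : PowerSeries ℂ :=
  (PowerSeries.log ℂ).subst
    (PowerSeries.C ((M 0).det)⁻¹ *
      (Matrix.of fun i j : ι => PowerSeries.mk fun a => M a i j).det - 1)

theorem logVolumeRatio_eq_logRatio {d : ℕ} (G : ℕ → Form d) (x : Coord d) :
    logVolumeRatio G x = logRatio fun a => G a x := rfl

/-- A family of power series is graded by `S` if its `k`-th coefficients form an element of `S k`. -/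
def IsGraded {T : Type*} (S : ℕ → Submodule ℝ (T → ℂ)) (F : T → PowerSeries ℂ) : Prop :=
  ∀ k, (fun τ => PowerSeries.coeff k (F τ)) ∈ S k

namespace IsGraded

variable {T : Type*} {S : ℕ → Submodule ℝ (T → ℂ)} {F G : T → PowerSeries ℂ}

theorem sub (hF : IsGraded S F) (hG : IsGraded S G) : IsGraded S fun τ => F τ - G τ := fun k => by
  have := (S k).sub_mem (hF k) (hG k)
  convert this using 1
  ext τ
  simp

theorem zsmul (n : ℤ) (hF : IsGraded S F) : IsGraded S fun τ => n • F τ := fun k => by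
  have := zsmul_mem (hF k) n
  convert this using 1
  ext τ
  simp only [map_zsmul, Pi.smul_apply]

theorem sum {α : Type*} {s : Finset α} {F : α → T → PowerSeries ℂ}
    (hF : ∀ i ∈ s, IsGraded S (F i)) : IsGraded S fun τ => ∑ i ∈ s, F i τ := fun k => by
  have := (S k).sum_mem fun i hi => hF i hi k
  convert this using 1
  ext τ
  simp

theorem C {c : T → ℂ} (hc : c ∈ S 0) : IsGraded S fun τ => PowerSeries.C (c τ) := fun k => by
  rcases Nat.eq_zero_or_pos k with rfl | hk
  · convert hc using 1
    ext τ
    simp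
  · convert (S k).zero_mem using 1
    ext τ
    simp [PowerSeries.coeff_C, hk.ne']

variable [SetLike.GradedMonoid S]

theorem one : IsGraded S fun _ : T => (1 : PowerSeries ℂ) := fun k => by
  rcases Nat.eq_zero_or_pos k with rfl | hk
  · convert (SetLike.GradedOne.one_mem : (1 : T → ℂ) ∈ S 0) using 1
    ext τ
    simp
  · convert (S k).zero_mem using 1
    ext τ
    simp [PowerSeries.coeff_one, hk.ne']

theorem mul (hF : IsGraded S F) (hG : IsGraded S G) : IsGraded S fun τ => F τ * G τ := fun k => by
  have := Submodule.sum_mem (S k) (t := Finset.HasAntidiagonal.antidiagonal k)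
    (f := fun p : ℕ × ℕ => (fun τ => PowerSeries.coeff p.1 (F τ)) * (fun τ => PowerSeries.coeff p.2 (G τ)))
    fun p hp => by
      rw [Finset.HasAntidiagonal.mem_antidiagonal] at hp
      rw [← hp]
      exact SetLike.GradedMul.mul_mem (hF _) (hG _)
  convert this using 1
  ext τ
  simp [PowerSeries.coeff_mul]

theorem pow (hF : IsGraded S F) (n : ℕ) : IsGraded S fun τ => F τ ^ n := by
  induction n with
  | zero => simpa using one
  | succ n ih => simpa [pow_succ] using ih.mul hF

theorem prod {α : Type*} {s : Finset α} {F : α → T → PowerSeries ℂ}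
    (hF : ∀ i ∈ s, IsGraded S (F i)) : IsGraded S fun τ => ∏ i ∈ s, F i τ := by
  classical
  induction s using Finset.induction_on with
  | empty => simpa using one
  | insert a s ha ih =>
    simp only [Finset.prod_insert ha]
    exact (hF a (by simp)).mul (ih fun i hi => hF i (by simp [hi]))

theorem det {A : T → Matrix ι ι (PowerSeries ℂ)} (hA : ∀ i j, IsGraded S fun τ => A τ i j) :
    IsGraded S fun τ => (A τ).det := by
  simp only [Matrix.det_apply, Units.smul_def]
  exact sum fun σ _ => (prod fun i _ => hA _ _).zsmul _

/-- The `n`-th power of a series without constant term starts in degree `n`, so each coefficient is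
a finite sum. The Taylor coefficients of `log (1 + X)` are written as real numbers since the
gradings are only real subspaces; `conjGrading` is not closed under complex scalars. -/
theorem subst_log (hF : IsGraded S F) (h0 : ∀ τ, PowerSeries.constantCoeff (F τ) = 0) :
    IsGraded S fun τ => (PowerSeries.log ℂ).subst (F τ) := fun k => by
  have key : ∀ τ, PowerSeries.coeff k ((PowerSeries.log ℂ).subst (F τ)) =
      ∑ n ∈ Finset.range (k + 1),
        (if n = 0 then 0 else ((-1 : ℝ) ^ (n + 1) / n)) • PowerSeries.coeff k (F τ ^ n) := by
    intro τ
    rw [PowerSeries.coeff_subst' (PowerSeries.HasSubst.of_constantCoeff_zero' (h0 τ))]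
    rw [finsum_eq_sum_of_support_subset (s := Finset.range (k + 1))]
    · refine Finset.sum_congr rfl fun n _ => ?_
      rw [PowerSeries.coeff_log]
      split_ifs <;> simp
    · intro n hn
      by_contra hk
      simp only [Finset.coe_range, mem_Iio, not_lt] at hk
      apply hn
      have : PowerSeries.X ^ n ∣ F τ ^ n := pow_dvd_pow_of_dvd (PowerSeries.X_dvd_iff.2 (h0 τ)) n
      simp [PowerSeries.X_pow_dvd_iff.1 this k (by omega)]
  have := (S k).sum_mem (t := Finset.range (k + 1)) fun n _ =>
    (S k).smul_mem (if n = 0 then 0 else ((-1 : ℝ) ^ (n + 1) / n)) (hF.pow n k)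
  convert this using 1
  ext τ
  rw [key, Finset.sum_apply]
  rfl

/-- Apart from the inverse of `det M_0`, only sums and products of entries occur in each
coefficient. With `T = Bool`, membership in `S k` encodes a relation between two series; with times
and points in `T`, it encodes regularity. -/
theorem logRatio {M : T → ℕ → Matrix ι ι ℂ} (hM : ∀ a i j, (fun τ => M τ a i j) ∈ S a)
    (hinv : (fun τ => ((M τ 0).det)⁻¹) ∈ S 0) (hdet : ∀ τ, (M τ 0).det ≠ 0) :
    IsGraded S fun τ => logRatio (M τ) := by
  refine subst_log (((C hinv).mul (det fun i j k => ?_)).sub one) fun τ => ?_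
  · simpa using hM k i j
  · have : PowerSeries.constantCoeff (Matrix.det (Matrix.of fun i j : ι =>
        PowerSeries.mk fun a => M τ a i j)) = (M τ 0).det := by
      rw [RingHom.map_det]
      congr 1
    simp [this, hdet τ]

end IsGraded

/-- The grading of functions on two points given by `f true = r ^ k * f false`. -/
def scalingGrading (r : ℝ) (k : ℕ) : Submodule ℝ (Bool → ℂ) where
  carrier := {f | f true = (r : ℂ) ^ k * f false}
  add_mem' {f g} hf hg := by simp_all [mul_add]
  zero_mem' := by simp
  smul_mem' c f hf := by
    simp only [mem_ofPred_eq, Pi.smul_apply, Complex.real_smul] at *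
    rw [hf]
    ring

instance (r : ℝ) : SetLike.GradedMonoid (scalingGrading r) where
  one_mem := by simp [scalingGrading]
  mul_mem i j f g hf hg := by
    simp only [scalingGrading, Submodule.mem_mk, AddSubmonoid.mem_mk, AddSubsemigroup.mem_mk,
      mem_ofPred_eq, Pi.mul_apply] at *
    rw [hf, hg]
    ring

/-- The filtration of functions on two points given by `f true = f false` for `k ≤ N`. -/
def truncationGrading (N k : ℕ) : Submodule ℝ (Bool → ℂ) where
  carrier := {f | k ≤ N → f true = f false}
  add_mem' {f g} hf hg := fun h => by simp [hf h, hg h]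
  zero_mem' := by simp
  smul_mem' c f hf := fun h => by simp [hf h]

instance (N : ℕ) : SetLike.GradedMonoid (truncationGrading N) where
  one_mem := by simp [truncationGrading]
  mul_mem i j f g hf hg := by
    intro h
    simp [hf (by omega), hg (by omega)]

/-- The functions on two points with `f true` conjugate to `f false`. -/
def conjGrading (_ : ℕ) : Submodule ℝ (Bool → ℂ) where
  carrier := {f | f true = star (f false)}
  add_mem' {f g} hf hg := by simp_all
  zero_mem' := by simp
  smul_mem' c f hf := by simp_all

instance : SetLike.GradedMonoid conjGrading where
  one_mem := by simp [conjGrading]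
  mul_mem i j f g hf hg := by simp_all [conjGrading]

/-- Source of the triangular structure: products of total weight at most `k` have factors of weight
at most `k`, so later entries are invisible. -/
theorem logRatio_congr_coeff {M N : ℕ → Matrix ι ι ℂ} {k : ℕ} (h0 : (M 0).det ≠ 0)
    (h : ∀ a ≤ k, M a = N a) :
    PowerSeries.coeff k (logRatio M) = PowerSeries.coeff k (logRatio N) := by
  refine IsGraded.logRatio (S := truncationGrading k) (M := fun b => bif b then M else N)
    (fun a i j => ?_) (fun _ => ?_) (fun b => ?_) k le_rfl
  · intro ha
    simp [h a ha]
  · simp [h 0 (Nat.zero_le _)]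
  · cases b <;> simp [← h 0 (Nat.zero_le _), h0]

/-- The constants `det A` and `det B` cancel between `det (∑ M_a X^a)` and `det M_0`. -/
theorem logRatio_mul_mul {M : ℕ → Matrix ι ι ℂ} {A B : Matrix ι ι ℂ} (hA : A.det ≠ 0)
    (hB : B.det ≠ 0) : logRatio (fun a => A * M a * B) = logRatio M := by
  unfold logRatio
  congr 2
  have : (Matrix.of fun i j : ι => PowerSeries.mk fun a => (A * M a * B) i j) =
      A.map PowerSeries.C * (Matrix.of fun i j : ι => PowerSeries.mk fun a => M a i j) *
        B.map PowerSeries.C := by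
    ext i j k
    simp [Matrix.mul_apply, PowerSeries.coeff_mul_C, PowerSeries.coeff_C_mul]
  rw [this]
  have hC : ∀ N : Matrix ι ι ℂ, (N.map PowerSeries.C).det = PowerSeries.C N.det := fun N =>
    ((PowerSeries.C (R := ℂ)).map_det N).symm
  simp only [Matrix.det_mul, hC, mul_inv, map_mul]
  have h1 : PowerSeries.C A.det⁻¹ * PowerSeries.C A.det = 1 := by
    rw [← map_mul, inv_mul_cancel₀ hA, map_one]
  have h2 : PowerSeries.C B.det⁻¹ * PowerSeries.C B.det = 1 := by
    rw [← map_mul, inv_mul_cancel₀ hB, map_one]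
  linear_combination (PowerSeries.C (M 0).det⁻¹ * (Matrix.of fun i j : ι =>
      PowerSeries.mk fun a => M a i j).det) * (PowerSeries.C B.det⁻¹ * PowerSeries.C B.det * h1
      + h2)

/-- Constant matrices on both sides cancel in the ratio, and the factors `r ^ a` act as the
substitution `X ↦ r X`. Dilations, rotations and coordinate changes are all instances, with `A` and
`B` built from a Jacobian matrix. -/
theorem coeff_logRatio_of_scaling {M N : ℕ → Matrix ι ι ℂ} {A B : Matrix ι ι ℂ} {r : ℝ} {k : ℕ}
    (hA : A.det ≠ 0) (hB : B.det ≠ 0) (h0 : (M 0).det ≠ 0)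
    (h : ∀ a ≤ k, (r : ℂ) ^ a • M a = A * N a * B) :
    PowerSeries.coeff k (logRatio N) = (r : ℂ) ^ k * PowerSeries.coeff k (logRatio M) := by
  have hN0 : (N 0).det ≠ 0 := by
    have := h 0 (Nat.zero_le _)
    rw [pow_zero, one_smul] at this
    intro hz
    apply h0
    rw [this, Matrix.det_mul, Matrix.det_mul, hz]
    ring
  rw [← logRatio_mul_mul hA hB,
    logRatio_congr_coeff (N := fun a => (r : ℂ) ^ a • M a) (by simp [hA, hB, hN0])
      fun a ha => (h a ha).symm]
  refine IsGraded.logRatio (S := scalingGrading r)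
    (M := fun b => bif b then (fun a => (r : ℂ) ^ a • M a) else M)
    (fun a i j => ?_) ?_ (fun b => ?_) k
  · simp [scalingGrading]
  · simp [scalingGrading]
  · cases b <;> simp [h0]

theorem logRatio_transpose (M : ℕ → Matrix ι ι ℂ) :
    logRatio (fun a => (M a).transpose) = logRatio M := by
  unfold logRatio
  rw [Matrix.det_transpose, ← Matrix.det_transpose (Matrix.of _)]
  rfl

/-- Conjugating the entries of a Hermitian matrix transposes it, and transposition does not change
determinants. -/
theorem star_coeff_logRatio {M : ℕ → Matrix ι ι ℂ} (hM : ∀ a, (M a).IsHermitian)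
    (h0 : (M 0).det ≠ 0) (k : ℕ) :
    star (PowerSeries.coeff k (logRatio M)) = PowerSeries.coeff k (logRatio M) := by
  have := IsGraded.logRatio (S := conjGrading)
    (M := fun b => bif b then (fun a => (M a).transpose) else M)
    (fun a i j => ?_) ?_ (fun b => ?_) k
  · simpa [conjGrading, logRatio_transpose] using this.symm
  · simpa [conjGrading] using ((hM a).apply j i).symm
  · simp only [conjGrading, Submodule.mem_mk, AddSubmonoid.mem_mk, AddSubsemigroup.mem_mk,
      mem_ofPred_eq, cond_true, cond_false, Matrix.det_transpose, star_inv₀]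
    rw [← Matrix.det_conjTranspose, (hM 0).eq]
  · cases b <;> simp [h0]

theorem coeff_zero_logRatio {M : ℕ → Matrix ι ι ℂ} (h0 : (M 0).det ≠ 0) :
    PowerSeries.coeff 0 (logRatio M) = 0 := by
  have h : PowerSeries.constantCoeff (PowerSeries.C ((M 0).det)⁻¹ *
      (Matrix.of fun i j : ι => PowerSeries.mk fun a => M a i j).det - 1) = 0 := by
    have : PowerSeries.constantCoeff (Matrix.det (Matrix.of fun i j : ι =>
        PowerSeries.mk fun a => M a i j)) = (M 0).det := by
      rw [RingHom.map_det]
      congr 1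
    simp [this, h0]
  rw [PowerSeries.coeff_zero_eq_constantCoeff_apply]
  exact PowerSeries.constantCoeff_subst_eq_zero h _ PowerSeries.constantCoeff_log

end LogRatio

/-! ### Wirtinger derivatives -/

section WirtingerCalculus

variable {V : Type*} [NormedAddCommGroup V] [NormedSpace ℝ V] [NormedSpace ℂ V]
  {f g : V → ℂ} {U : Set V} {v x : V}

theorem dWirt_congr (h : f =ᶠ[𝓝 x] g) : dWirt f v x = dWirt g v x := by
  simp only [dWirt, h.fderiv_eq]

theorem dbarWirt_congr (h : f =ᶠ[𝓝 x] g) : dbarWirt f v x = dbarWirt g v x := by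
  simp only [dbarWirt, h.fderiv_eq]

theorem eventuallyEq_dbarWirt (h : f =ᶠ[𝓝 x] g) :
    (fun y => dbarWirt f v y) =ᶠ[𝓝 x] fun y => dbarWirt g v y := by
  filter_upwards [h.eventuallyEq_nhds] with y hy using dbarWirt_congr hy

theorem ddbar_congr {ι : Type*} {b : ι → V} (h : f =ᶠ[𝓝 x] g) : ddbar b f x = ddbar b g x := by
  ext i j
  exact dWirt_congr (eventuallyEq_dbarWirt h)

theorem ddbar_congr_of_eqOn {ι : Type*} {b : ι → V} (hU : IsOpen U) (h : EqOn f g U)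
    (hx : x ∈ U) : ddbar b f x = ddbar b g x :=
  ddbar_congr (h.eventuallyEq_of_mem (hU.mem_nhds hx))

omit [NormedSpace ℂ V] in
theorem differentiableAt_of_contDiffOn {W : Type*} [NormedAddCommGroup W] [NormedSpace ℝ W]
    {f : V → W} (hf : ContDiffOn ℝ ∞ f U) (hU : IsOpen U)
    (hx : x ∈ U) : DifferentiableAt ℝ f x :=
  (hf.contDiffAt (hU.mem_nhds hx)).differentiableAt (by simp)

omit [NormedSpace ℂ V] in
theorem contDiffOn_fderiv_apply_of_isOpen {W : Type*} [NormedAddCommGroup W] [NormedSpace ℝ W]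
    {f : V → W} (hf : ContDiffOn ℝ ∞ f U) (hU : IsOpen U) (v : V) :
    ContDiffOn ℝ ∞ (fun y => fderiv ℝ f y v) U :=
  (hf.fderiv_of_isOpen hU (by simp)).clm_apply contDiffOn_const

theorem contDiffOn_dWirt (hf : ContDiffOn ℝ ∞ f U) (hU : IsOpen U) (v : V) :
    ContDiffOn ℝ ∞ (fun y => dWirt f v y) U :=
  contDiffOn_const.mul ((contDiffOn_fderiv_apply_of_isOpen hf hU _).sub
    (contDiffOn_const.mul (contDiffOn_fderiv_apply_of_isOpen hf hU _)))

theorem contDiffOn_dbarWirt (hf : ContDiffOn ℝ ∞ f U) (hU : IsOpen U) (v : V) :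
    ContDiffOn ℝ ∞ (fun y => dbarWirt f v y) U :=
  contDiffOn_const.mul ((contDiffOn_fderiv_apply_of_isOpen hf hU _).add
    (contDiffOn_const.mul (contDiffOn_fderiv_apply_of_isOpen hf hU _)))

theorem contDiffOn_ddbar {ι : Type*} {b : ι → V} (hf : ContDiffOn ℝ ∞ f U) (hU : IsOpen U)
    (i j : ι) : ContDiffOn ℝ ∞ (fun y => ddbar b f y i j) U :=
  contDiffOn_dWirt (contDiffOn_dbarWirt hf hU _) hU _

@[simp] theorem dWirt_const (c : ℂ) : dWirt (fun _ => c) v x = 0 := by simp [dWirt]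

@[simp] theorem dbarWirt_const (c : ℂ) : dbarWirt (fun _ => c) v x = 0 := by simp [dbarWirt]

theorem dWirt_add (hf : DifferentiableAt ℝ f x) (hg : DifferentiableAt ℝ g x) :
    dWirt (fun y => f y + g y) v x = dWirt f v x + dWirt g v x := by
  simp only [dWirt, fderiv_fun_add hf hg, add_apply]
  ring

theorem dbarWirt_add (hf : DifferentiableAt ℝ f x) (hg : DifferentiableAt ℝ g x) :
    dbarWirt (fun y => f y + g y) v x = dbarWirt f v x + dbarWirt g v x := by
  simp only [dbarWirt, fderiv_fun_add hf hg, add_apply]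
  ring

theorem dWirt_mul (hf : DifferentiableAt ℝ f x) (hg : DifferentiableAt ℝ g x) :
    dWirt (fun y => f y * g y) v x = f x * dWirt g v x + g x * dWirt f v x := by
  simp only [dWirt, fderiv_fun_mul hf hg, add_apply,
    smul_apply, smul_eq_mul]
  ring

theorem dbarWirt_mul (hf : DifferentiableAt ℝ f x) (hg : DifferentiableAt ℝ g x) :
    dbarWirt (fun y => f y * g y) v x = f x * dbarWirt g v x + g x * dbarWirt f v x := by
  simp only [dbarWirt, fderiv_fun_mul hf hg, add_apply,
    smul_apply, smul_eq_mul]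
  ring

theorem dWirt_const_mul (c : ℂ) (hf : DifferentiableAt ℝ f x) :
    dWirt (fun y => c * f y) v x = c * dWirt f v x := by
  rw [dWirt_mul (differentiableAt_const c) hf]
  simp

theorem dbarWirt_const_mul (c : ℂ) (hf : DifferentiableAt ℝ f x) :
    dbarWirt (fun y => c * f y) v x = c * dbarWirt f v x := by
  rw [dbarWirt_mul (differentiableAt_const c) hf]
  simp

theorem dWirt_sum {α : Type*} {s : Finset α} {f : α → V → ℂ}
    (hf : ∀ i ∈ s, DifferentiableAt ℝ (f i) x) :
    dWirt (fun y => ∑ i ∈ s, f i y) v x = ∑ i ∈ s, dWirt (f i) v x := by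
  simp only [dWirt, fderiv_fun_sum hf, sum_apply, Finset.mul_sum,
    ← Finset.sum_sub_distrib]

theorem dbarWirt_sum {α : Type*} {s : Finset α} {f : α → V → ℂ}
    (hf : ∀ i ∈ s, DifferentiableAt ℝ (f i) x) :
    dbarWirt (fun y => ∑ i ∈ s, f i y) v x = ∑ i ∈ s, dbarWirt (f i) v x := by
  simp only [dbarWirt, fderiv_fun_sum hf, sum_apply, Finset.mul_sum,
    ← Finset.sum_add_distrib]

omit [NormedSpace ℂ V] in
theorem fderiv_star_apply (f : V → ℂ) :
    fderiv ℝ (fun y => star (f y)) x v = star (fderiv ℝ f x v) := by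
  rw [fderiv_star]
  rfl

theorem dWirt_star (f : V → ℂ) :
    dWirt (fun y => star (f y)) v x = star (dbarWirt f v x) := by
  simp only [dWirt, dbarWirt, fderiv_star_apply]
  simp
  ring

theorem dbarWirt_star (f : V → ℂ) :
    dbarWirt (fun y => star (f y)) v x = star (dWirt f v x) := by
  simp only [dWirt, dbarWirt, fderiv_star_apply]
  simp

theorem ddbar_add {ι : Type*} {b : ι → V} (hU : IsOpen U) (hf : ContDiffOn ℝ ∞ f U)
    (hg : ContDiffOn ℝ ∞ g U) (hx : x ∈ U) :
    ddbar b (fun y => f y + g y) x = ddbar b f x + ddbar b g x := by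
  ext i j
  simp only [ddbar, Matrix.of_apply, Matrix.add_apply]
  rw [← dWirt_add (differentiableAt_of_contDiffOn (contDiffOn_dbarWirt hf hU _) hU hx)
    (differentiableAt_of_contDiffOn (contDiffOn_dbarWirt hg hU _) hU hx)]
  refine dWirt_congr ?_
  filter_upwards [hU.mem_nhds hx] with y hy
  exact dbarWirt_add (differentiableAt_of_contDiffOn hf hU hy)
    (differentiableAt_of_contDiffOn hg hU hy)

theorem ddbar_const_mul {ι : Type*} {b : ι → V} (hU : IsOpen U) (c : ℂ)
    (hf : ContDiffOn ℝ ∞ f U) (hx : x ∈ U) :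
    ddbar b (fun y => c * f y) x = c • ddbar b f x := by
  ext i j
  simp only [ddbar, Matrix.of_apply, Matrix.smul_apply, smul_eq_mul]
  rw [← dWirt_const_mul c (differentiableAt_of_contDiffOn (contDiffOn_dbarWirt hf hU _) hU hx)]
  refine dWirt_congr ?_
  filter_upwards [hU.mem_nhds hx] with y hy
  exact dbarWirt_const_mul c (differentiableAt_of_contDiffOn hf hU hy)

@[simp] theorem ddbar_const {ι : Type*} {b : ι → V} (c : ℂ) :
    ddbar b (fun _ => c) x = 0 := by
  ext i j
  simp [ddbar]

omit [NormedSpace ℂ V] in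
theorem fderiv_fderiv_apply (hU : IsOpen U) (hf : ContDiffOn ℝ ∞ f U) (hx : x ∈ U) (v w : V) :
    fderiv ℝ (fun y => fderiv ℝ f y v) x w = fderiv ℝ (fderiv ℝ f) x w v := by
  have : DifferentiableAt ℝ (fderiv ℝ f) x :=
    differentiableAt_of_contDiffOn (hf.fderiv_of_isOpen hU (by simp)) hU hx
  rw [fderiv_clm_apply this (differentiableAt_const v)]
  simp

omit [NormedSpace ℂ V] in
theorem fderiv_fderiv_comm (hU : IsOpen U) (hf : ContDiffOn ℝ ∞ f U) (hx : x ∈ U) (v w : V) :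
    fderiv ℝ (fun y => fderiv ℝ f y v) x w = fderiv ℝ (fun y => fderiv ℝ f y w) x v := by
  rw [fderiv_fderiv_apply hU hf hx, fderiv_fderiv_apply hU hf hx]
  exact ((hf.contDiffAt (hU.mem_nhds hx)).isSymmSndFDerivAt
    (by simpa using (mod_cast le_top : ((2 : ℕ∞) : WithTop ℕ∞) ≤ ((⊤ : ℕ∞) : WithTop ℕ∞)))) w v

/-- Treats both operators at once: `c = I` is `∂̄` and `c = -I` is `∂`. -/
theorem dWirt_fderiv_combination (hU : IsOpen U) (hf : ContDiffOn ℝ ∞ f U) (hx : x ∈ U)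
    (c : ℂ) (v w : V) :
    fderiv ℝ (fun y => (1 / 2 : ℂ) * (fderiv ℝ f y v + c * fderiv ℝ f y (Complex.I • v))) x w =
      (1 / 2 : ℂ) * (fderiv ℝ (fun y => fderiv ℝ f y v) x w +
        c * fderiv ℝ (fun y => fderiv ℝ f y (Complex.I • v)) x w) := by
  have h1 := differentiableAt_of_contDiffOn (contDiffOn_fderiv_apply_of_isOpen hf hU v) hU hx
  have h2 := differentiableAt_of_contDiffOn
    (contDiffOn_fderiv_apply_of_isOpen hf hU (Complex.I • v)) hU hx
  rw [fderiv_const_mul (h1.fun_add (h2.const_mul c)), fderiv_fun_add h1 (h2.const_mul c),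
    fderiv_const_mul h2]
  simp [mul_add]

theorem dWirt_dbarWirt_comm (hU : IsOpen U) (hf : ContDiffOn ℝ ∞ f U) (hx : x ∈ U) (v w : V) :
    dWirt (fun y => dbarWirt f v y) w x = dbarWirt (fun y => dWirt f w y) v x := by
  simp only [dWirt, dbarWirt, sub_eq_add_neg, ← neg_mul]
  simp only [dWirt_fderiv_combination hU hf hx]
  rw [fderiv_fderiv_comm hU hf hx v w, fderiv_fderiv_comm hU hf hx (Complex.I • v) w,
    fderiv_fderiv_comm hU hf hx v (Complex.I • w),
    fderiv_fderiv_comm hU hf hx (Complex.I • v) (Complex.I • w)]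
  ring

/-- For real `f`, `∂f` is the conjugate of `∂̄f`; conjugating a mixed derivative therefore exchanges
the two operators, which commute. -/
theorem ddbar_isHermitian {ι : Type*} {b : ι → V} (hU : IsOpen U) (hf : ContDiffOn ℝ ∞ f U)
    (hreal : ∀ y ∈ U, star (f y) = f y) (hx : x ∈ U) : (ddbar b f x).IsHermitian := by
  ext i j
  have h1 : ∀ y ∈ U, ∀ v, dWirt f v y = star (dbarWirt f v y) := fun y hy v => by
    rw [← dWirt_star]
    refine dWirt_congr ?_
    filter_upwards [hU.mem_nhds hy] with z hz using (hreal z hz).symm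
  simp only [Matrix.conjTranspose_apply, ddbar, Matrix.of_apply]
  rw [dWirt_dbarWirt_comm hU hf hx, ← dWirt_star]
  refine dWirt_congr ?_
  filter_upwards [hU.mem_nhds hx] with y hy
  rw [h1 y hy, star_star]

/-- If `dWirt f w` is the multiple `κ / θ` of `f` up to a constant, `θ` holomorphic, then so are
the mixed derivatives. -/
theorem mul_dWirt_dbarWirt_of_euler (hU : IsOpen U) (hf : ContDiffOn ℝ ∞ f U)
    {θ : V → ℂ} (hθ : ∀ y ∈ U, DifferentiableAt ℝ θ y) (hθ' : dbarWirt θ v x = 0) {w : V} {κ c : ℂ}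
    (h : ∀ y ∈ U, θ y * dWirt f w y = κ * f y + c) (hx : x ∈ U) :
    θ x * dWirt (fun y => dbarWirt f v y) w x = κ * dbarWirt f v x := by
  rw [dWirt_dbarWirt_comm hU hf hx]
  have h1 : dbarWirt (fun y => θ y * dWirt f w y) v x = dbarWirt (fun y => κ * f y + c) v x := by
    refine dbarWirt_congr ?_
    filter_upwards [hU.mem_nhds hx] with y hy using h y hy
  have hfx := differentiableAt_of_contDiffOn hf hU hx
  rw [dbarWirt_mul (hθ x hx) (differentiableAt_of_contDiffOn (contDiffOn_dWirt hf hU w) hU hx),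
    dbarWirt_add (hfx.const_mul κ) (differentiableAt_const c), dbarWirt_const_mul κ hfx, hθ'] at h1
  simpa using h1

theorem dWirt_exp (hf : DifferentiableAt ℝ f x) :
    dWirt (fun y => Complex.exp (f y)) v x = Complex.exp (f x) * dWirt f v x := by
  simp only [dWirt]
  rw [hf.hasFDerivAt.cexp.fderiv]
  simp
  ring

theorem dbarWirt_exp (hf : DifferentiableAt ℝ f x) :
    dbarWirt (fun y => Complex.exp (f y)) v x = Complex.exp (f x) * dbarWirt f v x := by
  simp only [dbarWirt]
  rw [hf.hasFDerivAt.cexp.fderiv]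
  simp
  ring

theorem ddbar_exp {ι : Type*} {b : ι → V} (hU : IsOpen U) (hf : ContDiffOn ℝ ∞ f U)
    (hx : x ∈ U) (i j : ι) :
    ddbar b (fun y => Complex.exp (f y)) x i j =
      Complex.exp (f x) * (ddbar b f x i j + dWirt f (b i) x * dbarWirt f (b j) x) := by
  have hfx := differentiableAt_of_contDiffOn hf hU hx
  simp only [ddbar, Matrix.of_apply]
  have : (fun y => dbarWirt (fun y => Complex.exp (f y)) (b j) y) =ᶠ[𝓝 x]
      fun y => Complex.exp (f y) * dbarWirt f (b j) y := by
    filter_upwards [hU.mem_nhds hx] with y hy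
    exact dbarWirt_exp (differentiableAt_of_contDiffOn hf hU hy)
  rw [dWirt_congr this, dWirt_mul hfx.cexp
    (differentiableAt_of_contDiffOn (contDiffOn_dbarWirt hf hU _) hU hx), dWirt_exp hfx]
  ring

variable [IsScalarTower ℝ ℂ V]

theorem complex_smul_eq (c : ℂ) (v : V) : c • v = c.re • v + c.im • (Complex.I • v) := by
  conv_lhs => rw [← Complex.re_add_im c]
  rw [add_smul, mul_smul, ← Complex.coe_algebraMap, algebraMap_smul, algebraMap_smul]

theorem dWirt_smul_right (f : V → ℂ) (c : ℂ) : dWirt f (c • v) x = c * dWirt f v x := by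
  have h : Complex.I • Complex.I • v = -v := by rw [smul_smul]; simp
  rw [dWirt, smul_comm, complex_smul_eq c v, complex_smul_eq c (Complex.I • v), h]
  simp only [dWirt, map_add, map_smul, Complex.real_smul, map_neg]
  conv_rhs => rw [← Complex.re_add_im c]
  linear_combination (1 / 2 : ℂ) * c.im * fderiv ℝ f x (Complex.I • v) * Complex.I_sq

theorem dbarWirt_smul_right (f : V → ℂ) (c : ℂ) :
    dbarWirt f (c • v) x = star c * dbarWirt f v x := by
  have h : dbarWirt f (c • v) x = star (dWirt (fun y => star (f y)) (c • v) x) := by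
    rw [dWirt_star, star_star]
  rw [h, dWirt_smul_right, dWirt_star]
  simp

omit [IsScalarTower ℝ ℂ V] in
theorem dWirt_sum_right {α : Type*} (s : Finset α) (f : V → ℂ) (v : α → V) :
    dWirt f (∑ i ∈ s, v i) x = ∑ i ∈ s, dWirt f (v i) x := by
  simp only [dWirt, Finset.smul_sum, map_sum, Finset.mul_sum, ← Finset.sum_sub_distrib]

omit [IsScalarTower ℝ ℂ V] in
theorem dbarWirt_sum_right {α : Type*} (s : Finset α) (f : V → ℂ) (v : α → V) :
    dbarWirt f (∑ i ∈ s, v i) x = ∑ i ∈ s, dbarWirt f (v i) x := by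
  simp only [dbarWirt, Finset.smul_sum, map_sum, Finset.mul_sum, ← Finset.sum_add_distrib]

theorem dbarWirt_eq_zero (hf : DifferentiableAt ℂ f x) : dbarWirt f v x = 0 := by
  simp only [dbarWirt, hf.fderiv_restrictScalars ℝ, ContinuousLinearMap.coe_restrictScalars',
    map_smul, smul_eq_mul]
  linear_combination (1 / 2 : ℂ) * fderiv ℂ f x v * Complex.I_sq

theorem dWirt_eq_fderiv (hf : DifferentiableAt ℂ f x) : dWirt f v x = fderiv ℂ f x v := by
  simp only [dWirt, hf.fderiv_restrictScalars ℝ, ContinuousLinearMap.coe_restrictScalars',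
    map_smul, smul_eq_mul]
  linear_combination -(1 / 2 : ℂ) * fderiv ℂ f x v * Complex.I_sq

variable {W : Type*} [NormedAddCommGroup W] [NormedSpace ℝ W] [NormedSpace ℂ W]
  [IsScalarTower ℝ ℂ W] {Φ : V → W}

theorem dWirt_comp {f : W → ℂ} (hf : DifferentiableAt ℝ f (Φ x)) (hΦ : DifferentiableAt ℂ Φ x) :
    dWirt (fun y => f (Φ y)) v x = dWirt f (fderiv ℂ Φ x v) (Φ x) := by
  have h := (hf.hasFDerivAt.comp x (hΦ.restrictScalars ℝ).hasFDerivAt).fderiv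
  simp only [dWirt]
  rw [show (fun y => f (Φ y)) = f ∘ Φ from rfl, h, hΦ.fderiv_restrictScalars ℝ]
  simp

theorem dbarWirt_comp {f : W → ℂ} (hf : DifferentiableAt ℝ f (Φ x))
    (hΦ : DifferentiableAt ℂ Φ x) :
    dbarWirt (fun y => f (Φ y)) v x = dbarWirt f (fderiv ℂ Φ x v) (Φ x) := by
  have h := (hf.hasFDerivAt.comp x (hΦ.restrictScalars ℝ).hasFDerivAt).fderiv
  simp only [dbarWirt]
  rw [show (fun y => f (Φ y)) = f ∘ Φ from rfl, h, hΦ.fderiv_restrictScalars ℝ]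
  simp

omit [NormedSpace ℝ V] [IsScalarTower ℝ ℂ V] in
theorem differentiableAt_of_contDiffOn_complex {W : Type*} [NormedAddCommGroup W]
    [NormedSpace ℂ W] {f : V → W} (hf : ContDiffOn ℂ ∞ f U)
    (hU : IsOpen U) (hx : x ∈ U) : DifferentiableAt ℂ f x :=
  (hf.contDiffAt (hU.mem_nhds hx)).differentiableAt (by simp)

/-- The real part of a holomorphic function is pluriharmonic. -/
theorem ddbar_re_of_holomorphic {ι : Type*} {b : ι → V} (hU : IsOpen U)
    (hf : ContDiffOn ℂ ∞ f U) (hx : x ∈ U) :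
    ddbar b (fun y => (((f y).re : ℝ) : ℂ)) x = 0 := by
  have h1 : ∀ y ∈ U, ∀ v, dbarWirt (fun y => (((f y).re : ℝ) : ℂ)) v y =
      (1 / 2 : ℂ) * star (fderiv ℂ f y v) := by
    intro y hy v
    have hd := differentiableAt_of_contDiffOn_complex hf hU hy
    have hd' := hd.restrictScalars ℝ
    have : (fun y => (((f y).re : ℝ) : ℂ)) = fun y => (1 / 2 : ℂ) * (f y + star (f y)) := by
      ext y
      rw [Complex.star_def, Complex.add_conj]
      push_cast
      ring
    rw [this, dbarWirt_const_mul _ (hd'.fun_add hd'.star), dbarWirt_add hd' hd'.star,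
      dbarWirt_eq_zero hd, dbarWirt_star, dWirt_eq_fderiv hd, zero_add]
  ext i j
  simp only [ddbar, Matrix.of_apply, Matrix.zero_apply]
  have h2 : (fun y => dbarWirt (fun y => (((f y).re : ℝ) : ℂ)) (b j) y) =ᶠ[𝓝 x]
      fun y => (1 / 2 : ℂ) * star (fderiv ℂ f y (b j)) := by
    filter_upwards [hU.mem_nhds hx] with y hy using h1 y hy (b j)
  have hd : DifferentiableAt ℂ (fun y => fderiv ℂ f y (b j)) x :=
    differentiableAt_of_contDiffOn_complex
      ((hf.fderiv_of_isOpen hU (by simp)).clm_apply contDiffOn_const) hU hx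
  rw [dWirt_congr h2, dWirt_const_mul _ (hd.restrictScalars ℝ).star, dWirt_star,
    dbarWirt_eq_zero hd]
  simp

/-- `log |F|` is pluriharmonic if `F` is holomorphic without zeros. -/
theorem ddbar_log_norm {ι : Type*} {b : ι → V} (hU : IsOpen U) (hf : ContDiffOn ℂ ∞ f U)
    (hx : x ∈ U) (h0 : f x ≠ 0) :
    ddbar b (fun y => ((Real.log ‖f y‖ : ℝ) : ℂ)) x = 0 := by
  -- On `U'` the quotient `f / f x` avoids the branch cut, so `log |f|` is there the real part of a
  -- holomorphic branch of the logarithm.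
  set U' := U ∩ (fun y => f y / f x) ⁻¹' Complex.slitPlane with hU'
  have hc : ContinuousOn (fun y => f y / f x) U := hf.continuousOn.div_const _
  have hU'o : IsOpen U' := hc.isOpen_inter_preimage hU Complex.isOpen_slitPlane
  have hxU' : x ∈ U' := ⟨hx, by simp [h0]⟩
  have hlog : ContDiffOn ℂ ∞ (fun y => Complex.log (f y / f x) + (Real.log ‖f x‖ : ℝ)) U' := by
    intro y hy
    refine ContDiffAt.contDiffWithinAt ?_
    exact ((Complex.contDiffAt_log hy.2).comp y
      ((hf.contDiffAt (hU.mem_nhds hy.1)).div_const _)).add contDiffAt_const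
  rw [← ddbar_re_of_holomorphic (b := b) hU'o hlog hxU']
  refine ddbar_congr_of_eqOn hU'o (fun y hy => ?_) hxU'
  have hy0 : f y ≠ 0 := by
    intro h
    have := hy.2
    simp [h] at this
  simp only [Complex.add_re, Complex.log_re, Complex.ofReal_re, norm_div]
  rw [Real.log_div (norm_ne_zero_iff.2 hy0) (norm_ne_zero_iff.2 h0)]
  congr 1
  ring

end WirtingerCalculus

/-! ### Holomorphic coordinate changes -/

section CoordChange

variable {d : ℕ}

/-- The coordinate functions `(w, z) ↦ w^α` and `(w, z) ↦ z`. -/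
def coordProj (d : ℕ) : Idx d → Coord d →L[ℂ] ℂ
  | Sum.inl α => (EuclideanSpace.proj α).comp (ContinuousLinearMap.fst ℂ _ _)
  | Sum.inr _ => ContinuousLinearMap.snd ℂ _ _

theorem sum_coordProj_smul_dir (v : Coord d) : ∑ k, coordProj d k v • dir d k = v := by
  rw [Fintype.sum_sum_type]
  ext i
  · simp [coordProj, dir, Pi.single_apply, Prod.fst_sum]
  · simp [coordProj, dir, Prod.snd_sum]

theorem coordProj_dir (i j : Idx d) : coordProj d i (dir d j) = if i = j then 1 else 0 := by
  rcases i with i | i <;> rcases j with j | j <;>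
    simp [coordProj, dir]

/-- The complex Jacobian matrix. -/
def jac (Φ : Coord d → Coord d) (x : Coord d) : Matrix (Idx d) (Idx d) ℂ :=
  Matrix.of fun k j => coordProj d k (fderiv ℂ Φ x (dir d j))

theorem fderiv_dir_eq_sum (Φ : Coord d → Coord d) (x : Coord d) (j : Idx d) :
    fderiv ℂ Φ x (dir d j) = ∑ k, jac Φ x k j • dir d k :=
  (sum_coordProj_smul_dir _).symm

theorem jac_comp {Φ Ψ : Coord d → Coord d} {x : Coord d} (hΨ : DifferentiableAt ℂ Ψ (Φ x))
    (hΦ : DifferentiableAt ℂ Φ x) : jac (fun y => Ψ (Φ y)) x = jac Ψ (Φ x) * jac Φ x := by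
  ext i j
  rw [jac, Matrix.of_apply, show (fun y => Ψ (Φ y)) = Ψ ∘ Φ from rfl, fderiv_comp x hΨ hΦ,
    ContinuousLinearMap.comp_apply, fderiv_dir_eq_sum Φ, Matrix.mul_apply]
  simp [jac, mul_comm]

theorem jac_id (x : Coord d) : jac (fun y : Coord d => y) x = 1 := by
  ext i j
  simp [jac, coordProj_dir, Matrix.one_apply]

theorem jac_congr {Φ Ψ : Coord d → Coord d} {x : Coord d} (h : Φ =ᶠ[𝓝 x] Ψ) :
    jac Φ x = jac Ψ x := by
  simp only [jac, h.fderiv_eq]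

/-- The pullback of the component matrix of a (1,1)-form by a map with Jacobian matrix `J`. -/
def jacPull (J A : Matrix (Idx d) (Idx d) ℂ) : Matrix (Idx d) (Idx d) ℂ :=
  J.transpose * A * J.map star

theorem jacPull_add (J A B : Matrix (Idx d) (Idx d) ℂ) :
    jacPull J (A + B) = jacPull J A + jacPull J B := by
  simp [jacPull, mul_add, add_mul]

theorem jacPull_smul (J A : Matrix (Idx d) (Idx d) ℂ) (c : ℂ) :
    jacPull J (c • A) = c • jacPull J A := by
  simp [jacPull]

@[simp] theorem jacPull_zero (J : Matrix (Idx d) (Idx d) ℂ) : jacPull J 0 = 0 := by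
  simp [jacPull]

theorem det_map_star (J : Matrix (Idx d) (Idx d) ℂ) : (J.map star).det = star J.det := by
  rw [← Matrix.det_conjTranspose, ← Matrix.det_transpose]
  rfl

theorem det_jacPull (J A : Matrix (Idx d) (Idx d) ℂ) :
    (jacPull J A).det = ((‖J.det‖ ^ 2 : ℝ) : ℂ) * A.det := by
  have : J.det * star J.det = ((‖J.det‖ ^ 2 : ℝ) : ℂ) := by
    rw [Complex.star_def, Complex.mul_conj, Complex.normSq_eq_norm_sq]
  rw [jacPull, Matrix.det_mul, Matrix.det_mul, Matrix.det_transpose, det_map_star, ← this]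
  ring

/-- `Φ` is a holomorphic coordinate change from `U` into `U'`. -/
structure IsHolCoordChange (Φ : Coord d → Coord d) (U U' : Set (Coord d)) : Prop where
  isOpen : IsOpen U
  isOpen' : IsOpen U'
  mapsTo : MapsTo Φ U U'
  contDiffOn : ContDiffOn ℂ ∞ Φ U
  det_ne_zero : ∀ x ∈ U, (jac Φ x).det ≠ 0

namespace IsHolCoordChange

variable {Φ : Coord d → Coord d} {U U' : Set (Coord d)} {x : Coord d}

theorem differentiableAt (hΦ : IsHolCoordChange Φ U U') (hx : x ∈ U) : DifferentiableAt ℂ Φ x :=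
  differentiableAt_of_contDiffOn_complex hΦ.contDiffOn hΦ.isOpen hx

theorem contDiffOn_real (hΦ : IsHolCoordChange Φ U U') : ContDiffOn ℝ ∞ Φ U :=
  hΦ.contDiffOn.restrict_scalars ℝ

theorem contDiffOn_jac (hΦ : IsHolCoordChange Φ U U') (i j : Idx d) :
    ContDiffOn ℂ ∞ (fun y => jac Φ y i j) U :=
  (coordProj d i).contDiff.comp_contDiffOn
    ((hΦ.contDiffOn.fderiv_of_isOpen hΦ.isOpen (by simp)).clm_apply contDiffOn_const)

theorem contDiffOn_det_jac (hΦ : IsHolCoordChange Φ U U') :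
    ContDiffOn ℂ ∞ (fun y => (jac Φ y).det) U := by
  simp only [Matrix.det_apply, Units.smul_def, zsmul_eq_mul]
  exact ContDiffOn.sum fun σ _ => contDiffOn_const.mul (contDiffOn_prod fun i _ =>
    hΦ.contDiffOn_jac _ _)

theorem comp {f : Coord d → ℂ} (hΦ : IsHolCoordChange Φ U U') (hf : ContDiffOn ℝ ∞ f U') :
    ContDiffOn ℝ ∞ (fun y => f (Φ y)) U :=
  ContDiffOn.comp hf hΦ.contDiffOn_real hΦ.mapsTo

/-- `∂̄` produces conjugated Jacobian entries, which are antiholomorphic and hence killed by `∂`. No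
second derivatives of `Φ` survive. -/
theorem ddbar_comp {f : Coord d → ℂ} (hΦ : IsHolCoordChange Φ U U') (hf : ContDiffOn ℝ ∞ f U')
    (hx : x ∈ U) :
    ddbar (dir d) (fun y => f (Φ y)) x = jacPull (jac Φ x) (ddbar (dir d) f (Φ x)) := by
  have h1 : ∀ y ∈ U, ∀ j, dbarWirt (fun y => f (Φ y)) (dir d j) y =
      ∑ k, star (jac Φ y k j) * dbarWirt f (dir d k) (Φ y) := by
    intro y hy j
    rw [dbarWirt_comp (differentiableAt_of_contDiffOn hf hΦ.isOpen' (hΦ.mapsTo hy))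
      (hΦ.differentiableAt hy), fderiv_dir_eq_sum, dbarWirt_sum_right]
    simp only [dbarWirt_smul_right]
  ext i j
  simp only [ddbar, Matrix.of_apply]
  have h2 : (fun y => dbarWirt (fun y => f (Φ y)) (dir d j) y) =ᶠ[𝓝 x]
      fun y => ∑ k, star (jac Φ y k j) * dbarWirt f (dir d k) (Φ y) := by
    filter_upwards [hΦ.isOpen.mem_nhds hx] with y hy using h1 y hy j
  have hJ : ∀ k, DifferentiableAt ℂ (fun y => jac Φ y k j) x := fun k =>
    differentiableAt_of_contDiffOn_complex (hΦ.contDiffOn_jac k j) hΦ.isOpen hx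
  have hb : ∀ k, ContDiffOn ℝ ∞ (fun y => dbarWirt f (dir d k) y) U' := fun k =>
    contDiffOn_dbarWirt hf hΦ.isOpen' _
  have hbx : ∀ k, DifferentiableAt ℝ (fun y => dbarWirt f (dir d k) (Φ y)) x := fun k =>
    differentiableAt_of_contDiffOn (hΦ.comp (hb k)) hΦ.isOpen hx
  rw [dWirt_congr h2, dWirt_sum fun k _ => ((hJ k).restrictScalars ℝ).star.fun_mul (hbx k)]
  simp only [jacPull, Matrix.mul_apply, Matrix.transpose_apply, Matrix.map_apply, Matrix.of_apply]
  refine Finset.sum_congr rfl fun k _ => ?_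
  rw [dWirt_mul ((hJ k).restrictScalars ℝ).star (hbx k), dWirt_star, dbarWirt_eq_zero (hJ k),
    dWirt_comp (differentiableAt_of_contDiffOn (hb k) hΦ.isOpen' (hΦ.mapsTo hx))
      (hΦ.differentiableAt hx), fderiv_dir_eq_sum, dWirt_sum_right]
  simp only [dWirt_smul_right, star_zero, mul_zero, add_zero]
  rw [mul_comm]

/-- The Ricci form is compatible with coordinate changes and constant rescalings. -/
theorem ricciForm_eq {g g' : Form d} (hΦ : IsHolCoordChange Φ U U') {c : ℝ} (hc : 0 < c)
    (hg : ∀ y ∈ U, g y = (c : ℂ) • jacPull (jac Φ y) (g' (Φ y)))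
    (hdet : ∀ y ∈ U', 0 < (g' y).det) (hsmooth : ContDiffOn ℝ ∞ (fun y => (g' y).det) U')
    (hx : x ∈ U) : ricciForm g x = jacPull (jac Φ x) (ricciForm g' (Φ x)) := by
  have hpos : ∀ z : ℂ, 0 < z → Complex.log z = ((Real.log ‖z‖ : ℝ) : ℂ) := by
    intro z hz
    rw [Complex.ofReal_log (norm_nonneg z)]
    congr 1
    rw [Complex.norm_of_nonneg' hz.le]
  have hlogs : ContDiffOn ℝ ∞ (fun y => Complex.log (g' y).det) U' := fun y hy => by
    have h : ContDiffAt ℝ ∞ Complex.log (g' y).det :=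
      (Complex.contDiffAt_log (Or.inl (Complex.pos_iff.1 (hdet y hy)).1)).restrict_scalars ℝ
    exact h.comp_contDiffWithinAt y (hsmooth y hy)
  -- Both determinants are positive, so the principal logarithms are real. They differ by a constant
  -- and `2 log |det J|`, which is pluriharmonic.
  have hlog : ∀ y ∈ U, Complex.log (g y).det =
      ((Real.log (c ^ Fintype.card (Idx d)) : ℝ) : ℂ) +
        (2 * ((Real.log ‖(jac Φ y).det‖ : ℝ) : ℂ) + Complex.log (g' (Φ y)).det) := by
    intro y hy
    have hJ : 0 < ‖(jac Φ y).det‖ := norm_pos_iff.2 (hΦ.det_ne_zero y hy)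
    have hgy : (g y).det =
        ((c ^ Fintype.card (Idx d) * ‖(jac Φ y).det‖ ^ 2 : ℝ) : ℂ) * (g' (Φ y)).det := by
      rw [hg y hy, Matrix.det_smul, det_jacPull]
      push_cast
      ring
    have hdy := hdet _ (hΦ.mapsTo hy)
    have : 0 < (g y).det := by
      rw [hgy]
      exact mul_pos (by exact_mod_cast (by positivity)) hdy
    rw [hpos _ this, hpos _ hdy, hgy, norm_mul, Complex.norm_real, Real.norm_of_nonneg
      (by positivity), Real.log_mul (by positivity) (norm_ne_zero_iff.2 hdy.ne'),
      Real.log_mul (by positivity) (by positivity), Real.log_pow ‖(jac Φ y).det‖ 2]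
    push_cast
    ring
  have hJlog : ContDiffOn ℝ ∞ (fun y => ((Real.log ‖(jac Φ y).det‖ : ℝ) : ℂ)) U := fun y hy => by
    have h1 : ContDiffWithinAt ℝ ∞ (fun y => (jac Φ y).det) U y :=
      hΦ.contDiffOn_det_jac.restrict_scalars ℝ y hy
    have h2 : ContDiffWithinAt ℝ ∞ (fun y => Real.log ‖(jac Φ y).det‖) U y :=
      (h1.norm ℝ (hΦ.det_ne_zero y hy)).log (norm_ne_zero_iff.2 (hΦ.det_ne_zero y hy))
    exact Complex.ofRealCLM.contDiff.contDiffAt.comp_contDiffWithinAt y h2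
  simp only [ricciForm]
  rw [ddbar_congr_of_eqOn hΦ.isOpen hlog hx, ddbar_add hΦ.isOpen contDiffOn_const
    ((contDiffOn_const.mul hJlog).add (hΦ.comp hlogs)) hx, ddbar_add hΦ.isOpen
    (contDiffOn_const.mul hJlog) (hΦ.comp hlogs) hx, ddbar_const_mul hΦ.isOpen 2 hJlog hx,
    ddbar_log_norm hΦ.isOpen hΦ.contDiffOn_det_jac hx (hΦ.det_ne_zero x hx),
    hΦ.ddbar_comp hlogs hx, ddbar_const, smul_zero, zero_add, zero_add]
  rw [← neg_one_smul ℂ (ddbar (dir d) _ (Φ x)), jacPull_smul, neg_one_smul]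

end IsHolCoordChange

/-- Multiplication of the last coordinate by a complex number. -/
def fibreMul (l : ℂ) (x : Coord d) : Coord d := (x.1, l * x.2)

theorem jac_fibreMul (l : ℂ) (x : Coord d) :
    jac (fibreMul l) x = Matrix.diagonal fun i => l ^ idxWeight d i := by
  have : fderiv ℂ (fibreMul (d := d) l) x =
      (ContinuousLinearMap.fst ℂ _ _).prod (l • ContinuousLinearMap.snd ℂ _ _) := by
    have h : fibreMul (d := d) l = fun y => ((ContinuousLinearMap.fst ℂ _ _).prod
      (l • ContinuousLinearMap.snd ℂ _ _) : Coord d →L[ℂ] Coord d) y := by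
      ext y <;> simp [fibreMul]
    rw [h]
    exact ContinuousLinearMap.fderiv _
  ext i j
  rw [jac, Matrix.of_apply, this]
  rcases i with i | i <;> rcases j with j | j <;>
    simp [coordProj, dir, idxWeight, Matrix.diagonal_apply]

theorem contDiff_fibreMul (l : ℂ) : ContDiff ℂ ∞ (fibreMul (d := d) l) :=
  contDiff_fst.prodMk (contDiff_const.mul contDiff_snd)

theorem isHolCoordChange_fibreMul {l : ℂ} (hl : l ≠ 0) {U : Set (Coord d)} (hU : IsOpen U)
    (h : MapsTo (fibreMul l) U U) : IsHolCoordChange (fibreMul l) U U where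
  isOpen := hU
  isOpen' := hU
  mapsTo := h
  contDiffOn := (contDiff_fibreMul l).contDiffOn
  det_ne_zero x _ := by
    rw [jac_fibreMul, Matrix.det_diagonal]
    exact Finset.prod_ne_zero_iff.2 fun i _ => pow_ne_zero _ hl

theorem dilatePullback_eq_jacPull (r : ℝ) (G : Form d) (x : Coord d) :
    dilatePullback r G x = jacPull (jac (fibreMul (r : ℂ)) x) (G (fibreMul r x)) := by
  ext i j
  rw [jacPull, jac_fibreMul, Matrix.diagonal_transpose, Matrix.diagonal_map (by simp),
    Matrix.mul_diagonal, Matrix.diagonal_mul]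
  simp [dilatePullback, fibreMul, pow_add]
  ring

end CoordChange

/-! ### Local coordinates of the total space -/

section LocalCoordinates

variable {d : ℕ} {D : Type*} [TopologicalSpace D] [ChartedSpace (EuclideanSpace ℂ (Fin d)) D]
  {E : D → Type*} [∀ x, AddCommGroup (E x)] [∀ x, Module ℂ (E x)] [∀ x, TopologicalSpace (E x)]
  [TopologicalSpace (TotalSpace ℂ E)] [FiberBundle ℂ E]

/-- Fibrewise multiplication by a complex number. -/
def cmul (l : ℂ) (p : TotalSpace ℂ E) : TotalSpace ℂ E := ⟨p.1, l • p.2⟩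

theorem dilate_eq_cmul (r : ℝ) (p : TotalSpace ℂ E) : dilate r p = cmul (r : ℂ) p := rfl

theorem cmul_cmul (a b : ℂ) (p : TotalSpace ℂ E) : cmul a (cmul b p) = cmul (a * b) p := by
  simp only [cmul, mul_smul]
  rfl

theorem cmul_one (p : TotalSpace ℂ E) : cmul 1 p = p := by
  simp [cmul]

theorem cmul_snd_ne_zero {l : ℂ} (hl : l ≠ 0) {p : TotalSpace ℂ E} (hp : p.2 ≠ 0) :
    (cmul l p).2 ≠ 0 :=
  smul_ne_zero hl hp

namespace LocalCoord

variable (c c' : LocalCoord d E) {x : Coord d} {p : TotalSpace ℂ E}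

/-- The part of the complement of the zero section that is covered by the coordinates. -/
def patch : Set (TotalSpace ℂ E) := {p | p.1 ∈ c.chart.source ∧ p.1 ∈ c.triv.baseSet ∧ p.2 ≠ 0}

/-- The coordinates of a point. -/
def coords (p : TotalSpace ℂ E) : Coord d := (c.chart p.1, (c.triv p).2)

/-- Coordinates around the point `p`. -/
def around (d : ℕ) [ChartedSpace (EuclideanSpace ℂ (Fin d)) D] (p : TotalSpace ℂ E) :
    LocalCoord d E where
  chart := chartAt _ p.1
  chart_mem := chart_mem_atlas _ _
  triv := trivializationAt ℂ E p.1
  triv_mem := inferInstance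

theorem mem_patch_around (hp : p.2 ≠ 0) : p ∈ (LocalCoord.around d p).patch :=
  ⟨mem_chart_source _ _, mem_baseSet_trivializationAt ℂ E p.1, hp⟩

theorem isOpen_dom : IsOpen c.dom := by
  have h1 : IsOpen (c.chart.target ∩ c.chart.symm ⁻¹' c.triv.baseSet) :=
    c.chart.isOpen_inter_preimage_symm c.triv.open_baseSet
  have : c.dom = (Prod.fst ⁻¹' (c.chart.target ∩ c.chart.symm ⁻¹' c.triv.baseSet)) ∩
      (Prod.snd ⁻¹' {0}ᶜ) := by
    ext x
    simp [dom, and_assoc]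
  rw [this]
  exact (h1.preimage continuous_fst).inter (isOpen_compl_singleton.preimage continuous_snd)

theorem fibreMul_mem_dom {l : ℂ} (hl : l ≠ 0) (hx : x ∈ c.dom) : fibreMul l x ∈ c.dom :=
  ⟨hx.1, hx.2.1, mul_ne_zero hl hx.2.2⟩

theorem isHolCoordChange_fibreMul {l : ℂ} (hl : l ≠ 0) :
    IsHolCoordChange (fibreMul l) c.dom c.dom :=
  FormalKRF.isHolCoordChange_fibreMul hl c.isOpen_dom fun _ hx => c.fibreMul_mem_dom hl hx

theorem coords_param (hx : x ∈ c.dom) : c.coords (c.param x) = x := by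
  ext1
  · exact c.chart.right_inv hx.1
  · simp [coords, param, c.triv.apply_mk_symm hx.2.1]

theorem param_coords (hp : p ∈ c.patch) : c.param (c.coords p) = p := by
  obtain ⟨b, v⟩ := p
  have h1 : c.chart.symm (c.chart b) = b := c.chart.left_inv hp.1
  simp only [param, coords]
  rw [h1, c.triv.symm_apply_apply_mk hp.2.1]

variable [VectorBundle ℂ ℂ E]

theorem param_mem_patch (hx : x ∈ c.dom) : c.param x ∈ c.patch := by
  have := c.triv_mem
  refine ⟨c.chart.map_target hx.1, hx.2.1, fun h => hx.2.2 ?_⟩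
  have h2 := c.triv.apply_mk_symm hx.2.1 x.2
  change c.triv.symm (c.chart.symm x.1) x.2 = (0 : E (c.chart.symm x.1)) at h
  have h3 : c.triv ⟨c.chart.symm x.1, (0 : E (c.chart.symm x.1))⟩ = (c.chart.symm x.1, 0) :=
    c.triv.zeroSection ℂ hx.2.1
  rw [h, h3] at h2
  exact (congrArg Prod.snd h2).symm

theorem coords_mem_dom (hp : p ∈ c.patch) : c.coords p ∈ c.dom := by
  have := c.triv_mem
  have h1 : c.chart.symm (c.chart p.1) = p.1 := c.chart.left_inv hp.1
  refine ⟨c.chart.map_source hp.1, ?_, fun h => hp.2.2 ?_⟩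
  · simpa only [coords, h1] using hp.2.1
  · have h2 := c.triv.linearMapAt_apply (R := ℂ) p.2
    rw [if_pos hp.2.1] at h2
    have h3 := c.triv.symmₗ_linearMapAt (R := ℂ) hp.2.1 p.2
    rw [h2] at h3
    have h4 : (c.triv p).2 = 0 := h
    rw [← h3, show (⟨p.1, p.2⟩ : TotalSpace ℂ E) = p from rfl, h4, map_zero]

theorem param_fibreMul (hx : x ∈ c.dom) (l : ℂ) :
    c.param (fibreMul l x) = cmul l (c.param x) := by
  have := c.triv_mem
  simp only [param, fibreMul, cmul]
  congr 1
  have := (c.triv.symmₗ ℂ (c.chart.symm x.1)).map_smul l x.2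
  rwa [c.triv.symmₗ_apply hx.2.1, c.triv.symmₗ_apply hx.2.1, smul_eq_mul] at this

/-- The coordinates `x` of points that lie in the domain of the coordinates `c'` as well. -/
def overlap : Set (Coord d) := c.dom ∩ {x | c.param x ∈ c'.patch}

/-- The transition map from `c` to `c'`. -/
def transition (x : Coord d) : Coord d := c'.coords (c.param x)

theorem isOpen_overlap : IsOpen (c.overlap c') := by
  have h1 : IsOpen (c.chart.target ∩ c.chart.symm ⁻¹' (c'.chart.source ∩ c'.triv.baseSet)) :=
    c.chart.isOpen_inter_preimage_symm (c'.chart.open_source.inter c'.triv.open_baseSet)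
  have : c.overlap c' = c.dom ∩ Prod.fst ⁻¹'
      (c.chart.target ∩ c.chart.symm ⁻¹' (c'.chart.source ∩ c'.triv.baseSet)) := by
    ext x
    constructor
    · rintro ⟨hx, hx'⟩
      exact ⟨hx, hx.1, hx'.1, hx'.2.1⟩
    · rintro ⟨hx, hx'⟩
      exact ⟨hx, hx'.2.1, hx'.2.2, (c.param_mem_patch hx).2.2⟩
  rw [this]
  exact c.isOpen_dom.inter (h1.preimage continuous_fst)

theorem param_transition (hx : x ∈ c.overlap c') : c'.param (c.transition c' x) = c.param x :=
  c'.param_coords hx.2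

theorem transition_mem_overlap (hx : x ∈ c.overlap c') : c.transition c' x ∈ c'.overlap c := by
  refine ⟨c'.coords_mem_dom hx.2, ?_⟩
  rw [mem_ofPred_eq, c.param_transition c' hx]
  exact c.param_mem_patch hx.1

theorem transition_transition (hx : x ∈ c.overlap c') :
    c'.transition c (c.transition c' x) = x := by
  rw [transition, c.param_transition c' hx, c.coords_param hx.1]

variable [IsManifold 𝓘(ℂ, EuclideanSpace ℂ (Fin d)) ω D]
  [ContMDiffVectorBundle ω ℂ E 𝓘(ℂ, EuclideanSpace ℂ (Fin d))]

theorem contDiffOn_transition : ContDiffOn ℂ ∞ (c.transition c') (c.overlap c') := by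
  have := c.triv_mem
  have := c'.triv_mem
  have : IsManifold 𝓘(ℂ, EuclideanSpace ℂ (Fin d)) ∞ D :=
    IsManifold.of_le (n := ω) le_top
  have hs : ContMDiffOn 𝓘(ℂ, Coord d) 𝓘(ℂ, EuclideanSpace ℂ (Fin d)) ∞
      (fun x : Coord d => c.chart.symm x.1) (c.overlap c') := by
    have h1 := contMDiffOn_symm_of_mem_maximalAtlas (I := 𝓘(ℂ, EuclideanSpace ℂ (Fin d)))
      (n := ∞) (IsManifold.subset_maximalAtlas c.chart_mem)
    exact h1.comp (contDiff_fst.contMDiff.contMDiffOn) fun x hx => hx.1.1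
  have h1 : ContMDiffOn 𝓘(ℂ, Coord d) 𝓘(ℂ, EuclideanSpace ℂ (Fin d)) ∞
      (fun x : Coord d => c'.chart (c.chart.symm x.1)) (c.overlap c') := by
    have := contMDiffOn_of_mem_maximalAtlas (I := 𝓘(ℂ, EuclideanSpace ℂ (Fin d)))
      (n := ∞) (IsManifold.subset_maximalAtlas c'.chart_mem)
    exact this.comp hs fun x hx => hx.2.1
  have h2 : ContMDiffOn 𝓘(ℂ, Coord d) 𝓘(ℂ, ℂ) ∞
      (fun x : Coord d => c.triv.coordChange c'.triv (c.chart.symm x.1) x.2) (c.overlap c') :=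
    hs.coordChange (contDiff_snd.contMDiff.contMDiffOn) (fun x hx => hx.1.2.1)
      (fun x hx => hx.2.2.1)
  have h3 : ContDiffOn ℂ ∞ (fun x : Coord d => (c'.chart (c.chart.symm x.1),
      c.triv.coordChange c'.triv (c.chart.symm x.1) x.2)) (c.overlap c') :=
    (contMDiffOn_iff_contDiffOn.1 h1).prodMk (contMDiffOn_iff_contDiffOn.1 h2)
  refine h3.congr fun x hx => ?_
  simp only [transition, coords, param, Trivialization.coordChange]
  rw [c.triv.mk_symm hx.1.2.1]

/-- The transition in the opposite direction is an inverse, so by the chain rule the two Jacobian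
determinants have product `1`. -/
theorem isHolCoordChange_transition :
    IsHolCoordChange (c.transition c') (c.overlap c') c'.dom where
  isOpen := c.isOpen_overlap c'
  isOpen' := c'.isOpen_dom
  mapsTo x hx := (c.transition_mem_overlap c' hx).1
  contDiffOn := c.contDiffOn_transition c'
  det_ne_zero x hx h := by
    have h1 := jac_comp (Φ := c.transition c') (Ψ := c'.transition c) (x := x)
      (differentiableAt_of_contDiffOn_complex (c'.contDiffOn_transition c) (c'.isOpen_overlap c)
        (c.transition_mem_overlap c' hx))
      (differentiableAt_of_contDiffOn_complex (c.contDiffOn_transition c') (c.isOpen_overlap c')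
        hx)
    have h2 : (fun y => c'.transition c (c.transition c' y)) =ᶠ[𝓝 x] fun y => y := by
      filter_upwards [(c.isOpen_overlap c').mem_nhds hx] with y hy
        using c.transition_transition c' hy
    rw [jac_congr h2, jac_id] at h1
    have h3 := congrArg Matrix.det h1
    rw [Matrix.det_one, Matrix.det_mul, h, mul_zero] at h3
    exact one_ne_zero h3

end LocalCoord

end LocalCoordinates

/-! ### The cone form and its Ricci form -/

section FibreDerivatives

variable {d : ℕ} {f : Coord d → ℂ} {U : Set (Coord d)} {x : Coord d}

/-- The derivative `z ∂_z` of a function that is invariant under rotations. -/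
theorem snd_mul_dWirt_of_invariant (hf : DifferentiableAt ℝ f x) {A : ℂ}
    (hA : HasDerivAt (fun s : ℝ => f (fibreMul (Real.exp s : ℂ) x)) A 0)
    (hrot : ∀ s : ℝ, f (fibreMul (Complex.exp (s * Complex.I)) x) = f x) :
    x.2 * dWirt f (dir d (Sum.inr ())) x = A / 2 := by
  have key : ∀ (l : ℝ → ℂ) (l' : ℂ), HasDerivAt l l' 0 → l 0 = 1 →
      HasDerivAt (fun s : ℝ => f (fibreMul (l s) x)) (fderiv ℝ f x (0, l' * x.2)) 0 := by
    intro l l' hl hl0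
    have h1 : HasDerivAt (fun s : ℝ => fibreMul (l s) x) ((0, l' * x.2) : Coord d) 0 :=
      (hasDerivAt_const _ _).prodMk (hl.mul_const x.2)
    have h2 : fibreMul (l 0) x = x := by simp [fibreMul, hl0]
    have h3 : HasFDerivAt f (fderiv ℝ f x) (fibreMul (l 0) x) := by
      rw [h2]
      exact hf.hasFDerivAt
    exact h3.comp_hasDerivAt (0 : ℝ) h1
  have hexp : HasDerivAt (fun s : ℝ => (Real.exp s : ℂ)) 1 0 := by
    simpa using (Real.hasDerivAt_exp 0).ofReal_comp
  have hrotd : HasDerivAt (fun s : ℝ => Complex.exp (s * Complex.I)) Complex.I 0 := by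
    have h1 : HasDerivAt (fun s : ℝ => (s : ℂ) * Complex.I) Complex.I 0 := by
      simpa using (Complex.ofRealCLM.hasDerivAt (x := (0 : ℝ))).mul_const Complex.I
    simpa using h1.cexp
  have h1 := (key _ _ hexp (by simp)).unique hA
  have h2 := (key _ _ hrotd (by simp)).unique (by
    simp only [hrot]
    exact hasDerivAt_const _ _)
  have h3 : x.2 • dir d (Sum.inr ()) = (0, x.2) := by simp [dir]
  -- `z ∂_z` is half the derivative along the dilations minus `I / 2` times the derivative along the
  -- rotations; the latter vanishes.
  rw [← dWirt_smul_right, h3, dWirt]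
  simp only [Prod.smul_mk, smul_zero, smul_eq_mul, one_mul] at *
  rw [h1, h2]
  ring

theorem differentiable_coordSnd (y : Coord d) : DifferentiableAt ℂ (fun y : Coord d => y.2) y :=
  differentiableAt_snd

/-- Euler's identity for the derivatives `z ∂_z ∂_j̄`. -/
theorem snd_mul_ddbar_of_euler (hU : IsOpen U) (hf : ContDiffOn ℝ ∞ f U) {κ c : ℂ}
    (h : ∀ y ∈ U, y.2 * dWirt f (dir d (Sum.inr ())) y = κ * f y + c) (hx : x ∈ U) (j : Idx d) :
    x.2 * ddbar (dir d) f x (Sum.inr ()) j = κ * dbarWirt f (dir d j) x :=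
  mul_dWirt_dbarWirt_of_euler hU hf (θ := fun y => y.2)
    (fun y _ => (differentiable_coordSnd y).restrictScalars ℝ)
    (dbarWirt_eq_zero (differentiable_coordSnd x)) h hx

/-- The map `w ↦ (w, z)` is holomorphic with constant differential. This connects Hessians on the
total space with the curvature, which is defined by functions of `w` alone. -/
theorem ddbar_slice (hU : IsOpen U) (hf : ContDiffOn ℝ ∞ f U) (hx : x ∈ U) (a b : Fin d) :
    ddbar (dir d) f x (Sum.inl a) (Sum.inl b) =
      ddbar (fun α : Fin d => EuclideanSpace.single α (1 : ℂ)) (fun w => f (w, x.2)) x.1 a b := by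
  have hι : ∀ w : EuclideanSpace ℂ (Fin d), HasFDerivAt (𝕜 := ℂ)
      (fun w : EuclideanSpace ℂ (Fin d) => ((w, x.2) : Coord d))
      (ContinuousLinearMap.inl ℂ _ _) w := fun w => hasFDerivAt_prodMk_left w x.2
  have hw : ∀ᶠ w in 𝓝 x.1, ((w, x.2) : Coord d) ∈ U :=
    (Continuous.prodMk_left x.2).continuousAt.eventually_mem (hU.mem_nhds hx)
  simp only [ddbar, Matrix.of_apply]
  have h1 : (fun w => dbarWirt (fun w => f (w, x.2)) (EuclideanSpace.single b (1 : ℂ)) w)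
      =ᶠ[𝓝 x.1] fun w => dbarWirt f (dir d (Sum.inl b)) (w, x.2) := by
    filter_upwards [hw] with w hw
    rw [dbarWirt_comp (f := f) (Φ := fun w => (w, x.2))
      (differentiableAt_of_contDiffOn hf hU hw) (hι w).differentiableAt, (hι w).fderiv]
    rfl
  rw [dWirt_congr h1, dWirt_comp (f := fun y => dbarWirt f (dir d (Sum.inl b)) y)
    (Φ := fun w => (w, x.2)) (differentiableAt_of_contDiffOn (contDiffOn_dbarWirt hf hU _) hU hx)
    (hι x.1).differentiableAt, (hι x.1).fderiv]
  rfl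

end FibreDerivatives

/-! ### Positivity of a form from the base plus a rank-one form -/

section QuadraticForms

variable {d : ℕ}

theorem dotProduct_fromBlocks_add_vecMulVec (P : Matrix (Fin d) (Fin d) ℂ) (θ v : Idx d → ℂ)
    (a b : ℂ) :
    star v ⬝ᵥ ((a • Matrix.fromBlocks P 0 0 0 + b • Matrix.vecMulVec θ (star θ)) : Matrix
      (Idx d) (Idx d) ℂ).mulVec v =
    a * (star (v ∘ Sum.inl) ⬝ᵥ P.mulVec (v ∘ Sum.inl)) +
      b * ((star v ⬝ᵥ θ) * star (star v ⬝ᵥ θ)) := by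
  rw [Matrix.add_mulVec, dotProduct_add, Matrix.smul_mulVec, Matrix.smul_mulVec, dotProduct_smul,
    dotProduct_smul, smul_eq_mul, smul_eq_mul]
  congr 2
  · rw [Matrix.fromBlocks_mulVec]
    simp [dotProduct, Fintype.sum_sum_type]
  · have : star θ ⬝ᵥ v = star (star v ⬝ᵥ θ) := by simp [dotProduct, mul_comm]
    rw [Matrix.vecMulVec_mulVec, dotProduct_smul, this]
    simp

/-- If the base part of the vector is nonzero, `P` contributes a positive term and the rank-one term
is nonnegative. Otherwise only the fibre component is left, and the rank-one term is positive
because `θ` does not vanish there. -/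
theorem posDef_fromBlocks_add_vecMulVec {P : Matrix (Fin d) (Fin d) ℂ} (hP : P.PosDef)
    {θ : Idx d → ℂ} (hθ : θ (Sum.inr ()) ≠ 0) :
    ((1 : ℂ) • Matrix.fromBlocks P 0 0 0 + (1 : ℂ) • Matrix.vecMulVec θ (star θ) : Matrix
      (Idx d) (Idx d) ℂ).PosDef := by
  refine Matrix.PosDef.of_dotProduct_mulVec_pos ?_ fun v hv => ?_
  · rw [one_smul, one_smul]
    refine Matrix.IsHermitian.add ?_ ?_
    · exact Matrix.IsHermitian.fromBlocks hP.1 (by simp) Matrix.isHermitian_zero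
    · rw [Matrix.IsHermitian, Matrix.conjTranspose_vecMulVec, star_star]
  · rw [dotProduct_fromBlocks_add_vecMulVec, one_mul, one_mul]
    by_cases h : v ∘ Sum.inl = 0
    · have hr : v (Sum.inr ()) ≠ 0 := by
        intro hr
        apply hv
        ext i
        rcases i with i | i
        · exact congrFun h i
        · exact hr
      have : star v ⬝ᵥ θ = star (v (Sum.inr ())) * θ (Sum.inr ()) := by
        have h' : ∀ a, v (Sum.inl a) = 0 := congrFun h
        simp [dotProduct, Fintype.sum_sum_type, h']
      rw [h, this]
      simp only [Matrix.mulVec_zero, dotProduct_zero, zero_add]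
      rw [Complex.star_def, Complex.mul_conj]
      have : 0 < Complex.normSq (star (v (Sum.inr ())) * θ (Sum.inr ())) :=
        Complex.normSq_pos.2 (mul_ne_zero (by simpa using hr) hθ)
      exact_mod_cast this
    · refine add_pos_of_pos_of_nonneg (hP.dotProduct_mulVec_pos h) ?_
      rw [Complex.star_def, Complex.mul_conj]
      exact_mod_cast Complex.normSq_nonneg _

end QuadraticForms

/-! ### The potential `-log |S|^2` and positivity of the cone form -/

namespace HermitianMetric

variable {d : ℕ} {D : Type*} [TopologicalSpace D] [ChartedSpace (EuclideanSpace ℂ (Fin d)) D]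
  {E : D → Type*} [∀ x, AddCommGroup (E x)] [∀ x, Module ℂ (E x)] [∀ x, TopologicalSpace (E x)]
  [TopologicalSpace (TotalSpace ℂ E)] [FiberBundle ℂ E] [VectorBundle ℂ ℂ E]
  (h : HermitianMetric d E) (c : LocalCoord d E) {x : Coord d}

theorem normSq_cmul (l : ℂ) (p : TotalSpace ℂ E) : h.normSq (cmul l p) = ‖l‖ ^ 2 * h.normSq p :=
  h.normSq_smul p.1 l p.2

/-- The potential `-log |S|_h^2` in coordinates. -/
def chi (x : Coord d) : ℂ := ((-Real.log (h.normSq (c.param x)) : ℝ) : ℂ)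

theorem normSq_param_pos (hx : x ∈ c.dom) : 0 < h.normSq (c.param x) :=
  h.normSq_pos _ (c.param_mem_patch hx).2.2

theorem contDiffOn_chi : ContDiffOn ℝ ∞ (h.chi c) c.dom :=
  Complex.ofRealCLM.contDiff.comp_contDiffOn
    (((h.smooth c).log fun _ hx => (h.normSq_param_pos c hx).ne').neg)

theorem chi_fibreMul {l : ℂ} (hl : l ≠ 0) (hx : x ∈ c.dom) :
    h.chi c (fibreMul l x) = h.chi c x - ((2 * Real.log ‖l‖ : ℝ) : ℂ) := by
  rw [chi, chi, c.param_fibreMul hx, normSq_cmul, Real.log_mul (by positivity)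
    (h.normSq_param_pos c hx).ne', Real.log_pow]
  push_cast
  ring

theorem snd_mul_dWirt_chi (hx : x ∈ c.dom) :
    x.2 * dWirt (h.chi c) (dir d (Sum.inr ())) x = -1 := by
  rw [snd_mul_dWirt_of_invariant (A := -2)
    (differentiableAt_of_contDiffOn (h.contDiffOn_chi c) c.isOpen_dom hx)]
  · norm_num
  · have : (fun s : ℝ => h.chi c (fibreMul (Real.exp s : ℂ) x)) =
        fun s : ℝ => h.chi c x - 2 * (s : ℂ) := by
      ext s
      rw [h.chi_fibreMul c (by exact_mod_cast (Real.exp_pos s).ne') hx]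
      simp [Complex.norm_exp]
    rw [this]
    simpa using ((Complex.ofRealCLM.hasDerivAt (x := (0 : ℝ))).const_mul 2).const_sub
      (h.chi c x)
  · intro s
    rw [h.chi_fibreMul c (Complex.exp_ne_zero _) hx]
    simp [Complex.norm_exp]

theorem ddbar_chi_inr (hx : x ∈ c.dom) (j : Idx d) :
    ddbar (dir d) (h.chi c) x (Sum.inr ()) j = 0 := by
  have := snd_mul_ddbar_of_euler c.isOpen_dom (h.contDiffOn_chi c) (κ := 0) (c := -1)
    (fun y hy => by rw [h.snd_mul_dWirt_chi c hy]; ring) hx j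
  rw [zero_mul] at this
  exact (mul_eq_zero.1 this).resolve_left hx.2.2

theorem isHermitian_ddbar_chi (hx : x ∈ c.dom) : (ddbar (dir d) (h.chi c) x).IsHermitian :=
  ddbar_isHermitian c.isOpen_dom (h.contDiffOn_chi c) (fun y _ => by simp [chi]) hx

/-- The curvature form of the base in the coordinates `w`. -/
def curv (w : EuclideanSpace ℂ (Fin d)) : Matrix (Fin d) (Fin d) ℂ :=
  - ddbar (fun α : Fin d => EuclideanSpace.single α (1 : ℂ))
      (fun w' => ((Real.log (h.normSq (c.param (w', 1))) : ℝ) : ℂ)) w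

theorem fst_one_mem_dom (hx : x ∈ c.dom) : (x.1, (1 : ℂ)) ∈ c.dom :=
  ⟨hx.1, hx.2.1, one_ne_zero⟩

/-- Along a fibre `χ` changes only by `-2 log |z|`, which is pluriharmonic, so the Hessian comes
from the slice `z = 1`. -/
theorem ddbar_chi_eq (hx : x ∈ c.dom) :
    ddbar (dir d) (h.chi c) x = Matrix.fromBlocks (h.curv c x.1) 0 0 0 := by
  have hsymm : ∀ i, ddbar (dir d) (h.chi c) x i (Sum.inr ()) = 0 := fun i => by
    rw [← (h.isHermitian_ddbar_chi c hx).apply, h.ddbar_chi_inr c hx, star_zero]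
  ext i j
  rcases i with a | ⟨⟩
  · rcases j with b | ⟨⟩
    · rw [Matrix.fromBlocks_apply₁₁, ddbar_slice c.isOpen_dom (h.contDiffOn_chi c) hx]
      have hx1 := fst_one_mem_dom c hx
      set U := {w : EuclideanSpace ℂ (Fin d) | (w, (1 : ℂ)) ∈ c.dom}
      have hU : IsOpen U := c.isOpen_dom.preimage (Continuous.prodMk_left (1 : ℂ))
      have hlog : ContDiffOn ℝ ∞
          (fun w' => ((Real.log (h.normSq (c.param (w', 1))) : ℝ) : ℂ)) U := by
        have : ContDiffOn ℝ ∞ (fun w => h.chi c (w, 1)) U :=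
          (h.contDiffOn_chi c).comp ((contDiff_prodMk_left (1 : ℂ)).contDiffOn) fun w hw => hw
        simpa [chi] using this.neg
      have : EqOn (fun w => h.chi c (w, x.2))
          (fun w => ((-1 : ℂ) * ((Real.log (h.normSq (c.param (w, 1))) : ℝ) : ℂ)) +
            ((-(2 * Real.log ‖x.2‖) : ℝ) : ℂ)) U := by
        intro w hw
        have := h.chi_fibreMul c hx.2.2 (x := (w, 1)) hw
        simp only [fibreMul, mul_one] at this
        simp only [this]
        simp [chi]
        ring
      rw [ddbar_congr_of_eqOn hU this hx1, ddbar_add hU (contDiffOn_const.mul hlog)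
        contDiffOn_const hx1, ddbar_const_mul hU _ hlog hx1]
      simp [curv]
    · rw [hsymm, Matrix.fromBlocks_apply₁₂, Matrix.zero_apply]
  · rw [h.ddbar_chi_inr c hx]
    rcases j with b | ⟨⟩ <;> simp

/-- Note `e^{aχ} = |S|^{-2a}`. The value `a = 1` gives the cone form, and `a = -k/2` gives `|S|^k`,
the comparison function of the maximum principle. -/
theorem ddbar_exp_mul_chi (a : ℝ) (hx : x ∈ c.dom) :
    ddbar (dir d) (fun y => Complex.exp (a * h.chi c y)) x =
      Complex.exp (a * h.chi c x) • ((a : ℂ) • Matrix.fromBlocks (h.curv c x.1) 0 0 0 +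
        ((a : ℂ) ^ 2) • Matrix.vecMulVec (fun i => dWirt (h.chi c) (dir d i) x)
          (star fun i => dWirt (h.chi c) (dir d i) x)) := by
  have hs := h.contDiffOn_chi c
  have hd := differentiableAt_of_contDiffOn hs c.isOpen_dom hx
  ext i j
  rw [ddbar_exp c.isOpen_dom (contDiffOn_const.mul hs) hx, ddbar_const_mul c.isOpen_dom _ hs hx,
    h.ddbar_chi_eq c hx, dWirt_const_mul _ hd, dbarWirt_const_mul _ hd]
  have : dbarWirt (h.chi c) (dir d j) x = star (dWirt (h.chi c) (dir d j) x) := by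
    rw [← dbarWirt_star]
    congr 1
    ext y
    simp [chi]
  rw [this]
  simp only [Matrix.smul_apply, Matrix.add_apply, Matrix.vecMulVec_apply, Pi.star_apply,
    smul_eq_mul]
  ring

theorem pull_inv_normSq_eq (hx : x ∈ c.dom) :
    c.pull (fun p => (h.normSq p)⁻¹) x = Complex.exp ((1 : ℝ) * h.chi c x) := by
  rw [LocalCoord.pull, chi, Complex.ofReal_one, one_mul, ← Complex.ofReal_exp, Real.exp_neg,
    Real.exp_log (h.normSq_param_pos c hx)]

theorem dWirt_chi_inr_ne_zero (hx : x ∈ c.dom) :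
    dWirt (h.chi c) (dir d (Sum.inr ())) x ≠ 0 := by
  intro h0
  have := h.snd_mul_dWirt_chi c hx
  rw [h0, mul_zero] at this
  norm_num at this

theorem isSmooth_inv_normSq : IsSmooth d fun p => (h.normSq p)⁻¹ := fun c =>
  (h.smooth c).inv fun _ hx => (h.normSq_param_pos c hx).ne'

variable {h} in
theorem posDef_omega0 (hpos : h.IsPositive) (hx : x ∈ c.dom) : (h.omega0 c x).PosDef := by
  have h1 : h.omega0 c x = ddbar (dir d) (fun y => Complex.exp ((1 : ℝ) * h.chi c y)) x :=
    ddbar_congr_of_eqOn c.isOpen_dom (fun y hy => h.pull_inv_normSq_eq c hy) hx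
  rw [h1, h.ddbar_exp_mul_chi c 1 hx]
  have h2 : (0 : ℂ) < Complex.exp ((1 : ℝ) * h.chi c x) := by
    rw [← h.pull_inv_normSq_eq c hx, LocalCoord.pull]
    exact_mod_cast inv_pos.2 (h.normSq_param_pos c hx)
  have h3 := posDef_fromBlocks_add_vecMulVec (hpos c x.1 (fst_one_mem_dom c hx))
    (θ := fun i => dWirt (h.chi c) (dir d i) x) (h.dWirt_chi_inr_ne_zero c hx)
  rw [Complex.ofReal_one, one_pow]
  exact h3.smul h2

end HermitianMetric

/-! ### Transformation of formal forms -/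

section Pull

variable {d : ℕ} {D : Type*} [TopologicalSpace D] [ChartedSpace (EuclideanSpace ℂ (Fin d)) D]
  {E : D → Type*} [∀ x, AddCommGroup (E x)] [∀ x, Module ℂ (E x)] [∀ x, TopologicalSpace (E x)]
  [TopologicalSpace (TotalSpace ℂ E)] [FiberBundle ℂ E] [VectorBundle ℂ ℂ E]
  {f f' : TotalSpace ℂ E → ℝ} (c c' : LocalCoord d E) {x : Coord d}

theorem IsSmooth.pull (hf : IsSmooth d f) : ContDiffOn ℝ ∞ (c.pull f) c.dom :=
  Complex.ofRealCLM.contDiff.comp_contDiffOn (hf c)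

theorem IsSmooth.isHermitian_ddbar (hf : IsSmooth d f) (hx : x ∈ c.dom) :
    (ddbar (dir d) (c.pull f) x).IsHermitian :=
  ddbar_isHermitian c.isOpen_dom (hf.pull c) (fun y _ => by simp [LocalCoord.pull]) hx

theorem ddbar_pull_congr (h : ∀ p : TotalSpace ℂ E, p.2 ≠ 0 → f p = f' p) (hx : x ∈ c.dom) :
    ddbar (dir d) (c.pull f) x = ddbar (dir d) (c.pull f') x :=
  ddbar_congr_of_eqOn c.isOpen_dom (fun y hy => by
    simp only [LocalCoord.pull, h _ (c.param_mem_patch hy).2.2]) hx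

theorem IsSmooth.ddbar_fibreMul (hf : IsSmooth d f) (hf' : IsSmooth d f') {l : ℂ} (hl : l ≠ 0)
    {κ μ : ℝ} (h : ∀ p : TotalSpace ℂ E, p.2 ≠ 0 → κ * f p = μ * f' (cmul l p))
    (hx : x ∈ c.dom) :
    (κ : ℂ) • ddbar (dir d) (c.pull f) x =
      (μ : ℂ) • jacPull (jac (fibreMul l) x) (ddbar (dir d) (c.pull f') (fibreMul l x)) := by
  have hΦ := c.isHolCoordChange_fibreMul hl
  rw [← hΦ.ddbar_comp (hf'.pull c) hx, ← ddbar_const_mul c.isOpen_dom _ (hf.pull c) hx,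
    ← ddbar_const_mul c.isOpen_dom _ (hΦ.comp (hf'.pull c)) hx]
  refine ddbar_congr_of_eqOn c.isOpen_dom (fun y hy => ?_) hx
  simp only [LocalCoord.pull]
  rw [c.param_fibreMul hy]
  exact_mod_cast h _ (c.param_mem_patch hy).2.2

/-- Homogeneity of a function of weight `k`. -/
theorem HasWeight.dilate_eq {k : ℕ} (hw : HasWeight k f) (hf : IsSmooth d f) {r : ℝ} (hr : 0 < r)
    {p : TotalSpace ℂ E} (hp : p.2 ≠ 0) : f (dilate r p) = r ^ k * f p := by
  have hdil : ∀ s : ℝ, (dilate (Real.exp s) p).2 ≠ 0 := fun s =>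
    cmul_snd_ne_zero (by exact_mod_cast (Real.exp_pos s).ne') hp
  have hadd : ∀ s s' : ℝ, dilate (Real.exp s') (dilate (Real.exp s) p) =
      dilate (Real.exp (s + s')) p := fun s s' => by
    rw [dilate_eq_cmul, dilate_eq_cmul, cmul_cmul, dilate_eq_cmul, Real.exp_add]
    push_cast
    rw [mul_comm]
  let c := LocalCoord.around d p
  have hpc := LocalCoord.mem_patch_around (d := d) hp
  have hx := c.coords_mem_dom hpc
  have hcurve : ∀ s : ℝ, dilate (Real.exp s) p =
      c.param (fibreMul (Real.exp s : ℂ) (c.coords p)) := fun s => by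
    rw [c.param_fibreMul hx, c.param_coords hpc]
    rfl
  have hdiff : Differentiable ℝ fun s : ℝ => f (dilate (Real.exp s) p) := by
    intro s
    simp only [hcurve]
    have h1 : DifferentiableAt ℝ (fun y => f (c.param y))
        (fibreMul (Real.exp s : ℂ) (c.coords p)) :=
      differentiableAt_of_contDiffOn (hf c) c.isOpen_dom
        (c.fibreMul_mem_dom (by exact_mod_cast (Real.exp_pos s).ne') hx)
    refine DifferentiableAt.comp (g := fun y => f (c.param y)) s h1 ?_
    have h2 : DifferentiableAt ℝ (fun s : ℝ => ((Real.exp s : ℝ) : ℂ)) s :=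
      (Real.hasDerivAt_exp s).ofReal_comp.differentiableAt
    exact (differentiableAt_const _).prodMk (h2.mul_const _)
  -- `HasWeight` only speaks of `s = 0`; applied at the point `δ_{e^s} p` it becomes a differential
  -- equation for all `s`. Differentiability comes from `hdiff`, because the value of `deriv` alone
  -- does not provide it.
  have hderiv : ∀ s : ℝ, HasDerivAt (fun s : ℝ => f (dilate (Real.exp s) p))
      (k * f (dilate (Real.exp s) p)) s := by
    intro s
    have h1 := hw _ (hdil s)
    simp only [hadd] at h1
    rw [← h1]
    have h2 := deriv_comp_const_add (f := fun s : ℝ => f (dilate (Real.exp s) p)) s 0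
    rw [h2, add_zero]
    exact (hdiff s).hasDerivAt
  have hconst : ∀ s : ℝ, HasDerivAt
      (fun s : ℝ => Real.exp (-(k * s)) * f (dilate (Real.exp s) p)) 0 s := by
    intro s
    have h1 : HasDerivAt (fun s : ℝ => Real.exp (-(k * s)))
        (Real.exp (-(k * s)) * (-(k * 1))) s := (((hasDerivAt_id s).const_mul (k : ℝ)).neg).exp
    refine (h1.mul (hderiv s)).congr_deriv ?_
    ring
  have h3 := is_const_of_deriv_eq_zero (fun s => (hconst s).differentiableAt)
    (fun s => (hconst s).deriv) (Real.log r) 0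
  simp only [mul_zero, neg_zero, Real.exp_zero, one_mul, Real.exp_log hr] at h3
  have h4 : dilate 1 p = p := by
    rw [dilate_eq_cmul, Complex.ofReal_one, cmul_one]
  rw [h4, Real.exp_neg, ← Real.log_pow, Real.exp_log (by positivity)] at h3
  rw [← h3]
  field_simp

/-- Homogeneous functions have a weight. -/
theorem hasWeight_of_dilate_eq {k : ℕ}
    (h : ∀ r : ℝ, 0 < r → ∀ p : TotalSpace ℂ E, p.2 ≠ 0 → f (dilate r p) = r ^ k * f p) :
    HasWeight k f := by
  intro p hp
  have h1 : (fun s : ℝ => f (dilate (Real.exp s) p)) = fun s : ℝ => Real.exp s ^ k * f p :=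
    funext fun s => h _ (Real.exp_pos s) p hp
  rw [h1]
  simp

variable [IsManifold 𝓘(ℂ, EuclideanSpace ℂ (Fin d)) ω D]
  [ContMDiffVectorBundle ω ℂ E 𝓘(ℂ, EuclideanSpace ℂ (Fin d))]

theorem IsSmooth.ddbar_transition (hf : IsSmooth d f) (hx : x ∈ c.overlap c') :
    ddbar (dir d) (c.pull f) x =
      jacPull (jac (c.transition c') x) (ddbar (dir d) (c'.pull f) (c.transition c' x)) := by
  have hΦ := c.isHolCoordChange_transition c'
  rw [← hΦ.ddbar_comp (hf.pull c') hx]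
  refine ddbar_congr_of_eqOn hΦ.isOpen (fun y hy => ?_) hx
  simp only [LocalCoord.pull]
  rw [c.param_transition c' hy]

end Pull

/-! ### Scaling of the cone form and of its Ricci form -/

namespace HermitianMetric

variable {d : ℕ} {D : Type*} [TopologicalSpace D] [ChartedSpace (EuclideanSpace ℂ (Fin d)) D]
  {E : D → Type*} [∀ x, AddCommGroup (E x)] [∀ x, Module ℂ (E x)] [∀ x, TopologicalSpace (E x)]
  [TopologicalSpace (TotalSpace ℂ E)] [FiberBundle ℂ E] [VectorBundle ℂ ℂ E]
  {h : HermitianMetric d E} (hpos : h.IsPositive) (c c' : LocalCoord d E) {x : Coord d}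

include hpos in
theorem det_omega0_pos (hx : x ∈ c.dom) : 0 < (h.omega0 c x).det :=
  (posDef_omega0 c hpos hx).det_pos

variable (h) in
theorem contDiffOn_omega0 (i j : Idx d) : ContDiffOn ℝ ∞ (fun y => h.omega0 c y i j) c.dom :=
  contDiffOn_ddbar (h.isSmooth_inv_normSq.pull c) c.isOpen_dom i j

variable (h) in
theorem contDiffOn_det_omega0 : ContDiffOn ℝ ∞ (fun y => (h.omega0 c y).det) c.dom := by
  simp only [Matrix.det_apply, Units.smul_def, zsmul_eq_mul]
  exact ContDiffOn.sum fun σ _ => contDiffOn_const.mul (contDiffOn_prod fun i _ =>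
    h.contDiffOn_omega0 c _ _)

variable (h) in
theorem omega0_fibreMul {l : ℂ} (hl : l ≠ 0) (hx : x ∈ c.dom) :
    h.omega0 c x =
      ((‖l‖ ^ 2 : ℝ) : ℂ) • jacPull (jac (fibreMul l) x) (h.omega0 c (fibreMul l x)) := by
  have := h.isSmooth_inv_normSq.ddbar_fibreMul c h.isSmooth_inv_normSq hl (κ := 1)
    (μ := ‖l‖ ^ 2) (fun p hp => ?_) hx
  · rwa [Complex.ofReal_one, one_smul] at this
  · have h1 := (h.normSq_pos p hp).ne'
    rw [h.normSq_cmul]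
    field_simp

include hpos in
theorem ricciForm_fibreMul {l : ℂ} (hl : l ≠ 0) (hx : x ∈ c.dom) :
    ricciForm (h.omega0 c) x =
      jacPull (jac (fibreMul l) x) (ricciForm (h.omega0 c) (fibreMul l x)) :=
  (c.isHolCoordChange_fibreMul hl).ricciForm_eq (by positivity)
    (fun _ hy => h.omega0_fibreMul c hl hy) (fun _ hy => det_omega0_pos hpos c hy)
    (h.contDiffOn_det_omega0 c) hx

include hpos in
theorem contDiffOn_log_det_omega0 :
    ContDiffOn ℝ ∞ (fun y => Complex.log (h.omega0 c y).det) c.dom := fun y hy => by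
  have h1 : ContDiffAt ℝ ∞ Complex.log (h.omega0 c y).det :=
    (Complex.contDiffAt_log
      (Or.inl (Complex.pos_iff.1 (det_omega0_pos hpos c hy)).1)).restrict_scalars ℝ
  exact h1.comp_contDiffWithinAt y (h.contDiffOn_det_omega0 c y hy)

include hpos in
theorem contDiffOn_ricciForm (i j : Idx d) :
    ContDiffOn ℝ ∞ (fun y => ricciForm (h.omega0 c) y i j) c.dom :=
  (contDiffOn_ddbar (contDiffOn_log_det_omega0 hpos c) c.isOpen_dom i j).neg

include hpos in
theorem log_det_omega0_eq (hx : x ∈ c.dom) :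
    Complex.log (h.omega0 c x).det = ((Real.log ‖(h.omega0 c x).det‖ : ℝ) : ℂ) := by
  rw [Complex.ofReal_log (norm_nonneg _)]
  congr 1
  rw [Complex.norm_of_nonneg' (det_omega0_pos hpos c hx).le]

include hpos in
theorem isHermitian_ricciForm (hx : x ∈ c.dom) : (ricciForm (h.omega0 c) x).IsHermitian :=
  (ddbar_isHermitian c.isOpen_dom (contDiffOn_log_det_omega0 hpos c) (fun y hy => by
    rw [log_det_omega0_eq hpos c hy]
    simp) hx).neg

include hpos in
-- The factor `‖l‖ ^ 2` in a matrix of size `d + 1` contributes `‖l‖ ^ (2(d + 1))`, and the Jacobian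
-- determinant `l` contributes `‖l‖ ^ 2` more.
theorem log_det_omega0_fibreMul {l : ℂ} (hl : l ≠ 0) (hx : x ∈ c.dom) :
    Complex.log (h.omega0 c (fibreMul l x)).det =
      Complex.log (h.omega0 c x).det - ((2 * (d + 2) * Real.log ‖l‖ : ℝ) : ℂ) := by
  have hlx := c.fibreMul_mem_dom hl hx
  have hJ : (jac (fibreMul l) x).det = l := by
    rw [jac_fibreMul, Matrix.det_diagonal, Fintype.prod_sum_type]
    simp [idxWeight]
  have hdet := congrArg (fun A => ‖Matrix.det A‖) (h.omega0_fibreMul c hl hx)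
  simp only [Matrix.det_smul, det_jacPull, hJ, norm_mul, norm_pow, Complex.norm_real, norm_norm,
    Fintype.card_sum, Fintype.card_fin, Fintype.card_unit] at hdet
  have hl' : 0 < ‖l‖ := norm_pos_iff.2 hl
  have hp : 0 < ‖(h.omega0 c (fibreMul l x)).det‖ :=
    norm_pos_iff.2 (det_omega0_pos hpos c hlx).ne'
  rw [log_det_omega0_eq hpos c hx, log_det_omega0_eq hpos c hlx, hdet,
    Real.log_mul (by positivity) (by positivity), Real.log_mul (by positivity) hp.ne',
    Real.log_pow, Real.log_pow]
  push_cast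
  ring

include hpos in
-- Since `z ∂_z log det ω_0` is the constant `-(d + 2)`, a further `∂̄` kills it. This removes the
-- Ricci term from the gradient equation.
theorem ricciForm_inr (hx : x ∈ c.dom) (j : Idx d) :
    ricciForm (h.omega0 c) x (Sum.inr ()) j = 0 := by
  have h1 : ∀ y ∈ c.dom, y.2 * dWirt (fun y => Complex.log (h.omega0 c y).det)
      (dir d (Sum.inr ())) y = 0 * Complex.log (h.omega0 c y).det + (-(d + 2 : ℂ)) := by
    intro y hy
    rw [snd_mul_dWirt_of_invariant (A := -(2 * (d + 2) : ℂ))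
      (differentiableAt_of_contDiffOn (contDiffOn_log_det_omega0 hpos c) c.isOpen_dom hy)]
    · ring
    · have : (fun s : ℝ => Complex.log (h.omega0 c (fibreMul (Real.exp s : ℂ) y)).det) =
          fun s : ℝ => Complex.log (h.omega0 c y).det - (2 * (d + 2) : ℂ) * (s : ℂ) := by
        ext s
        rw [log_det_omega0_fibreMul hpos c (by exact_mod_cast (Real.exp_pos s).ne') hy]
        simp [Complex.norm_exp]
      rw [this]
      simpa using ((Complex.ofRealCLM.hasDerivAt (x := (0 : ℝ))).const_mul
        (2 * (d + 2) : ℂ)).const_sub (Complex.log (h.omega0 c y).det)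
    · intro s
      rw [log_det_omega0_fibreMul hpos c (Complex.exp_ne_zero _) hy]
      simp [Complex.norm_exp]
  have h2 := snd_mul_ddbar_of_euler c.isOpen_dom (contDiffOn_log_det_omega0 hpos c) h1 hx j
  rw [zero_mul] at h2
  simp [ricciForm, (mul_eq_zero.1 h2).resolve_left hx.2.2]

/-! ### Scaling, locality, reality and coordinate independence of the formal volume ratio -/

section FormalForm

variable {u u' : ℕ → TotalSpace ℂ E → ℝ} {k : ℕ}

include hpos in
-- The Ricci form is invariant under fibre multiplication, so the two times have to satisfy `ρ² t =
-- ‖l‖² t'`. Taking `ρ = ‖l‖` keeps time fixed and expresses homogeneity; taking `ρ = 1` is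
-- parabolic scaling.
theorem formalForm_fibreMul {l : ℂ} (hl : l ≠ 0) {ρ t t' : ℝ} (ht : ρ ^ 2 * t = ‖l‖ ^ 2 * t')
    (hu : ∀ j, j + 2 ≤ k → IsSmooth d (u j)) (hu' : ∀ j, j + 2 ≤ k → IsSmooth d (u' j))
    (huu' : ∀ j, j + 2 ≤ k → ∀ p : TotalSpace ℂ E, p.2 ≠ 0 →
      ρ ^ (j + 2) * u j p = ‖l‖ ^ 2 * u' j (cmul l p)) (hx : x ∈ c.dom) :
    ∀ a ≤ k, (ρ : ℂ) ^ a • h.formalForm c t u a x =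
      ((‖l‖ ^ 2 : ℝ) : ℂ) • jacPull (jac (fibreMul l) x) (h.formalForm c t' u' a (fibreMul l x))
  | 0, _ => by
    rw [pow_zero, one_smul]
    exact h.omega0_fibreMul c hl hx
  | 1, _ => by simp [formalForm]
  | j + 2, hj => by
    have h1 := (hu j hj).ddbar_fibreMul c (hu' j hj) hl (huu' j hj) hx
    have h2 := ricciForm_fibreMul hpos c hl hx
    simp only [formalForm]
    rw [smul_add, jacPull_add, smul_add, ← h1, Complex.ofReal_pow ρ]
    congr 1
    split_ifs with hj0
    · subst hj0
      rw [jacPull_smul, ← h2, smul_smul, smul_smul]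
      congr 1
      have : (ρ : ℂ) ^ 2 * t = ((‖l‖ ^ 2 : ℝ) : ℂ) * t' := by exact_mod_cast ht
      linear_combination -this
    · simp

include hpos in
-- The common factor `‖l‖ ^ 2` is absorbed into the left constant matrix, so only the powers of `ρ`
-- remain.
theorem coeff_logRatio_fibreMul {l : ℂ} (hl : l ≠ 0) {ρ t t' : ℝ}
    (ht : ρ ^ 2 * t = ‖l‖ ^ 2 * t')
    (hu : ∀ j, j + 2 ≤ k → IsSmooth d (u j)) (hu' : ∀ j, j + 2 ≤ k → IsSmooth d (u' j))
    (huu' : ∀ j, j + 2 ≤ k → ∀ p : TotalSpace ℂ E, p.2 ≠ 0 →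
      ρ ^ (j + 2) * u j p = ‖l‖ ^ 2 * u' j (cmul l p)) (hx : x ∈ c.dom) :
    PowerSeries.coeff k (logVolumeRatio (h.formalForm c t' u') (fibreMul l x)) =
      (ρ : ℂ) ^ k * PowerSeries.coeff k (logVolumeRatio (h.formalForm c t u) x) := by
  have hJ := (c.isHolCoordChange_fibreMul hl).det_ne_zero x hx
  have hl' : ((‖l‖ ^ 2 : ℝ) : ℂ) ≠ 0 := by
    exact_mod_cast pow_ne_zero 2 (norm_ne_zero_iff.2 hl)
  rw [logVolumeRatio_eq_logRatio, logVolumeRatio_eq_logRatio]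
  refine coeff_logRatio_of_scaling (M := fun a => h.formalForm c t u a x)
    (N := fun a => h.formalForm c t' u' a (fibreMul l x))
    (A := ((‖l‖ ^ 2 : ℝ) : ℂ) • (jac (fibreMul l) x).transpose)
    (B := (jac (fibreMul l) x).map star) ?_ ?_ (det_omega0_pos hpos c hx).ne' fun a ha => ?_
  · rw [Matrix.det_smul, Matrix.det_transpose]
    exact mul_ne_zero (pow_ne_zero _ hl') hJ
  · rw [det_map_star]
    simpa using hJ
  · rw [formalForm_fibreMul hpos c hl ht hu hu' huu' hx a ha]
    simp [jacPull]

include hpos in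
-- The index shift by two between potentials and entries makes the flow equation recursive.
theorem coeff_logRatio_congr {t : ℝ}
    (huu' : ∀ j, j + 2 ≤ k → ∀ p : TotalSpace ℂ E, p.2 ≠ 0 → u j p = u' j p)
    (hx : x ∈ c.dom) :
    PowerSeries.coeff k (logVolumeRatio (h.formalForm c t u) x) =
      PowerSeries.coeff k (logVolumeRatio (h.formalForm c t u') x) := by
  rw [logVolumeRatio_eq_logRatio, logVolumeRatio_eq_logRatio]
  refine logRatio_congr_coeff (M := fun a => h.formalForm c t u a x)
    (N := fun a => h.formalForm c t u' a x) (det_omega0_pos hpos c hx).ne' fun a ha => ?_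
  match a with
  | 0 => rfl
  | 1 => rfl
  | j + 2 => simp only [formalForm, ddbar_pull_congr c (huu' j ha) hx]

include hpos in
theorem isHermitian_formalForm {t : ℝ} (hu : ∀ j, j + 2 ≤ k → IsSmooth d (u j))
    (hx : x ∈ c.dom) : ∀ a ≤ k, (h.formalForm c t u a x).IsHermitian
  | 0, _ => (posDef_omega0 c hpos hx).1
  | 1, _ => Matrix.isHermitian_zero
  | j + 2, hj => by
    refine Matrix.IsHermitian.add ?_ ((hu j hj).isHermitian_ddbar c hx)
    split_ifs
    · have := isHermitian_ricciForm hpos c hx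
      rw [Matrix.IsHermitian] at this ⊢
      rw [Matrix.conjTranspose_smul, this]
      simp
    · exact Matrix.isHermitian_zero

include hpos in
theorem coeff_logRatio_real {t : ℝ} (hu : ∀ j, j + 2 ≤ k → IsSmooth d (u j))
    (hx : x ∈ c.dom) :
    (((PowerSeries.coeff k (logVolumeRatio (h.formalForm c t u) x)).re : ℝ) : ℂ) =
      PowerSeries.coeff k (logVolumeRatio (h.formalForm c t u) x) := by
  -- The potentials beyond the range of `hu` need not be smooth, so their entries need not be
  -- Hermitian. They do not affect coefficient `k` and are replaced by `0`.
  set M : ℕ → Matrix (Idx d) (Idx d) ℂ :=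
    fun a => if a ≤ k then h.formalForm c t u a x else 0
  have h0 : (M 0).det ≠ 0 := (det_omega0_pos hpos c hx).ne'
  have h1 : PowerSeries.coeff k (logVolumeRatio (h.formalForm c t u) x) =
      PowerSeries.coeff k (logRatio M) := by
    rw [logVolumeRatio_eq_logRatio]
    exact (logRatio_congr_coeff h0 fun a ha => if_pos ha).symm
  rw [h1]
  refine Complex.conj_eq_iff_re.1 (star_coeff_logRatio (fun a => ?_) h0 k)
  simp only [M]
  split_ifs with ha
  · exact isHermitian_formalForm hpos c hu hx a ha
  · exact Matrix.isHermitian_zero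

variable [IsManifold 𝓘(ℂ, EuclideanSpace ℂ (Fin d)) ω D]
  [ContMDiffVectorBundle ω ℂ E 𝓘(ℂ, EuclideanSpace ℂ (Fin d))]

variable (h) in
theorem omega0_transition (hx : x ∈ c.overlap c') :
    h.omega0 c x =
      jacPull (jac (c.transition c') x) (h.omega0 c' (c.transition c' x)) :=
  h.isSmooth_inv_normSq.ddbar_transition c c' hx

include hpos in
theorem ricciForm_transition (hx : x ∈ c.overlap c') :
    ricciForm (h.omega0 c) x =
      jacPull (jac (c.transition c') x) (ricciForm (h.omega0 c') (c.transition c' x)) :=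
  (c.isHolCoordChange_transition c').ricciForm_eq one_pos
    (fun y hy => by rw [h.omega0_transition c c' hy, Complex.ofReal_one, one_smul])
    (fun _ hy => det_omega0_pos hpos c' hy) (h.contDiffOn_det_omega0 c') hx

include hpos in
-- A case of scaling with `r = 1` and Jacobian matrices on both sides. It makes the right-hand side
-- of the flow equation a function on the total space.
theorem coeff_logRatio_transition {t : ℝ} (hu : ∀ j, j + 2 ≤ k → IsSmooth d (u j))
    (hx : x ∈ c.overlap c') :
    PowerSeries.coeff k (logVolumeRatio (h.formalForm c' t u) (c.transition c' x)) =
      PowerSeries.coeff k (logVolumeRatio (h.formalForm c t u) x) := by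
  have hJ := (c.isHolCoordChange_transition c').det_ne_zero x hx
  have key := coeff_logRatio_of_scaling (r := 1) (k := k)
    (M := fun a => h.formalForm c t u a x)
    (N := fun a => h.formalForm c' t u a (c.transition c' x))
    (A := (jac (c.transition c') x).transpose)
    (B := (jac (c.transition c') x).map star) (by rwa [Matrix.det_transpose])
    (by rw [det_map_star]; simpa using hJ) (det_omega0_pos hpos c hx.1).ne' fun a ha => ?_
  · rw [logVolumeRatio_eq_logRatio, logVolumeRatio_eq_logRatio, key, Complex.ofReal_one, one_pow,
      one_mul]
  · rw [Complex.ofReal_one, one_pow, one_smul]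
    change _ = jacPull _ _
    match a with
    | 0 => exact h.omega0_transition c c' hx
    | 1 => simp [formalForm]
    | j + 2 =>
      simp only [formalForm]
      rw [jacPull_add, ← (hu j ha).ddbar_transition c c' hx]
      congr 1
      split_ifs
      · rw [jacPull_smul, ← ricciForm_transition hpos c c' hx]
      · simp

end FormalForm

end HermitianMetric

/-! ### Families that are polynomial in time -/

section TimePolynomials

open Polynomial (monomial)

variable {d : ℕ} {U : Set (Coord d)} {k m : ℕ}

/-- A pair of families `P true`, `P false` of polynomials in time, of degree at most `k / 2` and
with coefficients that are smooth on `U`; the coefficients of degree `k / 2` agree. -/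
structure IsTimePolynomial (U : Set (Coord d)) (k : ℕ) (P : Bool → Coord d → Polynomial ℂ) :
    Prop where
  smooth : ∀ b i, ContDiffOn ℝ ∞ (fun x => (P b x).coeff i) U
  degree : ∀ b x i, k < 2 * i → (P b x).coeff i = 0
  top : ∀ x i, k ≤ 2 * i → (P true x).coeff i = (P false x).coeff i

namespace IsTimePolynomial

variable {P Q : Bool → Coord d → Polynomial ℂ}

theorem add (hP : IsTimePolynomial U k P) (hQ : IsTimePolynomial U k Q) :
    IsTimePolynomial U k fun b x => P b x + Q b x where
  smooth b i := by
    simp only [Polynomial.coeff_add]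
    exact (hP.smooth b i).add (hQ.smooth b i)
  degree b x i hi := by simp [hP.degree b x i hi, hQ.degree b x i hi]
  top x i hi := by simp [hP.top x i hi, hQ.top x i hi]

theorem mul (hP : IsTimePolynomial U k P) (hQ : IsTimePolynomial U m Q) :
    IsTimePolynomial U (k + m) fun b x => P b x * Q b x where
  smooth b i := by
    simp only [Polynomial.coeff_mul]
    exact ContDiffOn.sum fun p _ => (hP.smooth b p.1).mul (hQ.smooth b p.2)
  degree b x i hi := by
    rw [Polynomial.coeff_mul]
    refine Finset.sum_eq_zero fun p hp => ?_
    rw [Finset.HasAntidiagonal.mem_antidiagonal] at hp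
    by_cases h : k < 2 * p.1
    · rw [hP.degree b x _ h, zero_mul]
    · rw [hQ.degree b x _ (by omega), mul_zero]
  top x i hi := by
    rw [Polynomial.coeff_mul, Polynomial.coeff_mul]
    refine Finset.sum_congr rfl fun p hp => ?_
    rw [Finset.HasAntidiagonal.mem_antidiagonal] at hp
    -- A term that does not vanish has `2 p.1 ≤ k` and `2 p.2 ≤ m`. Together with `k + m ≤ 2 i` this
    -- forces equalities, so only top coefficients are multiplied.
    by_cases h1 : k < 2 * p.1
    · rw [hP.degree _ x _ h1, hP.degree _ x _ h1, zero_mul, zero_mul]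
    · by_cases h2 : m < 2 * p.2
      · rw [hQ.degree _ x _ h2, hQ.degree _ x _ h2, mul_zero, mul_zero]
      · rw [hP.top x _ (by omega), hQ.top x _ (by omega)]

theorem C {a : Coord d → ℂ} (ha : ContDiffOn ℝ ∞ a U) :
    IsTimePolynomial U k fun _ x => Polynomial.C (a x) where
  smooth b i := by
    simp only [Polynomial.coeff_C]
    split_ifs
    · exact ha
    · exact contDiffOn_const
  degree b x i hi := by simp [Polynomial.coeff_C, show i ≠ 0 by omega]
  top x i hi := rfl

theorem monomial_one {a : Coord d → ℂ} (ha : ContDiffOn ℝ ∞ a U) :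
    IsTimePolynomial U 2 fun _ x => monomial 1 (a x) where
  smooth b i := by
    simp only [Polynomial.coeff_monomial]
    split_ifs
    · exact ha
    · exact contDiffOn_const
  degree b x i hi := by simp [Polynomial.coeff_monomial, show 1 ≠ i by omega]
  top x i hi := rfl

theorem eval_eq_sum (hP : IsTimePolynomial U k P) (b : Bool) (x : Coord d) (t : ℂ) :
    (P b x).eval t = ∑ i ∈ Finset.range (k + 1), t ^ i * (P b x).coeff i := by
  rw [Polynomial.eval_eq_sum_range' (n := k + 1)]
  · exact Finset.sum_congr rfl fun i _ => mul_comm _ _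
  · refine Nat.lt_succ_of_le (Polynomial.natDegree_le_iff_coeff_eq_zero.2 fun i hi => ?_)
    exact hP.degree b x i (by omega)

/-- Applying a linear operation to the coefficients. -/
theorem mapCoeff (hP : IsTimePolynomial U k P) {L : (Coord d → ℂ) → Coord d → ℂ}
    (hL : ∀ a, ContDiffOn ℝ ∞ a U → ContDiffOn ℝ ∞ (L a) U) (hL0 : L (fun _ => 0) = fun _ => 0) :
    IsTimePolynomial U k fun b x =>
      ∑ i ∈ Finset.range (k + 1), monomial i (L (fun y => (P b y).coeff i) x) := by
  have hc : ∀ b x i, (∑ n ∈ Finset.range (k + 1),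
      monomial n (L (fun y => (P b y).coeff n) x)).coeff i = L (fun y => (P b y).coeff i) x := by
    intro b x i
    simp only [Polynomial.finsetSum_coeff, Polynomial.coeff_monomial, Finset.sum_ite_eq',
      Finset.mem_range]
    split_ifs with hi
    · rfl
    · have : (fun y => (P b y).coeff i) = fun _ => 0 :=
        funext fun y => hP.degree b y i (by omega)
      rw [this, hL0]
  refine ⟨fun b i => ?_, fun b x i hi => ?_, fun x i hi => ?_⟩
  · simp only [hc]
    exact hL _ (hP.smooth b i)
  · have : (fun y => (P b y).coeff i) = fun _ => 0 := funext fun y => hP.degree b y i hi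
    rw [hc, this, hL0]
  · have : (fun y => (P true y).coeff i) = fun y => (P false y).coeff i :=
      funext fun y => hP.top y i hi
    rw [hc, hc, this]

/-- The polynomials with derivative `P` and constant term `a`. -/
theorem antideriv (hP : IsTimePolynomial U k P) {a : Bool → Coord d → ℂ}
    (ha : ∀ b, ContDiffOn ℝ ∞ (a b) U) :
    ∃ Q : Bool → Coord d → Polynomial ℂ, IsTimePolynomial U (k + 2) Q ∧
      (∀ b x, (Q b x).derivative = P b x) ∧ ∀ b x, (Q b x).eval 0 = a b x := by
  let Q : Bool → Coord d → Polynomial ℂ := fun b x => Polynomial.C (a b x) +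
    ∑ i ∈ Finset.range (k + 1), monomial (i + 1) ((P b x).coeff i / ((i : ℂ) + 1))
  have hc0 : ∀ b x, (Q b x).coeff 0 = a b x := by
    intro b x
    simp [Q, Polynomial.coeff_monomial]
  have hc : ∀ b x i, (Q b x).coeff (i + 1) = (P b x).coeff i / ((i : ℂ) + 1) := by
    intro b x i
    simp only [Q, Polynomial.coeff_add, Polynomial.coeff_C_succ, zero_add,
      Polynomial.finsetSum_coeff, Polynomial.coeff_monomial, add_left_inj, Finset.sum_ite_eq',
      Finset.mem_range]
    split_ifs with hi
    · rfl
    · rw [hP.degree b x i (by omega), zero_div]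
  refine ⟨Q, ⟨?_, ?_, ?_⟩, ?_, ?_⟩
  · rintro b (_ | i)
    · simpa only [hc0] using ha b
    · simp only [hc]
      exact (hP.smooth b i).div_const _
  · rintro b x (_ | i) hi
    · omega
    · rw [hc, hP.degree b x i (by omega), zero_div]
  -- The initial values sit in degree `0`, strictly below `(k + 2)/2`, and so never reach the top
  -- coefficient. This is why leading terms forget the initial data.
  · rintro x (_ | i) hi
    · omega
    · rw [hc, hc, hP.top x i (by omega)]
  · intro b x
    ext i
    rw [Polynomial.coeff_derivative, hc, div_mul_cancel₀]
    exact_mod_cast Nat.succ_ne_zero i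
  · intro b x
    rw [← Polynomial.coeff_zero_eq_eval_zero, hc0]

end IsTimePolynomial

/-- A pair of functions on `[0, ∞) × U` given by polynomials in time as above. -/
def IsTimePoly (U : Set (Coord d)) (k : ℕ) (f : Bool → ℝ → Coord d → ℂ) : Prop :=
  ∃ P, IsTimePolynomial U k P ∧ ∀ b, ∀ t : ℝ, 0 ≤ t → ∀ x ∈ U, f b t x = (P b x).eval (t : ℂ)

namespace IsTimePoly

variable {f g : Bool → ℝ → Coord d → ℂ}

theorem congr (hf : IsTimePoly U k f) (h : ∀ b, ∀ t : ℝ, 0 ≤ t → ∀ x ∈ U, g b t x = f b t x) :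
    IsTimePoly U k g := by
  obtain ⟨P, hP, hfP⟩ := hf
  exact ⟨P, hP, fun b t ht x hx => (h b t ht x hx).trans (hfP b t ht x hx)⟩

theorem add (hf : IsTimePoly U k f) (hg : IsTimePoly U k g) :
    IsTimePoly U k fun b t x => f b t x + g b t x := by
  obtain ⟨P, hP, hfP⟩ := hf
  obtain ⟨Q, hQ, hgQ⟩ := hg
  refine ⟨_, hP.add hQ, fun b t ht x hx => ?_⟩
  simp only [hfP b t ht x hx, hgQ b t ht x hx, Polynomial.eval_add]

theorem of_smooth {a : Coord d → ℂ} (ha : ContDiffOn ℝ ∞ a U) :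
    IsTimePoly U k fun _ _ x => a x :=
  ⟨_, IsTimePolynomial.C ha, fun b t ht x hx => by simp⟩

theorem time_mul {a : Coord d → ℂ} (ha : ContDiffOn ℝ ∞ a U) :
    IsTimePoly U 2 fun _ t x => (t : ℂ) * a x :=
  ⟨_, IsTimePolynomial.monomial_one ha, fun b t ht x hx => by simp [mul_comm]⟩

theorem dWirt (hU : IsOpen U) (hf : IsTimePoly U k f) (v : Coord d) :
    IsTimePoly U k fun b t x => dWirt (f b t) v x := by
  obtain ⟨P, hP, hfP⟩ := hf
  refine ⟨_, hP.mapCoeff (L := fun a x => FormalKRF.dWirt a v x)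
    (fun a ha => contDiffOn_dWirt ha hU v) (by simp), fun b t ht x hx => ?_⟩
  have h1 : f b t =ᶠ[𝓝 x] fun y => ∑ i ∈ Finset.range (k + 1), (t : ℂ) ^ i * (P b y).coeff i := by
    filter_upwards [hU.mem_nhds hx] with y hy
    rw [hfP b t ht y hy, hP.eval_eq_sum]
  have h2 : ∀ i, DifferentiableAt ℝ (fun y => (P b y).coeff i) x := fun i =>
    differentiableAt_of_contDiffOn (hP.smooth b i) hU hx
  beta_reduce
  rw [dWirt_congr h1, dWirt_sum fun i _ => (h2 i).const_mul _, Polynomial.eval_finsetSum]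
  refine Finset.sum_congr rfl fun i _ => ?_
  rw [dWirt_const_mul _ (h2 i), Polynomial.eval_monomial, mul_comm]

theorem dbarWirt (hU : IsOpen U) (hf : IsTimePoly U k f) (v : Coord d) :
    IsTimePoly U k fun b t x => dbarWirt (f b t) v x := by
  obtain ⟨P, hP, hfP⟩ := hf
  refine ⟨_, hP.mapCoeff (L := fun a x => FormalKRF.dbarWirt a v x)
    (fun a ha => contDiffOn_dbarWirt ha hU v) (by simp), fun b t ht x hx => ?_⟩
  have h1 : f b t =ᶠ[𝓝 x] fun y => ∑ i ∈ Finset.range (k + 1), (t : ℂ) ^ i * (P b y).coeff i := by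
    filter_upwards [hU.mem_nhds hx] with y hy
    rw [hfP b t ht y hy, hP.eval_eq_sum]
  have h2 : ∀ i, DifferentiableAt ℝ (fun y => (P b y).coeff i) x := fun i =>
    differentiableAt_of_contDiffOn (hP.smooth b i) hU hx
  beta_reduce
  rw [dbarWirt_congr h1, dbarWirt_sum fun i _ => (h2 i).const_mul _, Polynomial.eval_finsetSum]
  refine Finset.sum_congr rfl fun i _ => ?_
  rw [dbarWirt_const_mul _ (h2 i), Polynomial.eval_monomial, mul_comm]

theorem ddbar (hU : IsOpen U) (hf : IsTimePoly U k f) (i j : Idx d) :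
    IsTimePoly U k fun b t x => ddbar (dir d) (f b t) x i j :=
  (hf.dbarWirt hU (dir d j)).dWirt hU (dir d i)

theorem contDiffOn (hf : IsTimePoly U k f) (b : Bool) :
    ContDiffOn ℝ ∞ (fun q : ℝ × Coord d => f b q.1 q.2) (Ici 0 ×ˢ U) := by
  obtain ⟨P, hP, hfP⟩ := hf
  have h1 : ContDiffOn ℝ ∞ (fun q : ℝ × Coord d =>
      ∑ i ∈ Finset.range (k + 1), (q.1 : ℂ) ^ i * (P b q.2).coeff i) (Ici 0 ×ˢ U) := by
    refine ContDiffOn.sum fun i _ => ContDiffOn.mul ?_ ?_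
    · exact ((Complex.ofRealCLM.contDiff.comp contDiff_fst).pow i).contDiffOn
    · exact (hP.smooth b i).comp contDiff_snd.contDiffOn fun q hq => hq.2
  refine h1.congr fun q hq => ?_
  rw [hfP b q.1 hq.1 q.2 hq.2, hP.eval_eq_sum]

theorem contDiffOn_slice (hf : IsTimePoly U k f) (b : Bool) {t : ℝ} (ht : 0 ≤ t) :
    ContDiffOn ℝ ∞ (f b t) U :=
  (hf.contDiffOn b).comp (contDiff_prodMk_right t).contDiffOn fun _ hx => ⟨ht, hx⟩

end IsTimePoly

theorem eq_of_hasDerivWithinAt_zero {f : ℝ → ℂ}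
    (hf : ∀ t : ℝ, 0 ≤ t → HasDerivWithinAt f 0 (Ici 0) t) {t : ℝ} (ht : 0 ≤ t) : f t = f 0 := by
  have := (convex_Ici (0 : ℝ)).norm_image_sub_le_of_norm_hasDerivWithin_le (f' := fun _ => 0)
    (C := 0) (fun s hs => hf s hs) (by simp) (self_mem_Ici) ht
  simpa [sub_eq_zero] using this

/-- Integration in time raises the degree by one. -/
theorem IsTimePoly.of_hasDerivWithinAt {f F : Bool → ℝ → Coord d → ℂ} (hf : IsTimePoly U k f)
    (hF : ∀ b, ∀ t : ℝ, 0 ≤ t → ∀ x ∈ U,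
      HasDerivWithinAt (fun τ => F b τ x) (f b t x) (Ici 0) t)
    (h0 : ∀ b, ContDiffOn ℝ ∞ (F b 0) U) : IsTimePoly U (k + 2) F := by
  obtain ⟨P, hP, hfP⟩ := hf
  obtain ⟨Q, hQ, hQ', hQ0⟩ := hP.antideriv h0
  refine ⟨Q, hQ, fun b t ht x hx => ?_⟩
  have h1 : ∀ t : ℝ, 0 ≤ t → HasDerivWithinAt (fun τ : ℝ => F b τ x - (Q b x).eval (τ : ℂ)) 0
      (Ici 0) t := by
    intro t ht
    have h2 := hF b t ht x hx
    have h3 : HasDerivAt (fun τ : ℝ => (Q b x).eval (τ : ℂ)) ((P b x).eval (t : ℂ)) t := by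
      rw [← hQ']
      exact ((Q b x).hasDerivAt (t : ℂ)).comp_ofReal
    rw [hfP b t ht x hx] at h2
    exact (h2.sub h3.hasDerivWithinAt).congr_deriv (sub_self _)
  have h4 := eq_of_hasDerivWithinAt_zero h1 ht
  simp only [Complex.ofReal_zero, hQ0, sub_self] at h4
  exact sub_eq_zero.1 h4

/-- The grading of functions on two copies of `[0, ∞) × U` by the degree in time. -/
def timeGrading (U : Set (Coord d)) (k : ℕ) :
    Submodule ℝ (Bool × Ici (0 : ℝ) × U → ℂ) where
  carrier := {f | ∃ P, IsTimePolynomial U k P ∧ ∀ τ, f τ = (P τ.1 τ.2.2).eval ((τ.2.1 : ℝ) : ℂ)}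
  add_mem' := by
    rintro f g ⟨P, hP, hfP⟩ ⟨Q, hQ, hgQ⟩
    exact ⟨_, hP.add hQ, fun τ => by simp [hfP, hgQ]⟩
  zero_mem' := ⟨_, IsTimePolynomial.C (a := fun _ => 0) contDiffOn_const, fun τ => by simp⟩
  smul_mem' r f := by
    rintro ⟨P, hP, hfP⟩
    have h1 : IsTimePolynomial U 0 fun _ _ => Polynomial.C (r : ℂ) :=
      IsTimePolynomial.C contDiffOn_const
    exact ⟨_, by simpa using h1.mul hP, fun τ => by simp [hfP]⟩

instance (U : Set (Coord d)) : SetLike.GradedMonoid (timeGrading U) where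
  one_mem := ⟨_, IsTimePolynomial.C (a := fun _ => 1) contDiffOn_const, fun τ => by simp⟩
  mul_mem := by
    rintro i j f g ⟨P, hP, hfP⟩ ⟨Q, hQ, hgQ⟩
    exact ⟨_, hP.mul hQ, fun τ => by simp [hfP, hgQ]⟩

theorem IsTimePoly.mem_timeGrading {f : Bool → ℝ → Coord d → ℂ} (hf : IsTimePoly U k f) :
    (fun τ : Bool × Ici (0 : ℝ) × U => f τ.1 τ.2.1 τ.2.2) ∈ timeGrading U k := by
  obtain ⟨P, hP, hfP⟩ := hf
  exact ⟨P, hP, fun τ => hfP _ _ τ.2.1.2 _ τ.2.2.2⟩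

theorem isTimePoly_of_mem_timeGrading {f : Bool → ℝ → Coord d → ℂ}
    (hf : (fun τ : Bool × Ici (0 : ℝ) × U => f τ.1 τ.2.1 τ.2.2) ∈ timeGrading U k) :
    IsTimePoly U k f := by
  obtain ⟨P, hP, hfP⟩ := hf
  exact ⟨P, hP, fun b t ht x hx => hfP (b, ⟨t, ht⟩, ⟨x, hx⟩)⟩

end TimePolynomials

/-! ### The formal flow -/

namespace HermitianMetric

variable {d : ℕ} {D : Type*} [TopologicalSpace D] [ChartedSpace (EuclideanSpace ℂ (Fin d)) D]
  {E : D → Type*} [∀ x, AddCommGroup (E x)] [∀ x, Module ℂ (E x)] [∀ x, TopologicalSpace (E x)]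
  [TopologicalSpace (TotalSpace ℂ E)] [FiberBundle ℂ E] [VectorBundle ℂ ℂ E]
  {h : HermitianMetric d E} (hpos : h.IsPositive) (c : LocalCoord d E) {k : ℕ}

include hpos in
theorem isTimePoly_formalForm {u : Bool → ℕ → ℝ → TotalSpace ℂ E → ℝ}
    (hu : ∀ j, IsTimePoly c.dom (j + 2) fun b t => c.pull (u b j t)) (i j : Idx d) :
    ∀ a, IsTimePoly c.dom a fun b t x => h.formalForm c t (fun k => u b k t) a x i j
  | 0 => IsTimePoly.of_smooth (h.contDiffOn_omega0 c i j)
  | 1 => IsTimePoly.of_smooth contDiffOn_const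
  -- The term `-t Ric(ω_0)` has degree `1`, the top degree allowed in entry `2`, and is common to
  -- both families.
  | 2 => by
    refine ((IsTimePoly.time_mul (contDiffOn_ricciForm hpos c i j).neg).add
      ((hu 0).ddbar c.isOpen_dom i j)).congr fun b t ht x hx => ?_
    simp [formalForm]
  | a + 3 => by
    refine ((hu (a + 1)).ddbar c.isOpen_dom i j).congr fun b t ht x hx => ?_
    simp [formalForm]

include hpos in
theorem isTimePoly_coeff_logVolumeRatio {u : Bool → ℕ → ℝ → TotalSpace ℂ E → ℝ}
    (hu : ∀ j, j + 2 ≤ k → IsTimePoly c.dom (j + 2) fun b t => c.pull (u b j t)) :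
    IsTimePoly c.dom k fun b t x =>
      PowerSeries.coeff k (logVolumeRatio (h.formalForm c t fun j => u b j t) x) := by
  classical
  -- The grading lemma needs control of all entries, whereas `hu` covers only those that matter; the
  -- others are set to `0`.
  let u' : Bool → ℕ → ℝ → TotalSpace ℂ E → ℝ := fun b j => if j + 2 ≤ k then u b j else 0
  have hu' : ∀ j, IsTimePoly c.dom (j + 2) fun b t => c.pull (u' b j t) := by
    intro j
    by_cases hj : j + 2 ≤ k
    · simpa [u', hj] using hu j hj
    · refine (IsTimePoly.of_smooth (a := fun _ => 0) contDiffOn_const).congr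
        fun b t ht x hx => ?_
      simp [u', hj, LocalCoord.pull]
  refine IsTimePoly.congr (f := fun b t x =>
    PowerSeries.coeff k (logVolumeRatio (h.formalForm c t fun j => u' b j t) x)) ?_
    fun b t ht x hx => coeff_logRatio_congr hpos c (fun j hj p hp => by simp [u', hj]) hx
  refine isTimePoly_of_mem_timeGrading ?_
  simp only [logVolumeRatio_eq_logRatio]
  refine IsGraded.logRatio (S := timeGrading c.dom)
    (M := fun (τ : Bool × Ici (0 : ℝ) × c.dom) a =>
      h.formalForm c τ.2.1 (fun j => u' τ.1 j τ.2.1) a τ.2.2)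
    (fun a i j => (isTimePoly_formalForm hpos c hu' i j a).mem_timeGrading) ?_
    (fun τ => (det_omega0_pos hpos c τ.2.2.2).ne') k
  have h1 : IsTimePoly c.dom 0 fun _ _ x => ((h.omega0 c x).det)⁻¹ :=
    IsTimePoly.of_smooth
      ((h.contDiffOn_det_omega0 c).inv fun x hx => (det_omega0_pos hpos c hx).ne')
  exact h1.mem_timeGrading

/-- The flow equation without the weight condition, for potentials that are smooth at each time. -/
structure IsPotentialFlow (h : HermitianMetric d E) (u : ℕ → ℝ → TotalSpace ℂ E → ℝ) : Prop where
  smooth : ∀ k, ∀ t : ℝ, 0 ≤ t → IsSmooth d (u k t)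
  flow : ∀ k, ∀ t : ℝ, 0 ≤ t → ∀ (c : LocalCoord d E), ∀ x ∈ c.dom,
    HasDerivWithinAt (fun τ : ℝ => ((u k τ (c.param x) : ℝ) : ℂ))
      (PowerSeries.coeff k (logVolumeRatio (h.formalForm c t fun j => u j t) x)) (Ici 0) t

theorem IsFormalPotentialFlow.isPotentialFlow {u : ℕ → ℝ → TotalSpace ℂ E → ℝ}
    (hu : h.IsFormalPotentialFlow u) : h.IsPotentialFlow u where
  smooth k t ht c := (hu.smooth k c).comp (contDiff_prodMk_right t).contDiffOn
    fun _ hx => ⟨ht, hx⟩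
  flow := hu.flow

include hpos in
/-- Two flows that are related by a symmetry at time `0` are so at all times. -/
theorem IsPotentialFlow.symmetry {u u' : ℕ → ℝ → TotalSpace ℂ E → ℝ}
    (hu : h.IsPotentialFlow u) (hu' : h.IsPotentialFlow u') {l : ℂ} (hl : l ≠ 0) {ρ σ : ℝ}
    (hσ : 0 ≤ σ) (hρσ : ρ ^ 2 = ‖l‖ ^ 2 * σ)
    (h0 : ∀ k, ∀ p : TotalSpace ℂ E, p.2 ≠ 0 →
      ρ ^ (k + 2) * u k 0 p = ‖l‖ ^ 2 * u' k 0 (cmul l p)) :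
    ∀ k, ∀ t : ℝ, 0 ≤ t → ∀ p : TotalSpace ℂ E, p.2 ≠ 0 →
      ρ ^ (k + 2) * u k t p = ‖l‖ ^ 2 * u' k (σ * t) (cmul l p) := by
  intro k
  induction k using Nat.strong_induction_on with
  | _ k ih =>
  intro t ht p hp
  let c := LocalCoord.around d p
  have hpc := LocalCoord.mem_patch_around (d := d) hp
  have hx := c.coords_mem_dom hpc
  have hlx := c.fibreMul_mem_dom hl hx
  have hpar := c.param_coords hpc
  have hlpar : c.param (fibreMul l (c.coords p)) = cmul l p := by
    rw [c.param_fibreMul hx, hpar]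
  -- By induction the weight `k` right-hand sides differ by the factor `ρ ^ k`. The time change
  -- contributes `σ`, and the terms cancel because `ρ² = ‖l‖² σ`.
  have hd : ∀ t : ℝ, 0 ≤ t → HasDerivWithinAt (fun τ : ℝ => (ρ : ℂ) ^ (k + 2) * (u k τ p : ℂ) -
      ((‖l‖ ^ 2 : ℝ) : ℂ) * (u' k (σ * τ) (cmul l p) : ℂ)) 0 (Ici 0) t := by
    intro t ht
    have h1 := hu.flow k t ht c _ hx
    have h2 := hu'.flow k (σ * t) (by positivity) c _ hlx
    rw [hpar] at h1
    rw [hlpar, coeff_logRatio_fibreMul hpos c hl (ρ := ρ) (t := t) (u := fun j => u j t)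
      (by rw [hρσ]; ring) (fun j _ => hu.smooth j t ht)
      (fun j _ => hu'.smooth j _ (by positivity)) (fun j hj p hp => ih j (by omega) t ht p hp)
      hx] at h2
    have h3 : HasDerivWithinAt (fun τ : ℝ => σ * τ) σ (Ici 0) t := by
      simpa using (hasDerivWithinAt_id t (Ici (0 : ℝ))).const_mul σ
    have h4 := h2.scomp t h3 fun τ hτ => mul_nonneg hσ hτ
    have h5 := (h1.const_mul ((ρ : ℂ) ^ (k + 2))).sub (h4.const_mul ((‖l‖ ^ 2 : ℝ) : ℂ))
    refine h5.congr_deriv ?_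
    have h6 : (ρ : ℂ) ^ 2 = ((‖l‖ ^ 2 : ℝ) : ℂ) * σ := by exact_mod_cast hρσ
    rw [Complex.real_smul]
    linear_combination ((ρ : ℂ) ^ k * PowerSeries.coeff k
      (logVolumeRatio (h.formalForm c t fun j => u j t) (c.coords p))) * h6
  have h7 := eq_of_hasDerivWithinAt_zero hd ht
  have h8 : (ρ : ℂ) ^ (k + 2) * (u k 0 p : ℂ) - ((‖l‖ ^ 2 : ℝ) : ℂ) * (u' k (σ * 0) (cmul l p) : ℂ)
      = 0 := by
    rw [mul_zero, sub_eq_zero]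
    exact_mod_cast h0 k p hp
  rw [h8, sub_eq_zero] at h7
  exact_mod_cast h7

include hpos in
/-- The potentials of a pair of flows are polynomials in time, with leading coefficients that do
not depend on the flow. -/
theorem IsPotentialFlow.isTimePoly {u : Bool → ℕ → ℝ → TotalSpace ℂ E → ℝ}
    (hu : ∀ b, h.IsPotentialFlow (u b)) (k : ℕ) :
    IsTimePoly c.dom (k + 2) fun b t => c.pull (u b k t) := by
  induction k using Nat.strong_induction_on with
  | _ k ih =>
  exact (isTimePoly_coeff_logVolumeRatio hpos c fun j hj => ih j (by omega)).of_hasDerivWithinAt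
    (fun b t ht x hx => (hu b).flow k t ht c x hx) fun b => ((hu b).smooth k 0 le_rfl).pull c

end HermitianMetric

namespace HermitianMetric

variable {d : ℕ} {D : Type*} [TopologicalSpace D] [ChartedSpace (EuclideanSpace ℂ (Fin d)) D]
  {E : D → Type*} [∀ x, AddCommGroup (E x)] [∀ x, Module ℂ (E x)] [∀ x, TopologicalSpace (E x)]
  [TopologicalSpace (TotalSpace ℂ E)] [FiberBundle ℂ E] [VectorBundle ℂ ℂ E]
  {h : HermitianMetric d E} (hpos : h.IsPositive)

/-! ### Existence of the formal flow -/

variable (h) in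
/-- The formal solution with initial data `a`, by recursive integration. -/
def flowSol (a : ℕ → TotalSpace ℂ E → ℝ) (k : ℕ) (t : ℝ) (p : TotalSpace ℂ E) : ℝ :=
  -- The cutoff `j < k` makes the recursion well founded. It is harmless since only `j + 2 ≤ k`
  -- matters; the choice of coordinates and the real part are harmless too, by coordinate
  -- independence and reality.
  a k p + ∫ τ in (0 : ℝ)..t, (PowerSeries.coeff k (logVolumeRatio
    (h.formalForm (LocalCoord.around d p) τ fun j => if j < k then flowSol a j τ else 0)
    ((LocalCoord.around d p).coords p))).re
termination_by k

theorem flowSol_zero (a : ℕ → TotalSpace ℂ E → ℝ) (k : ℕ) (p : TotalSpace ℂ E) :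
    h.flowSol a k 0 p = a k p := by
  rw [flowSol]
  simp

variable [IsManifold 𝓘(ℂ, EuclideanSpace ℂ (Fin d)) ω D]
  [ContMDiffVectorBundle ω ℂ E 𝓘(ℂ, EuclideanSpace ℂ (Fin d))]

include hpos in
-- The induction carries polynomial dependence on time along with the equation: it makes the
-- integrand continuous, for the fundamental theorem of calculus, and makes the integral smooth in
-- space.
theorem flowSol_isPotentialFlow {a : ℕ → TotalSpace ℂ E → ℝ} (ha : ∀ k, IsSmooth d (a k)) :
    h.IsPotentialFlow (h.flowSol a) := by
  have key : ∀ k, (∀ c : LocalCoord d E,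
      IsTimePoly c.dom (k + 2) fun _ t => c.pull (h.flowSol a k t)) ∧
      ∀ t : ℝ, 0 ≤ t → ∀ (c : LocalCoord d E), ∀ x ∈ c.dom,
        HasDerivWithinAt (fun τ : ℝ => ((h.flowSol a k τ (c.param x) : ℝ) : ℂ))
          (PowerSeries.coeff k (logVolumeRatio (h.formalForm c t fun j => h.flowSol a j t) x))
          (Ici 0) t := by
    intro k
    induction k using Nat.strong_induction_on with
    | _ k ih =>
    have hsm : ∀ t : ℝ, 0 ≤ t → ∀ j, j + 2 ≤ k → IsSmooth d (h.flowSol a j t) := by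
      intro t ht j hj c
      have := ((ih j (by omega)).1 c).contDiffOn_slice true ht
      exact Complex.reCLM.contDiff.comp_contDiffOn this
    have hpoly : ∀ c : LocalCoord d E, IsTimePoly c.dom k fun _ t x =>
        PowerSeries.coeff k (logVolumeRatio (h.formalForm c t fun j => h.flowSol a j t) x) :=
      fun c => isTimePoly_coeff_logVolumeRatio hpos c (u := fun _ => h.flowSol a)
        fun j hj => (ih j (by omega)).1 c
    have hflow : ∀ t : ℝ, 0 ≤ t → ∀ (c : LocalCoord d E), ∀ x ∈ c.dom,
        HasDerivWithinAt (fun τ : ℝ => ((h.flowSol a k τ (c.param x) : ℝ) : ℂ))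
          (PowerSeries.coeff k (logVolumeRatio (h.formalForm c t fun j => h.flowSol a j t) x))
          (Ici 0) t := by
      intro t ht c x hx
      obtain ⟨P, hP, hfP⟩ := hpoly c
      beta_reduce at hfP
      -- The integrand is controlled only for nonnegative times. The polynomial `g` extends it
      -- continuously to all of `ℝ`, which gives a two-sided derivative even at `t = 0`.
      let g : ℝ → ℝ := fun τ => ((P true x).eval (τ : ℂ)).re
      have hg : Continuous g := Complex.continuous_re.comp
        ((P true x).continuous.comp Complex.continuous_ofReal)
      -- The solution is defined with coordinates chosen at each point; the transition law moves the
      -- integrand to the fixed coordinates `c`.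
      have hx' : x ∈ c.overlap (LocalCoord.around d (c.param x)) :=
        ⟨hx, LocalCoord.mem_patch_around (c.param_mem_patch hx).2.2⟩
      have heq : ∀ τ : ℝ, 0 ≤ τ → (PowerSeries.coeff k (logVolumeRatio
          (h.formalForm (LocalCoord.around d (c.param x)) τ
            fun j => if j < k then h.flowSol a j τ else 0)
          ((LocalCoord.around d (c.param x)).coords (c.param x)))).re = g τ := by
        intro τ hτ
        rw [coeff_logRatio_congr hpos _ (u' := fun j => h.flowSol a j τ)
          (fun j hj p _ => by rw [if_pos (by omega)])
          ((LocalCoord.around d (c.param x)).coords_mem_dom hx'.2)]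
        have h1 := coeff_logRatio_transition hpos c (t := τ) (LocalCoord.around d (c.param x))
          (hsm τ hτ) hx'
        rw [LocalCoord.transition] at h1
        rw [h1, hfP true τ hτ x hx]
      have hsol : ∀ τ : ℝ, 0 ≤ τ →
          h.flowSol a k τ (c.param x) = a k (c.param x) + ∫ s in (0 : ℝ)..τ, g s := by
        intro τ hτ
        rw [flowSol]
        congr 1
        refine intervalIntegral.integral_congr fun s hs => ?_
        rw [uIcc_of_le hτ] at hs
        exact heq s hs.1
      have h1 : HasDerivAt (fun τ => a k (c.param x) + ∫ s in (0 : ℝ)..τ, g s) (g t) t :=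
        (hg.integral_hasStrictDerivAt 0 t).hasDerivAt.const_add _
      have h2 : HasDerivWithinAt (fun τ => h.flowSol a k τ (c.param x)) (g t) (Ici 0) t :=
        h1.hasDerivWithinAt.congr (fun τ hτ => hsol τ hτ) (hsol t ht)
      have h3 := coeff_logRatio_real hpos c (t := t) (hsm t ht) hx
      rw [hfP true t ht x hx] at h3
      rw [hfP true t ht x hx, ← h3]
      have h4 := Complex.ofRealCLM.hasFDerivAt.comp_hasDerivWithinAt t h2
      exact h4
    refine ⟨fun c => (hpoly c).of_hasDerivWithinAt (fun _ t ht x hx => hflow t ht c x hx)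
      fun _ => ?_, hflow⟩
    have : h.flowSol a k 0 = a k := funext fun p => flowSol_zero a k p
    rw [this]
    exact (ha k).pull c
  refine ⟨fun k t ht c => ?_, fun k => (key k).2⟩
  exact Complex.reCLM.contDiff.comp_contDiffOn (((key k).1 c).contDiffOn_slice true ht)

omit [IsManifold 𝓘(ℂ, EuclideanSpace ℂ (Fin d)) ω D]
  [ContMDiffVectorBundle ω ℂ E 𝓘(ℂ, EuclideanSpace ℂ (Fin d))] in
include hpos in
theorem IsPotentialFlow.isFormalPotentialFlow {u : ℕ → ℝ → TotalSpace ℂ E → ℝ}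
    (hu : h.IsPotentialFlow u) (hw : ∀ k, HasWeight k (u k 0)) : h.IsFormalPotentialFlow u where
  smooth k c := by
    have := (IsPotentialFlow.isTimePoly hpos c (u := fun _ => u) (fun _ => hu) k).contDiffOn true
    exact Complex.reCLM.contDiff.comp_contDiffOn this
  weight k t ht := hasWeight_of_dilate_eq fun r hr p hp => by
    -- With `ρ = l = r` and `σ = 1`, the symmetry compares the flow with its own dilation at the
    -- same time.
    have := hu.symmetry hpos hu (l := (r : ℂ)) (by exact_mod_cast hr.ne') (ρ := r) (σ := 1)
      zero_le_one (by simp) (fun k p hp => by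
        have h1 := (hw k).dilate_eq (hu.smooth k 0 le_rfl) hr hp
        rw [dilate_eq_cmul] at h1
        rw [h1]
        simp
        ring) k t ht p hp
    rw [dilate_eq_cmul]
    simp only [Complex.norm_real, Real.norm_eq_abs, sq_abs, one_mul] at this
    have h2 : r ^ 2 ≠ 0 := by positivity
    rw [pow_add] at this
    apply mul_left_cancel₀ h2
    linear_combination -this
  flow := hu.flow

omit [IsManifold 𝓘(ℂ, EuclideanSpace ℂ (Fin d)) ω D]
  [ContMDiffVectorBundle ω ℂ E 𝓘(ℂ, EuclideanSpace ℂ (Fin d))] in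
include hpos in
/-- Uniqueness of the formal flow. -/
theorem IsPotentialFlow.unique {u u' : ℕ → ℝ → TotalSpace ℂ E → ℝ}
    (hu : h.IsPotentialFlow u) (hu' : h.IsPotentialFlow u')
    (h0 : ∀ k, ∀ p : TotalSpace ℂ E, p.2 ≠ 0 → u k 0 p = u' k 0 p) (k : ℕ) {t : ℝ} (ht : 0 ≤ t)
    {p : TotalSpace ℂ E} (hp : p.2 ≠ 0) : u k t p = u' k t p := by
  have := hu.symmetry hpos hu' (l := 1) one_ne_zero (ρ := 1) (σ := 1) zero_le_one (by simp)
    (fun k p hp => by simp [cmul_one, h0 k p hp]) k t ht p hp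
  simpa [cmul_one] using this

/-! ### The self-similar flow -/

variable (h) in
/-- The formal solution with vanishing initial data. -/
def selfSimilarFlow : ℕ → ℝ → TotalSpace ℂ E → ℝ := h.flowSol fun _ _ => 0

include hpos in
theorem selfSimilarFlow_isPotentialFlow : h.IsPotentialFlow h.selfSimilarFlow :=
  flowSol_isPotentialFlow hpos fun _ _ => contDiffOn_const

omit [IsManifold 𝓘(ℂ, EuclideanSpace ℂ (Fin d)) ω D]
  [ContMDiffVectorBundle ω ℂ E 𝓘(ℂ, EuclideanSpace ℂ (Fin d))] in
theorem selfSimilarFlow_zero (k : ℕ) (p : TotalSpace ℂ E) : h.selfSimilarFlow k 0 p = 0 :=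
  flowSol_zero _ k p

include hpos in
theorem selfSimilarFlow_isFormalPotentialFlow : h.IsFormalPotentialFlow h.selfSimilarFlow :=
  (selfSimilarFlow_isPotentialFlow hpos).isFormalPotentialFlow hpos fun k p _ => by
    simp [selfSimilarFlow_zero]

include hpos in
-- Zero initial data satisfy every symmetry, here with `ρ = 1` and `σ = ‖l‖⁻²`. Real `l` gives
-- parabolic self-similarity, and `‖l‖ = 1` gives invariance under rotations.
theorem selfSimilarFlow_cmul {l : ℂ} (hl : l ≠ 0) {t : ℝ} (ht : 0 ≤ t) (k : ℕ)
    {p : TotalSpace ℂ E} (hp : p.2 ≠ 0) :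
    h.selfSimilarFlow k t p = ‖l‖ ^ 2 * h.selfSimilarFlow k ((‖l‖ ^ 2)⁻¹ * t) (cmul l p) := by
  have hflow := selfSimilarFlow_isPotentialFlow hpos
  have hl' := norm_ne_zero_iff.2 hl
  simpa using hflow.symmetry hpos hflow hl (ρ := 1) (σ := (‖l‖ ^ 2)⁻¹) (by positivity)
    (by field_simp) (fun k p _ => by simp [selfSimilarFlow_zero]) k t ht p hp

include hpos in
theorem selfSimilarFlow_eq (k : ℕ) {t : ℝ} (ht : 0 < t) {p : TotalSpace ℂ E} (hp : p.2 ≠ 0) :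
    h.selfSimilarFlow k t p = t * h.selfSimilarFlow k 1 (dilate (Real.sqrt t) p) := by
  rw [selfSimilarFlow_cmul hpos (l := (Real.sqrt t : ℂ))
    (by exact_mod_cast (Real.sqrt_pos.2 ht).ne') ht.le k hp, Complex.norm_real,
    Real.norm_of_nonneg (Real.sqrt_nonneg t), Real.sq_sqrt ht.le, inv_mul_cancel₀ ht.ne']
  rfl

include hpos in
theorem selfSimilarFlow_dilate (k : ℕ) {t : ℝ} (ht : 0 ≤ t) {r : ℝ} (hr : 0 < r)
    {p : TotalSpace ℂ E} (hp : p.2 ≠ 0) :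
    h.selfSimilarFlow k t (dilate r p) = r ^ k * h.selfSimilarFlow k t p :=
  ((selfSimilarFlow_isFormalPotentialFlow hpos).weight k t ht).dilate_eq
    ((selfSimilarFlow_isPotentialFlow hpos).smooth k t ht) hr hp

include hpos in
theorem selfSimilarFlow_rotate (k : ℕ) {t : ℝ} (ht : 0 ≤ t) {l : ℂ} (hl : ‖l‖ = 1)
    {p : TotalSpace ℂ E} (hp : p.2 ≠ 0) :
    h.selfSimilarFlow k t (cmul l p) = h.selfSimilarFlow k t p := by
  rw [selfSimilarFlow_cmul hpos (norm_ne_zero_iff.1 (by rw [hl]; exact one_ne_zero)) ht k hp, hl]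
  simp

include hpos in
theorem formalForm_selfSimilarFlow (c : LocalCoord d E) {x : Coord d} (hx : x ∈ c.dom) {t : ℝ}
    (ht : 0 < t) (a : ℕ) :
    h.formalForm c t (fun k => h.selfSimilarFlow k t) a x =
      (t : ℂ) • dilatePullback (Real.sqrt t)
        (h.formalForm c 1 (fun k => h.selfSimilarFlow k 1) a) x := by
  have hs := (Real.sqrt_pos.2 ht).ne'
  have hn : ‖(Real.sqrt t : ℂ)‖ ^ 2 = t := by
    rw [Complex.norm_real, Real.norm_of_nonneg (Real.sqrt_nonneg t), Real.sq_sqrt ht.le]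
  have hflow := selfSimilarFlow_isPotentialFlow hpos
  have := formalForm_fibreMul hpos c (l := (Real.sqrt t : ℂ)) (by exact_mod_cast hs)
    (ρ := 1) (t := t) (t' := 1) (u := fun k => h.selfSimilarFlow k t)
    (u' := fun k => h.selfSimilarFlow k 1) (k := a) (by rw [hn]; ring)
    (fun j _ => hflow.smooth j t ht.le) (fun j _ => hflow.smooth j 1 zero_le_one)
    (fun j _ p hp => by rw [hn, selfSimilarFlow_eq hpos j ht hp, one_pow, one_mul]; rfl) hx a le_rfl
  rw [Complex.ofReal_one, one_pow, one_smul, hn] at this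
  rw [this, dilatePullback_eq_jacPull]

include hpos in
theorem selfSimilarFlow_order_zero {t : ℝ} (ht : 0 ≤ t) {p : TotalSpace ℂ E} (hp : p.2 ≠ 0) :
    h.selfSimilarFlow 0 t p = 0 := by
  let c := LocalCoord.around d p
  have hpc := LocalCoord.mem_patch_around (d := d) hp
  have hx := c.coords_mem_dom hpc
  have h1 := eq_of_hasDerivWithinAt_zero (f := fun τ => (h.selfSimilarFlow 0 τ p : ℂ))
    (fun s hs => by
      have h2 := (selfSimilarFlow_isPotentialFlow hpos).flow 0 s hs c _ hx
      rw [c.param_coords hpc, logVolumeRatio_eq_logRatio,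
        coeff_zero_logRatio (det_omega0_pos hpos c hx).ne'] at h2
      exact h2) ht
  rw [selfSimilarFlow_zero] at h1
  exact_mod_cast h1

include hpos in
-- Self-similarity and homogeneity give the time dependence `t · (√t)^k`, whose derivative at `1` is
-- `(k + 2)/2`; the flow equation identifies this derivative with the logarithm.
theorem coeff_logVolumeRatio_selfSimilarFlow (c : LocalCoord d E) {x : Coord d} (hx : x ∈ c.dom)
    (k : ℕ) :
    PowerSeries.coeff k (logVolumeRatio
      (h.formalForm c 1 fun j => h.selfSimilarFlow j 1) x) =
      ((k : ℂ) + 2) / 2 * c.pull (h.selfSimilarFlow k 1) x := by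
  have hp := (c.param_mem_patch hx).2.2
  have h1 := ((selfSimilarFlow_isPotentialFlow hpos).flow k 1 zero_le_one c x hx).hasDerivAt
    (Ici_mem_nhds one_pos)
  have h2 : HasDerivAt (fun τ : ℝ => τ * (Real.sqrt τ) ^ k) (((k : ℝ) + 2) / 2) 1 := by
    have h3 := (hasDerivAt_id (1 : ℝ)).mul ((Real.hasDerivAt_sqrt one_ne_zero).pow k)
    refine h3.congr_deriv ?_
    simp
    ring
  have h4 : HasDerivAt (fun τ : ℝ => ((τ * (Real.sqrt τ) ^ k *
      h.selfSimilarFlow k 1 (c.param x) : ℝ) : ℂ))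
      ((((k : ℝ) + 2) / 2 * h.selfSimilarFlow k 1 (c.param x) : ℝ) : ℂ) 1 :=
    (h2.mul_const _).ofReal_comp
  have h5 : (fun τ : ℝ => ((h.selfSimilarFlow k τ (c.param x) : ℝ) : ℂ)) =ᶠ[𝓝 1]
      fun τ : ℝ => ((τ * (Real.sqrt τ) ^ k * h.selfSimilarFlow k 1 (c.param x) : ℝ) : ℂ) := by
    filter_upwards [Ioi_mem_nhds (zero_lt_one' ℝ)] with τ hτ
    rw [selfSimilarFlow_eq hpos k hτ hp,
      selfSimilarFlow_dilate hpos k zero_le_one (Real.sqrt_pos.2 hτ) hp, mul_assoc]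
  rw [h1.unique (h4.congr_of_eventuallyEq h5), LocalCoord.pull]
  push_cast
  ring

/-! ### The soliton equation -/

omit [IsManifold 𝓘(ℂ, EuclideanSpace ℂ (Fin d)) ω D]
  [ContMDiffVectorBundle ω ℂ E 𝓘(ℂ, EuclideanSpace ℂ (Fin d))]

include hpos in
-- Pulling back by the flow of `V` multiplies entry `a` by `e^{(a - 2)s}`; then differentiate at `s
-- = 0`.
theorem lieForm_formalForm {v : ℕ → TotalSpace ℂ E → ℝ} (hv : ∀ k, IsSmooth d (v k))
    (hw : ∀ k, HasWeight k (v k)) (c : LocalCoord d E) {x : Coord d} (hx : x ∈ c.dom) (a : ℕ) :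
    lieForm (h.formalForm c 1 v a) x = ((a : ℂ) - 2) • h.formalForm c 1 v a x := by
  have key : ∀ s : ℝ, dilatePullback (Real.exp s) (h.formalForm c 1 v a) x =
      (Real.exp ((a - 2) * s) : ℂ) • h.formalForm c 1 v a x := by
    intro s
    have hs := Real.exp_pos s
    have hn : ‖(Real.exp s : ℂ)‖ = Real.exp s := by
      rw [Complex.norm_real, Real.norm_of_nonneg hs.le]
    have h1 := formalForm_fibreMul hpos c (l := (Real.exp s : ℂ)) (by exact_mod_cast hs.ne')
      (ρ := Real.exp s) (t := 1) (t' := 1) (u := v) (u' := v) (k := a) (by rw [hn])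
      (fun j _ => hv j) (fun j _ => hv j) (fun j _ p hp => by
        have := (hw j).dilate_eq (hv j) hs hp
        rw [dilate_eq_cmul] at this
        rw [this, hn]
        ring) hx a le_rfl
    rw [hn] at h1
    have h2 : (Real.exp ((a - 2) * s) : ℂ) =
        (((Real.exp s) ^ 2 : ℝ) : ℂ)⁻¹ * (Real.exp s : ℂ) ^ a := by
      rw [sub_mul, Real.exp_sub, Real.exp_nat_mul, two_mul, Real.exp_add]
      push_cast
      field_simp
    rw [dilatePullback_eq_jacPull, h2, mul_smul, h1, inv_smul_smul₀]
    exact_mod_cast (pow_pos hs 2).ne'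
  ext i j
  rw [lieForm, Matrix.of_apply]
  simp only [key, Matrix.smul_apply, smul_eq_mul]
  have h3 : HasDerivAt (fun s : ℝ => Real.exp (((a : ℝ) - 2) * s)) ((a : ℝ) - 2) 0 := by
    simpa using ((hasDerivAt_id (0 : ℝ)).const_mul ((a : ℝ) - 2)).exp
  have h4 := (h3.ofReal_comp.mul_const (h.formalForm c 1 v a x i j)).deriv
  rw [h4]
  push_cast
  ring

include hpos in
-- With `½ L_V` acting as `(a - 2)/2`, the right-hand factor becomes `-1 - (a - 2)/2 = -a/2`. This
-- turns the soliton equation into a recursion.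
theorem soliton_iff {v : ℕ → TotalSpace ℂ E → ℝ} (hv : ∀ k, IsSmooth d (v k))
    (hw : ∀ k, HasWeight k (v k)) (c : LocalCoord d E) {x : Coord d} (hx : x ∈ c.dom) (a : ℕ) :
    formalRicci (h.formalForm c 1 v) a x + (1 / 2 : ℂ) • lieForm (h.formalForm c 1 v a) x
      = - h.formalForm c 1 v a x ↔
    formalRicci (h.formalForm c 1 v) a x = -((a : ℂ) / 2) • h.formalForm c 1 v a x := by
  rw [lieForm_formalForm hpos hv hw c hx, smul_smul, ← eq_sub_iff_add_eq]
  have : -h.formalForm c 1 v a x - (1 / 2 * ((a : ℂ) - 2)) • h.formalForm c 1 v a x =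
      -((a : ℂ) / 2) • h.formalForm c 1 v a x := by
    rw [← neg_one_smul ℂ (h.formalForm c 1 v a x), ← sub_smul]
    congr 1
    ring
  rw [this]

include hpos in
/-- The formal soliton form is unique. -/
theorem formalForm_unique {v v' : ℕ → TotalSpace ℂ E → ℝ} (hv : h.IsFormalExpandingSoliton v)
    (hv' : h.IsFormalExpandingSoliton v') (c : LocalCoord d E) (a : ℕ) :
    ∀ x ∈ c.dom, h.formalForm c 1 v a x = h.formalForm c 1 v' a x := by
  induction a using Nat.strong_induction_on with
  | _ a ih =>
  intro x hx
  match a with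
  | 0 => rfl
  | 1 => rfl
  | k + 2 =>
    have h1 := (soliton_iff hpos hv.smooth hv.weight c hx (k + 2)).1 (hv.soliton c x hx _)
    have h2 := (soliton_iff hpos hv'.smooth hv'.weight c hx (k + 2)).1 (hv'.soliton c x hx _)
    -- The logarithmic part of the Ricci form in entry `k + 2` sees only entries up to `k`, where
    -- the two forms agree by induction.
    have h3 : EqOn (fun y => PowerSeries.coeff k (logVolumeRatio (h.formalForm c 1 v) y))
        (fun y => PowerSeries.coeff k (logVolumeRatio (h.formalForm c 1 v') y)) c.dom := by
      intro y hy
      simp only [logVolumeRatio_eq_logRatio]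
      exact logRatio_congr_coeff (M := fun a => h.formalForm c 1 v a y)
        (N := fun a => h.formalForm c 1 v' a y) (det_omega0_pos hpos c hy).ne'
        fun b hb => ih b (by omega) y hy
    have h5 : h.formalForm c 1 v 0 = h.formalForm c 1 v' 0 := rfl
    simp only [formalRicci] at h1 h2
    rw [h5, ddbar_congr_of_eqOn c.isOpen_dom h3 hx, h2] at h1
    -- Since `-(k + 2)/2` is nonzero, the Ricci entry determines the form.
    have h4 : -(((k + 2 : ℕ) : ℂ) / 2) ≠ 0 :=
      neg_ne_zero.2 (div_ne_zero (by exact_mod_cast Nat.succ_ne_zero (k + 1)) two_ne_zero)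
    rw [← inv_smul_smul₀ h4 (h.formalForm c 1 v (k + 2) x), ← h1, inv_smul_smul₀ h4]

variable [IsManifold 𝓘(ℂ, EuclideanSpace ℂ (Fin d)) ω D]
  [ContMDiffVectorBundle ω ℂ E 𝓘(ℂ, EuclideanSpace ℂ (Fin d))]

include hpos in
-- Apply `√-1 ∂∂̄` to the identity for the logarithm at time `1`. In entry `2` the factor is `-1`,
-- which matches `Ric(ω_0)` with the term `-Ric(ω_0)` of the form.
theorem selfSimilarFlow_isFormalExpandingSoliton :
    h.IsFormalExpandingSoliton fun k => h.selfSimilarFlow k 1 := by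
  have hs : ∀ k, IsSmooth d (h.selfSimilarFlow k 1) := fun k =>
    (selfSimilarFlow_isPotentialFlow hpos).smooth k 1 zero_le_one
  have hw : ∀ k, HasWeight k (h.selfSimilarFlow k 1) := fun k =>
    (selfSimilarFlow_isFormalPotentialFlow hpos).weight k 1 zero_le_one
  refine ⟨fun p hp => selfSimilarFlow_order_zero hpos zero_le_one hp, hs, hw,
    fun c x hx a => (soliton_iff hpos hs hw c hx a).2 ?_⟩
  match a with
  | 0 => simp [formalRicci]
  | 1 => simp [formalRicci, formalForm]
  | k + 2 =>
    have h1 : ddbar (dir d) (fun y => PowerSeries.coeff k (logVolumeRatio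
        (h.formalForm c 1 fun j => h.selfSimilarFlow j 1) y)) x =
        (((k : ℂ) + 2) / 2) • ddbar (dir d) (c.pull (h.selfSimilarFlow k 1)) x := by
      rw [← ddbar_const_mul c.isOpen_dom _ ((hs k).pull c) hx]
      exact ddbar_congr_of_eqOn c.isOpen_dom
        (fun y hy => coeff_logVolumeRatio_selfSimilarFlow hpos c hy k) hx
    simp only [formalRicci, h1, formalForm]
    rw [smul_add]
    split_ifs with hk
    · subst hk
      simp
      abel
    · push_cast
      simp

/-! ### The gradient property -/

theorem exp_zpow (s : ℝ) (m : ℤ) : Real.exp s ^ m = Real.exp (m * s) := by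
  rw [mul_comm, Real.exp_mul, Real.rpow_intCast]

/-- Homogeneity and rotation invariance give `z ∂_z f = (m/2) f`, and `z` is holomorphic, so `∂̄`
may be applied to this identity. Integer weights are needed to include `|S|^{-2}`. -/
theorem snd_mul_ddbar_pull {f : TotalSpace ℂ E → ℝ} (hf : IsSmooth d f) {m : ℤ}
    (hdil : ∀ r : ℝ, 0 < r → ∀ p : TotalSpace ℂ E, p.2 ≠ 0 → f (dilate r p) = r ^ m * f p)
    (hrot : ∀ l : ℂ, ‖l‖ = 1 → ∀ p : TotalSpace ℂ E, p.2 ≠ 0 → f (cmul l p) = f p)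
    (c : LocalCoord d E) {x : Coord d} (hx : x ∈ c.dom) (j : Idx d) :
    x.2 * ddbar (dir d) (c.pull f) x (Sum.inr ()) j =
      (m : ℂ) / 2 * dbarWirt (c.pull f) (dir d j) x := by
  refine snd_mul_ddbar_of_euler c.isOpen_dom (hf.pull c) (c := 0) (fun y hy => ?_) hx j
  have hp := (c.param_mem_patch hy).2.2
  rw [snd_mul_dWirt_of_invariant (A := m * c.pull f y)
    (differentiableAt_of_contDiffOn (hf.pull c) c.isOpen_dom hy)]
  · ring
  · have h1 : (fun s : ℝ => c.pull f (fibreMul (Real.exp s : ℂ) y)) =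
        fun s : ℝ => ((Real.exp (m * s) : ℝ) : ℂ) * c.pull f y := by
      ext s
      have h2 := hdil _ (Real.exp_pos s) _ hp
      rw [dilate_eq_cmul, exp_zpow] at h2
      rw [LocalCoord.pull, c.param_fibreMul hy, h2, LocalCoord.pull]
      push_cast
      rfl
    rw [h1]
    have h3 : HasDerivAt (fun s : ℝ => Real.exp ((m : ℝ) * s)) (m : ℝ) 0 := by
      simpa using ((hasDerivAt_id (0 : ℝ)).const_mul (m : ℝ)).exp
    exact_mod_cast h3.ofReal_comp.mul_const (c.pull f y)
  · intro s
    rw [LocalCoord.pull, c.param_fibreMul hy, hrot _ (Complex.norm_exp_ofReal_mul_I s) _ hp]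
    rfl

include hpos in
-- Each part of `F` is half its weight times the corresponding potential: `-|S|^{-2}` from
-- `|S|^{-2}`, and `(k/2) v_(k)` from `v_(k)`. The Ricci term contributes nothing, since it has no
-- `z` components.
theorem selfSimilarFlow_isGradient : h.IsGradient fun k => h.selfSimilarFlow k 1 := by
  have hs : ∀ k, IsSmooth d (h.selfSimilarFlow k 1) := fun k =>
    (selfSimilarFlow_isPotentialFlow hpos).smooth k 1 zero_le_one
  have hinv : ∀ r : ℝ, 0 < r → ∀ p : TotalSpace ℂ E, p.2 ≠ 0 →
      (h.normSq (dilate r p))⁻¹ = r ^ (-2 : ℤ) * (h.normSq p)⁻¹ := by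
    intro r hr p _
    rw [dilate_eq_cmul, h.normSq_cmul, mul_inv, Complex.norm_real, Real.norm_of_nonneg hr.le]
    rfl
  refine ⟨fun a => match a with
    | 0 => fun p => -(h.normSq p)⁻¹
    | 1 => fun _ => 0
    | k + 2 => fun p => (k : ℝ) / 2 * h.selfSimilarFlow k 1 p, ?_, ?_, ?_⟩
  · intro a c
    match a with
    | 0 => exact (h.isSmooth_inv_normSq c).neg
    | 1 => exact contDiffOn_const
    | k + 2 => exact contDiffOn_const.mul (hs k c)
  · intro a p hp
    match a with
    | 0 =>
      have h1 : (fun s : ℝ => -(h.normSq (dilate (Real.exp s) p))⁻¹) =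
          fun s : ℝ => Real.exp (-2 * s) * -(h.normSq p)⁻¹ := by
        ext s
        rw [hinv _ (Real.exp_pos s) p hp, exp_zpow]
        push_cast
        ring
      have h2 := (((hasDerivAt_id (0 : ℝ)).const_mul (-2)).exp.mul_const (-(h.normSq p)⁻¹)).deriv
      simp only [h1]
      simp only [id] at h2
      rw [h2]
      simp
    | 1 => simp
    | k + 2 =>
      have h1 : (fun s : ℝ => (k : ℝ) / 2 * h.selfSimilarFlow k 1 (dilate (Real.exp s) p)) =
          fun s : ℝ => Real.exp s ^ k * ((k : ℝ) / 2 * h.selfSimilarFlow k 1 p) := by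
        ext s
        rw [selfSimilarFlow_dilate hpos k zero_le_one (Real.exp_pos s) hp]
        ring
      have h2 := (((Real.hasDerivAt_exp 0).pow k).mul_const
        ((k : ℝ) / 2 * h.selfSimilarFlow k 1 p)).deriv
      simp only [Pi.pow_apply] at h2
      simp only [h1]
      rw [h2]
      simp
  · intro c x hx a j
    match a with
    | 0 =>
      have h1 := snd_mul_ddbar_pull h.isSmooth_inv_normSq hinv (fun l hl p _ => by
        rw [h.normSq_cmul, hl, one_pow, one_mul]) c hx j
      have h2 : c.pull (fun p => -(h.normSq p)⁻¹) =
          fun y => (-1 : ℂ) * c.pull (fun p => (h.normSq p)⁻¹) y := by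
        ext y
        simp [LocalCoord.pull]
      simp only [h2]
      rw [dbarWirt_const_mul _ (differentiableAt_of_contDiffOn (h.isSmooth_inv_normSq.pull c)
        c.isOpen_dom hx)]
      refine h1.trans ?_
      push_cast
      ring
    | 1 =>
      have h2 : c.pull (fun _ : TotalSpace ℂ E => (0 : ℝ)) = fun _ => 0 := by
        ext y
        simp [LocalCoord.pull]
      simp only [h2]
      simp [formalForm]
    | k + 2 =>
      have h1 := snd_mul_ddbar_pull (hs k) (m := k) (fun r hr p hp => by
          rw [zpow_natCast]
          exact selfSimilarFlow_dilate hpos k zero_le_one hr hp)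
        (fun l hl p hp => selfSimilarFlow_rotate hpos k zero_le_one hl hp) c hx j
      have h2 : c.pull (fun p => (k : ℝ) / 2 * h.selfSimilarFlow k 1 p) =
          fun y => ((k : ℂ) / 2) * c.pull (h.selfSimilarFlow k 1) y := by
        ext y
        simp [LocalCoord.pull]
      simp only [h2]
      rw [dbarWirt_const_mul _ (differentiableAt_of_contDiffOn ((hs k).pull c)
        c.isOpen_dom hx)]
      simp only [formalForm, Matrix.add_apply]
      rw [mul_add, h1]
      split_ifs
      · simp [ricciForm_inr hpos c hx j]
      · simp

end HermitianMetric

/-! ### Blowdown limits -/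

section Blowdown

/-- The error is a finite combination of fixed smooth functions, and differentiation does not touch
the scalars `a i s`. Local boundedness of the fixed derivatives suffices. -/
theorem tendstoLocallyUniformlyOn_iteratedFDerivWithin {V : Type*} [NormedAddCommGroup V]
    [NormedSpace ℝ V] {S : Set V} (hS : UniqueDiffOn ℝ S) {g : V → ℝ} (hg : ContDiffOn ℝ ∞ g S)
    {I : Finset ℕ} {e : ℕ → V → ℝ} (he : ∀ i, ContDiffOn ℝ ∞ (e i) S) {a : ℕ → ℝ → ℝ}
    (ha : ∀ i, Tendsto (a i) atTop (𝓝 0)) {F : ℝ → V → ℝ}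
    (hF : ∀ s, 0 < s → EqOn (F s) (fun q => g q + ∑ i ∈ I, a i s • e i q) S) (m : ℕ) :
    TendstoLocallyUniformlyOn (fun s => iteratedFDerivWithin ℝ m (F s) S)
      (iteratedFDerivWithin ℝ m g S) atTop S := by
  have hder : ∀ s, 0 < s → ∀ q ∈ S, iteratedFDerivWithin ℝ m (F s) S q =
      iteratedFDerivWithin ℝ m g S q + ∑ i ∈ I, a i s • iteratedFDerivWithin ℝ m (e i) S q := by
    intro s hs q hq
    have hm : (m : WithTop ℕ∞) ≤ ∞ := by exact_mod_cast le_top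
    have hgq : ContDiffWithinAt ℝ m g S q := (hg q hq).of_le hm
    have heq : ∀ i, ContDiffWithinAt ℝ m (e i) S q := fun i => (he i q hq).of_le hm
    have haq : ∀ i, ContDiffWithinAt ℝ m (fun q => a i s • e i q) S q := fun i => by
      have h1 : ContDiffWithinAt ℝ m (a i s • e i) S q := contDiffWithinAt_const.smul (heq i)
      exact h1
    rw [iteratedFDerivWithin_congr (hF s hs) hq,
      fun_iteratedFDerivWithin_add_apply hgq (ContDiffWithinAt.sum fun i _ => haq i) hS hq,
      iteratedFDerivWithin_fun_sum_apply hS hq fun i _ => haq i]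
    congr 1
    refine Finset.sum_congr rfl fun i _ => ?_
    exact iteratedFDerivWithin_const_smul_apply (a := a i s) (heq i) hS hq
  rw [Metric.tendstoLocallyUniformlyOn_iff]
  intro ε hε q hq
  have hcont : ∀ i, ContinuousOn (iteratedFDerivWithin ℝ m (e i) S) S := fun i =>
    (he i).continuousOn_iteratedFDerivWithin (by exact_mod_cast le_top) hS
  -- By continuity each derivative is bounded near `q` by its norm at `q` plus `1`, so no local
  -- compactness is needed.
  refine ⟨S ∩ ⋂ i ∈ I, {y | ‖iteratedFDerivWithin ℝ m (e i) S y‖ <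
    ‖iteratedFDerivWithin ℝ m (e i) S q‖ + 1}, ?_, ?_⟩
  · refine inter_mem self_mem_nhdsWithin ((biInter_finset_mem I).2 fun i _ => ?_)
    exact ((hcont i q hq).norm).eventually_lt_const (lt_add_one _)
  · have hlim : Tendsto (fun s => ∑ i ∈ I,
        ‖a i s‖ * (‖iteratedFDerivWithin ℝ m (e i) S q‖ + 1)) atTop (𝓝 0) := by
      rw [← Finset.sum_const_zero (s := I)]
      refine tendsto_finsetSum _ fun i _ => ?_
      simpa using (ha i).norm.mul_const (‖iteratedFDerivWithin ℝ m (e i) S q‖ + 1)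
    filter_upwards [hlim.eventually_lt_const hε, eventually_gt_atTop 0] with s hs hs0 y hy
    rw [hder s hs0 y hy.1, dist_eq_norm, sub_add_cancel_left, norm_neg]
    refine lt_of_le_of_lt (norm_sum_le _ _) (lt_of_le_of_lt ?_ hs)
    refine Finset.sum_le_sum fun i hi => ?_
    rw [norm_smul]
    exact mul_le_mul_of_nonneg_left (mem_iInter₂.1 hy.2 i hi).le (norm_nonneg _)

end Blowdown

/-! ### Pluriharmonic functions of positive weight -/

section SecondDerivative

/-- A negative second derivative would make the point a local maximum as well, so `g` would be
locally constant. -/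
theorem deriv_deriv_nonneg_of_isLocalMin {g : ℝ → ℝ} {x : ℝ} (hg : IsLocalMin g x)
    (hc : ContinuousAt g x) : 0 ≤ deriv (deriv g) x := by
  by_contra! hneg
  have hmax := isLocalMax_of_deriv_deriv_neg hneg hg.deriv_eq_zero hc
  have hconst : g =ᶠ[𝓝 x] fun _ => g x := by
    filter_upwards [hg, hmax] with y hy1 hy2 using le_antisymm hy2 hy1
  rw [hconst.deriv.deriv_eq] at hneg
  simp at hneg

variable {V : Type*} [NormedAddCommGroup V] [NormedSpace ℝ V] {f : V → ℂ} {U : Set V} {x : V}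

theorem re_fderiv_fderiv_nonneg (hU : IsOpen U) (hf : ContDiffOn ℝ ∞ f U) (hx : x ∈ U)
    (hmin : ∀ y ∈ U, (f x).re ≤ (f y).re) (v : V) :
    0 ≤ (fderiv ℝ (fun y => fderiv ℝ f y v) x v).re := by
  let L : ℝ → V := fun s => x + s • v
  have hL : ∀ s, HasDerivAt L v s := fun s => by
    have h1 := ((hasDerivAt_id s).smul_const v).const_add x
    rw [one_smul] at h1
    exact h1
  have hL0 : L 0 = x := by simp [L]
  have hLU : ∀ᶠ s in 𝓝 0, L s ∈ U :=
    (hL 0).continuousAt.eventually_mem (by rw [hL0]; exact hU.mem_nhds hx)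
  have hd1 : ∀ s, L s ∈ U → HasDerivAt (fun s => (f (L s)).re) (fderiv ℝ f (L s) v).re s :=
    fun s hs => Complex.reCLM.hasFDerivAt.comp_hasDerivAt s
      ((differentiableAt_of_contDiffOn hf hU hs).hasFDerivAt.comp_hasDerivAt s (hL s))
  have hd2 : HasDerivAt (fun s => (fderiv ℝ f (L s) v).re)
      (fderiv ℝ (fun y => fderiv ℝ f y v) x v).re 0 := by
    have h1 : HasFDerivAt (fun y => fderiv ℝ f y v) (fderiv ℝ (fun y => fderiv ℝ f y v) x)
        (L 0) := by
      rw [hL0]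
      exact (differentiableAt_of_contDiffOn
        (contDiffOn_fderiv_apply_of_isOpen hf hU v) hU hx).hasFDerivAt
    exact Complex.reCLM.hasFDerivAt.comp_hasDerivAt 0 (h1.comp_hasDerivAt 0 (hL 0))
  have hderiv : deriv (fun s => (f (L s)).re) =ᶠ[𝓝 0] fun s => (fderiv ℝ f (L s) v).re := by
    filter_upwards [hLU] with s hs using (hd1 s hs).deriv
  have hloc : IsLocalMin (fun s => (f (L s)).re) 0 := by
    filter_upwards [hLU] with s hs
    rw [hL0]
    exact hmin _ hs
  have h2 := deriv_deriv_nonneg_of_isLocalMin hloc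
    (hd1 0 (by rw [hL0]; exact hx)).continuousAt
  rwa [hderiv.deriv_eq, hd2.deriv] at h2

variable [NormedSpace ℂ V]

/-- The mixed terms cancel by symmetry of second derivatives, leaving a quarter of the Laplacian on
the real plane spanned by `v` and `I • v`. -/
theorem dWirt_dbarWirt_self (hU : IsOpen U) (hf : ContDiffOn ℝ ∞ f U) (hx : x ∈ U) (v : V) :
    dWirt (fun y => dbarWirt f v y) v x = (1 / 4 : ℂ) *
      (fderiv ℝ (fun y => fderiv ℝ f y v) x v +
        fderiv ℝ (fun y => fderiv ℝ f y (Complex.I • v)) x (Complex.I • v)) := by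
  simp only [dWirt, dbarWirt]
  simp only [dWirt_fderiv_combination hU hf hx]
  rw [fderiv_fderiv_comm hU hf hx v (Complex.I • v)]
  linear_combination (-1 / 4 : ℂ) *
    fderiv ℝ (fun y => fderiv ℝ f y (Complex.I • v)) x (Complex.I • v) * Complex.I_sq

/-- Reduces the Hessian form to a single complex direction. The coefficients of that direction are
conjugated because `∂` is complex linear in its direction, while the form has `star c` on the left.
-/
theorem dotProduct_ddbar_mulVec [IsScalarTower ℝ ℂ V] {ι : Type*} [Fintype ι] {b : ι → V}
    (hU : IsOpen U) (hf : ContDiffOn ℝ ∞ f U) (hx : x ∈ U) (c : ι → ℂ) :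
    star c ⬝ᵥ (ddbar b f x).mulVec c =
      dWirt (fun y => dbarWirt f (∑ i, star (c i) • b i) y) (∑ i, star (c i) • b i) x := by
  have h1 : (fun y => dbarWirt f (∑ i, star (c i) • b i) y) =
      fun y => ∑ j, c j * dbarWirt f (b j) y := by
    ext y
    rw [dbarWirt_sum_right]
    simp only [dbarWirt_smul_right, star_star]
  have hd : ∀ j, DifferentiableAt ℝ (fun y => dbarWirt f (b j) y) x := fun j =>
    differentiableAt_of_contDiffOn (contDiffOn_dbarWirt hf hU _) hU hx
  rw [h1, dWirt_sum_right]
  simp only [dotProduct, Matrix.mulVec, Pi.star_apply, dWirt_smul_right]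
  refine Finset.sum_congr rfl fun i _ => ?_
  rw [dWirt_sum fun j _ => (hd j).const_mul _]
  congr 1
  refine Finset.sum_congr rfl fun j _ => ?_
  rw [dWirt_const_mul _ (hd j), mul_comm]
  rfl

/-- The complex Hessian is nonnegative at a minimum. -/
theorem re_dotProduct_ddbar_nonneg [IsScalarTower ℝ ℂ V] {ι : Type*} [Fintype ι] {b : ι → V}
    (hU : IsOpen U) (hf : ContDiffOn ℝ ∞ f U) (hx : x ∈ U)
    (hmin : ∀ y ∈ U, (f x).re ≤ (f y).re) (c : ι → ℂ) :
    0 ≤ (star c ⬝ᵥ (ddbar b f x).mulVec c).re := by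
  rw [dotProduct_ddbar_mulVec hU hf hx, dWirt_dbarWirt_self hU hf hx]
  have h1 := re_fderiv_fderiv_nonneg hU hf hx hmin (∑ i, star (c i) • b i)
  have h2 := re_fderiv_fderiv_nonneg hU hf hx hmin (Complex.I • ∑ i, star (c i) • b i)
  have h4 : (1 / 4 : ℂ) = ((1 / 4 : ℝ) : ℂ) := by push_cast; rfl
  rw [h4, Complex.re_ofReal_mul, Complex.add_re]
  positivity

end SecondDerivative

/-! ### Maxima of dilation-invariant functions -/

section Compactness

variable {d : ℕ} {D : Type*} [TopologicalSpace D] [ChartedSpace (EuclideanSpace ℂ (Fin d)) D]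
  {E : D → Type*} [∀ x, AddCommGroup (E x)] [∀ x, Module ℂ (E x)] [∀ x, TopologicalSpace (E x)]
  [TopologicalSpace (TotalSpace ℂ E)] [FiberBundle ℂ E] [VectorBundle ℂ ℂ E]

/-- A continuous function that is invariant under dilations attains its maximum if the base is
compact. -/
theorem exists_forall_le_of_dilate_invariant [CompactSpace D] {q : TotalSpace ℂ E → ℝ}
    (hq : ∀ c : LocalCoord d E, ContinuousOn (fun x => q (c.param x)) c.dom)
    (hdil : ∀ r : ℝ, 0 < r → ∀ p : TotalSpace ℂ E, p.2 ≠ 0 → q (dilate r p) = q p)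
    (hne : ∃ p : TotalSpace ℂ E, p.2 ≠ 0) :
    ∃ p₀ : TotalSpace ℂ E, p₀.2 ≠ 0 ∧ ∀ p : TotalSpace ℂ E, p.2 ≠ 0 → q p ≤ q p₀ := by
  let c : D → LocalCoord d E := fun b => LocalCoord.around d (⟨b, 0⟩ : TotalSpace ℂ E)
  have hball : ∀ b : D, ∃ r > 0, ∀ w ∈ Metric.closedBall ((c b).chart b) r,
      w ∈ (c b).chart.target ∩ (c b).chart.symm ⁻¹' (c b).triv.baseSet := by
    intro b
    have h1 : IsOpen ((c b).chart.target ∩ (c b).chart.symm ⁻¹' (c b).triv.baseSet) :=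
      (c b).chart.isOpen_inter_preimage_symm (c b).triv.open_baseSet
    have hb : b ∈ (c b).chart.source := mem_chart_source _ _
    have h2 : (c b).chart b ∈ (c b).chart.target ∩ (c b).chart.symm ⁻¹' (c b).triv.baseSet := by
      refine ⟨(c b).chart.map_source hb, ?_⟩
      rw [mem_preimage, (c b).chart.left_inv hb]
      exact mem_baseSet_trivializationAt ℂ E b
    obtain ⟨r, hr, hrs⟩ := Metric.nhds_basis_closedBall.mem_iff.1 (h1.mem_nhds h2)
    exact ⟨r, hr, fun w hw => hrs hw⟩
  choose r hr hrs using hball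
  -- In local coordinates every dilation orbit meets `|z| = 1`. A circle is needed, since no
  -- invariance under rotations is assumed.
  let K : D → Set (Coord d) := fun b =>
    Metric.closedBall ((c b).chart b) (r b) ×ˢ Metric.sphere (0 : ℂ) 1
  have hKdom : ∀ b, K b ⊆ (c b).dom := by
    rintro b ⟨w, z⟩ ⟨hw, hz⟩
    refine ⟨(hrs b w hw).1, (hrs b w hw).2, ?_⟩
    intro h0
    simp only at h0
    simp [h0] at hz
  have hmax : ∀ b, ∃ m ∈ K b, ∀ y ∈ K b, q ((c b).param y) ≤ q ((c b).param m) := by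
    intro b
    have hK : IsCompact (K b) := (isCompact_closedBall _ _).prod (isCompact_sphere _ _)
    have hKne : (K b).Nonempty :=
      ⟨((c b).chart b, 1), Metric.mem_closedBall_self (hr b).le, by simp⟩
    obtain ⟨m, hm, hmax⟩ := hK.exists_isMaxOn hKne ((hq (c b)).mono (hKdom b))
    exact ⟨m, hm, fun y hy => hmax hy⟩
  choose m hmK hm using hmax
  have hN : ∀ b : D, (c b).chart.source ∩ (c b).chart ⁻¹' Metric.ball ((c b).chart b) (r b) ∈
      𝓝 b := fun b =>
    ((c b).chart.isOpen_inter_preimage Metric.isOpen_ball).mem_nhds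
      ⟨mem_chart_source _ _, Metric.mem_ball_self (hr b)⟩
  obtain ⟨T, hT⟩ := CompactSpace.elim_nhds_subcover _ hN
  have hcover : ∀ p : TotalSpace ℂ E, p.2 ≠ 0 → ∃ b ∈ T, q p ≤ q ((c b).param (m b)) := by
    intro p hp
    have hpT : p.1 ∈ ⋃ b ∈ T,
        (c b).chart.source ∩ (c b).chart ⁻¹' Metric.ball ((c b).chart b) (r b) := by
      rw [hT]
      trivial
    obtain ⟨b, hb, hpb⟩ := mem_iUnion₂.1 hpT
    refine ⟨b, hb, ?_⟩
    have hw := Metric.ball_subset_closedBall hpb.2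
    have hpatch : p ∈ (c b).patch := by
      refine ⟨hpb.1, ?_, hp⟩
      have := (hrs b _ hw).2
      rwa [mem_preimage, (c b).chart.left_inv hpb.1] at this
    have hx := (c b).coords_mem_dom hpatch
    have hz : 0 < ‖((c b).coords p).2‖ := norm_pos_iff.2 hx.2.2
    -- Dilating by `1/|z|` moves the point into the compact set `K b` without changing `q`.
    rw [← hdil _ (inv_pos.2 hz) p hp, dilate_eq_cmul]
    conv_lhs => rw [← (c b).param_coords hpatch, ← (c b).param_fibreMul hx]
    refine hm b _ ⟨hw, ?_⟩
    simp only [fibreMul, (c b).param_coords hpatch, mem_sphere_iff_norm, sub_zero, norm_mul,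
      Complex.norm_real, norm_inv, norm_norm]
    exact inv_mul_cancel₀ hz.ne'
  obtain ⟨p₁, hp₁⟩ := hne
  obtain ⟨b₁, hb₁, _⟩ := hcover p₁ hp₁
  obtain ⟨b, hb, hbmax⟩ := T.exists_max_image (fun b => q ((c b).param (m b))) ⟨b₁, hb₁⟩
  refine ⟨(c b).param (m b), ((c b).param_mem_patch (hKdom b (hmK b))).2.2, fun p hp => ?_⟩
  obtain ⟨b', hb', hle⟩ := hcover p hp
  exact hle.trans (hbmax b' hb')

end Compactness

/-! ### The maximum principle and uniqueness of the soliton potential -/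

namespace HermitianMetric

variable {d : ℕ} {D : Type*} [TopologicalSpace D] [ChartedSpace (EuclideanSpace ℂ (Fin d)) D]
  {E : D → Type*} [∀ x, AddCommGroup (E x)] [∀ x, Module ℂ (E x)] [∀ x, TopologicalSpace (E x)]
  [TopologicalSpace (TotalSpace ℂ E)] [FiberBundle ℂ E] [VectorBundle ℂ ℂ E]
  {h : HermitianMetric d E} (hpos : h.IsPositive)

include hpos in
/-- A pluriharmonic function of positive weight is nonpositive: otherwise it would touch a
multiple of a power of `|S|` from below, in contradiction to the curvature assumption. -/
theorem nonpos_of_pluriharmonic [CompactSpace D] (hd : 0 < d) {k : ℕ} (hk : 0 < k)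
    {f : TotalSpace ℂ E → ℝ} (hf : IsSmooth d f)
    (hdil : ∀ r : ℝ, 0 < r → ∀ p : TotalSpace ℂ E, p.2 ≠ 0 → f (dilate r p) = r ^ k * f p)
    (hdd : ∀ c : LocalCoord d E, ∀ x ∈ c.dom, ddbar (dir d) (c.pull f) x = 0)
    {p : TotalSpace ℂ E} (hp : p.2 ≠ 0) : f p ≤ 0 := by
  by_contra! hfp
  -- With this exponent `e^{aχ} = |S|^k`, and `q` below is the dilation-invariant quotient `f
  -- |S|^{-k}`.
  let a : ℝ := -(k / 2)
  have ha : a < 0 := neg_neg_of_pos (by positivity)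
  let q : TotalSpace ℂ E → ℝ := fun p => f p * Real.exp (a * Real.log (h.normSq p))
  have hqc : ∀ c : LocalCoord d E, ContinuousOn (fun x => q (c.param x)) c.dom := fun c => by
    have h1 : ContinuousOn (fun x => Real.log (h.normSq (c.param x))) c.dom :=
      ((h.smooth c).continuousOn).log fun x hx => (h.normSq_param_pos c hx).ne'
    exact (hf c).continuousOn.mul (Real.continuous_exp.comp_continuousOn (h1.const_smul a))
  have hqdil : ∀ r : ℝ, 0 < r → ∀ p : TotalSpace ℂ E, p.2 ≠ 0 → q (dilate r p) = q p := by
    intro r hr p hp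
    simp only [q]
    rw [hdil r hr p hp, dilate_eq_cmul, h.normSq_cmul, Complex.norm_real,
      Real.norm_of_nonneg hr.le, Real.log_mul (by positivity) (h.normSq_pos p hp).ne', mul_add,
      Real.exp_add, Real.log_pow]
    have h1 : a * ((2 : ℕ) * Real.log r) = -(k * Real.log r) := by
      simp only [a]
      push_cast
      ring
    rw [h1, Real.exp_neg, Real.exp_nat_mul, Real.exp_log hr]
    field_simp
  obtain ⟨p₀, hp₀, hmax⟩ := exists_forall_le_of_dilate_invariant hqc hqdil ⟨p, hp⟩
  have hM : 0 < q p₀ := lt_of_lt_of_le (mul_pos hfp (Real.exp_pos _)) (hmax p hp)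
  have hfq : ∀ p, f p = q p * Real.exp (-(a * Real.log (h.normSq p))) := fun p => by
    simp only [q]
    rw [mul_assoc, ← Real.exp_add, add_neg_cancel, Real.exp_zero, mul_one]
  let c := LocalCoord.around d p₀
  have hpc := LocalCoord.mem_patch_around (d := d) hp₀
  let x := c.coords p₀
  have hx : x ∈ c.dom := c.coords_mem_dom hpc
  have hpx : c.param x = p₀ := c.param_coords hpc
  have hχ := h.contDiffOn_chi c
  have hexp : ContDiffOn ℝ ∞ (fun y => Complex.exp (a * h.chi c y)) c.dom :=
    (contDiffOn_const.mul hχ).cexp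
  have hexpval : ∀ y, Complex.exp (a * h.chi c y) =
      ((Real.exp (-(a * Real.log (h.normSq (c.param y)))) : ℝ) : ℂ) := fun y => by
    rw [chi]
    push_cast
    rw [mul_neg]
  -- `N = M |S|^k - f` with `M = q p₀`. It is nonnegative and vanishes at the maximum point of `q`.
  let N : Coord d → ℂ := fun y =>
    (q p₀ : ℂ) * Complex.exp (a * h.chi c y) + (-1 : ℂ) * c.pull f y
  have hN : ContDiffOn ℝ ∞ N c.dom :=
    (contDiffOn_const.mul hexp).add (contDiffOn_const.mul (hf.pull c))
  have hNre : ∀ y, (N y).re = (q p₀ - q (c.param y)) *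
      Real.exp (-(a * Real.log (h.normSq (c.param y)))) := fun y => by
    have h1 : N y = (((q p₀ - q (c.param y)) *
        Real.exp (-(a * Real.log (h.normSq (c.param y)))) : ℝ) : ℂ) := by
      simp only [N]
      rw [hexpval, LocalCoord.pull, hfq]
      push_cast
      ring
    rw [h1, Complex.ofReal_re]
  have hmin : ∀ y ∈ c.dom, (N x).re ≤ (N y).re := fun y hy => by
    rw [hNre, hNre, hpx, sub_self, zero_mul]
    exact mul_nonneg (sub_nonneg.2 (hmax _ (c.param_mem_patch hy).2.2)) (Real.exp_pos _).le
  let θ : Idx d → ℂ := fun i => dWirt (h.chi c) (dir d i) x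
  have hθ : θ (Sum.inr ()) ≠ 0 := h.dWirt_chi_inr_ne_zero c hx
  -- A base direction, available since `0 < d`, corrected in the fibre so that the rank-one term in
  -- the Hessian of `|S|^k` vanishes. Only `a` times the curvature, with `a < 0`, is left.
  let v : Idx d → ℂ := Sum.elim (Pi.single ⟨0, hd⟩ 1)
    fun _ => -star (θ (Sum.inl ⟨0, hd⟩) / θ (Sum.inr ()))
  have hvθ : star v ⬝ᵥ θ = 0 := by
    have h1 : ∀ a : Fin d, star (v (Sum.inl a)) * θ (Sum.inl a) =
        if a = ⟨0, hd⟩ then θ (Sum.inl ⟨0, hd⟩) else 0 := by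
      intro a
      simp only [v, Sum.elim_inl, Pi.single_apply]
      split_ifs with h
      · rw [h]
        simp
      · simp
    rw [dotProduct, Fintype.sum_sum_type]
    simp only [Pi.star_apply, h1, Finset.sum_ite_eq', Finset.mem_univ, if_true]
    simp [v]
    field_simp
    ring
  have hvl : v ∘ Sum.inl ≠ 0 := by
    intro h0
    have := congrFun h0 ⟨0, hd⟩
    simp [v] at this
  have hcurv := (hpos c x.1 (fst_one_mem_dom c hx)).dotProduct_mulVec_pos hvl
  have hnonneg := re_dotProduct_ddbar_nonneg (b := dir d) c.isOpen_dom hN hx hmin v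
  have hddN : ddbar (dir d) N x = (q p₀ : ℂ) • ddbar (dir d)
      (fun y => Complex.exp (a * h.chi c y)) x := by
    rw [ddbar_add c.isOpen_dom (contDiffOn_const.mul hexp) (contDiffOn_const.mul (hf.pull c)) hx,
      ddbar_const_mul c.isOpen_dom _ hexp hx, ddbar_const_mul c.isOpen_dom _ (hf.pull c) hx,
      hdd c x hx, smul_zero, add_zero]
  rw [hddN, h.ddbar_exp_mul_chi c a hx, Matrix.smul_mulVec, Matrix.smul_mulVec, dotProduct_smul,
    dotProduct_smul, dotProduct_fromBlocks_add_vecMulVec, hvθ, star_zero, mul_zero, mul_zero,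
    add_zero, smul_eq_mul, smul_eq_mul, hexpval, ← mul_assoc, ← mul_assoc, ← Complex.ofReal_mul,
    ← Complex.ofReal_mul, Complex.re_ofReal_mul] at hnonneg
  have h1 : q p₀ * Real.exp (-(a * Real.log (h.normSq (c.param x)))) * a < 0 :=
    mul_neg_of_pos_of_neg (mul_pos hM (Real.exp_pos _)) ha
  have h2 := (Complex.pos_iff.1 hcurv).1
  exact absurd hnonneg (not_le.2 (mul_neg_of_neg_of_pos h1 h2))

include hpos in
theorem eq_zero_of_pluriharmonic [CompactSpace D] (hd : 0 < d) {k : ℕ} (hk : 0 < k)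
    {f : TotalSpace ℂ E → ℝ} (hf : IsSmooth d f)
    (hdil : ∀ r : ℝ, 0 < r → ∀ p : TotalSpace ℂ E, p.2 ≠ 0 → f (dilate r p) = r ^ k * f p)
    (hdd : ∀ c : LocalCoord d E, ∀ x ∈ c.dom, ddbar (dir d) (c.pull f) x = 0)
    {p : TotalSpace ℂ E} (hp : p.2 ≠ 0) : f p = 0 := by
  refine le_antisymm (nonpos_of_pluriharmonic hpos hd hk hf hdil hdd hp) ?_
  have h1 : ∀ c : LocalCoord d E, c.pull (fun p => -f p) = fun y => (-1 : ℂ) * c.pull f y :=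
    fun c => by
      ext y
      simp [LocalCoord.pull]
  have := nonpos_of_pluriharmonic hpos hd hk (f := fun p => -f p) (fun c => (hf c).neg)
    (fun r hr p hp => by rw [hdil r hr p hp, mul_neg]) (fun c x hx => by
      rw [h1, ddbar_const_mul c.isOpen_dom _ (hf.pull c) hx, hdd c x hx, smul_zero]) hp
  linarith

include hpos in
/-- The potential of the formal soliton is unique in dimension at least two. -/
theorem IsFormalExpandingSoliton.potential_unique [CompactSpace D] (hd : 0 < d)
    {v v' : ℕ → TotalSpace ℂ E → ℝ} (hv : h.IsFormalExpandingSoliton v)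
    (hv' : h.IsFormalExpandingSoliton v') (k : ℕ) {p : TotalSpace ℂ E} (hp : p.2 ≠ 0) :
    v k p = v' k p := by
  rcases Nat.eq_zero_or_pos k with rfl | hk
  · rw [hv.zero p hp, hv'.zero p hp]
  · refine sub_eq_zero.1 (eq_zero_of_pluriharmonic hpos hd hk (f := fun p => v k p - v' k p)
      (fun c => (hv.smooth k c).sub (hv'.smooth k c)) (fun r hr p hp => ?_) (fun c x hx => ?_) hp)
    · rw [(hv.weight k).dilate_eq (hv.smooth k) hr hp,
        (hv'.weight k).dilate_eq (hv'.smooth k) hr hp, mul_sub]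
    · have h1 : c.pull (fun p => v k p - v' k p) =
          fun y => c.pull (v k) y + (-1 : ℂ) * c.pull (v' k) y := by
        ext y
        simp [LocalCoord.pull, sub_eq_add_neg]
      have h2 := formalForm_unique hpos hv hv' c (k + 2) x hx
      simp only [formalForm, add_right_inj] at h2
      rw [h1, ddbar_add c.isOpen_dom ((hv.smooth k).pull c)
        (contDiffOn_const.mul ((hv'.smooth k).pull c)) hx,
        ddbar_const_mul c.isOpen_dom _ ((hv'.smooth k).pull c) hx, h2, neg_one_smul,
        add_neg_cancel]

/-! ### Convergence of the blowdowns -/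

variable [IsManifold 𝓘(ℂ, EuclideanSpace ℂ (Fin d)) ω D]
  [ContMDiffVectorBundle ω ℂ E 𝓘(ℂ, EuclideanSpace ℂ (Fin d))]

include hpos in
/-- The blowdown limit of a formal solution is the self-similar solution. -/
theorem IsFormalPotentialFlow.tendstoSmoothly {u : ℕ → ℝ → TotalSpace ℂ E → ℝ}
    (hu : h.IsFormalPotentialFlow u) (k : ℕ) :
    TendstoSmoothly d (fun s t p => (s ^ 2)⁻¹ * u k (s ^ 2 * t) (dilate s⁻¹ p))
      (h.selfSimilarFlow k) := by
  intro c m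
  have hflow := selfSimilarFlow_isPotentialFlow hpos
  -- Treating `u` and the self-similar flow as one pair yields polynomials with equal top
  -- coefficients.
  obtain ⟨P, hP, hfP⟩ := IsPotentialFlow.isTimePoly hpos c
    (u := fun b => if b then u else h.selfSimilarFlow)
    (fun b => by cases b <;> simp [hflow, hu.isPotentialFlow]) k
  let e : ℕ → ℝ × Coord d → ℝ := fun i q =>
    q.1 ^ i * ((P true q.2).coeff i - (P false q.2).coeff i).re
  -- `s^{2i - k - 2}` is the factor that the blowdown puts on degree `i`. For `2 i ≥ k + 2` the two
  -- coefficients agree, so the value `0` loses nothing.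
  let a : ℕ → ℝ → ℝ := fun i s => if 2 * i < k + 2 then s⁻¹ ^ (k + 2 - 2 * i) else 0
  have he : ∀ i, ContDiffOn ℝ ∞ (e i) (Ici 0 ×ˢ c.dom) := fun i => by
    have h1 : ContDiffOn ℝ ∞ (fun y => ((P true y).coeff i - (P false y).coeff i).re) c.dom :=
      Complex.reCLM.contDiff.comp_contDiffOn ((hP.smooth true i).sub (hP.smooth false i))
    exact (contDiff_fst.pow i).contDiffOn.mul
      (h1.comp contDiff_snd.contDiffOn fun q hq => hq.2)
  have ha : ∀ i, Tendsto (a i) atTop (𝓝 0) := fun i => by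
    simp only [a]
    split_ifs with hi
    · simpa [show k + 2 - 2 * i ≠ 0 by omega] using
        (tendsto_inv_atTop_zero (𝕜 := ℝ)).pow (k + 2 - 2 * i)
    · exact tendsto_const_nhds
  refine tendstoLocallyUniformlyOn_iteratedFDerivWithin
    ((uniqueDiffOn_Ici 0).prod c.isOpen_dom.uniqueDiffOn)
    ((selfSimilarFlow_isFormalPotentialFlow hpos).smooth k c) (I := Finset.range (k + 2 + 1))
    he ha (fun s hs q hq => ?_) m
  have hp := (c.param_mem_patch hq.2).2.2
  have hq0 : 0 ≤ q.1 := hq.1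
  have hs2q : 0 ≤ s ^ 2 * q.1 := mul_nonneg (by positivity) hq0
  have h1 : h.selfSimilarFlow k q.1 (c.param q.2) =
      (s ^ 2)⁻¹ * (s⁻¹ ^ k * h.selfSimilarFlow k (s ^ 2 * q.1) (c.param q.2)) := by
    rw [selfSimilarFlow_cmul hpos (l := ((s⁻¹ : ℝ) : ℂ)) (by exact_mod_cast (inv_pos.2 hs).ne')
      hq0 k hp, ← dilate_eq_cmul, selfSimilarFlow_dilate hpos k (by positivity) (inv_pos.2 hs) hp,
      Complex.norm_real, Real.norm_of_nonneg (inv_pos.2 hs).le]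
    simp
  have h2 : u k (s ^ 2 * q.1) (dilate s⁻¹ (c.param q.2)) =
      s⁻¹ ^ k * u k (s ^ 2 * q.1) (c.param q.2) :=
    (hu.weight k _ hs2q).dilate_eq (hu.isPotentialFlow.smooth k _ hs2q) (inv_pos.2 hs) hp
  have h3 : u k (s ^ 2 * q.1) (c.param q.2) - h.selfSimilarFlow k (s ^ 2 * q.1) (c.param q.2) =
      ∑ i ∈ Finset.range (k + 2 + 1), (s ^ 2 * q.1) ^ i *
        ((P true q.2).coeff i - (P false q.2).coeff i).re := by
    have h4 := hfP true _ hs2q q.2 hq.2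
    have h5 := hfP false _ hs2q q.2 hq.2
    rw [hP.eval_eq_sum] at h4 h5
    have h6 := congrArg Complex.re (congrArg₂ (· - ·) h4 h5)
    simp only [LocalCoord.pull, if_true, Bool.false_eq_true, if_false, ← Complex.ofReal_sub,
      Complex.ofReal_re, ← Finset.sum_sub_distrib, ← mul_sub, Complex.re_sum,
      ← Complex.ofReal_pow, Complex.re_ofReal_mul] at h6
    exact h6
  have h7 : ∀ i ∈ Finset.range (k + 2 + 1), (s ^ 2)⁻¹ * s⁻¹ ^ k * ((s ^ 2 * q.1) ^ i *
      ((P true q.2).coeff i - (P false q.2).coeff i).re) = a i s • e i q := by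
    intro i _
    simp only [a, e, smul_eq_mul]
    split_ifs with hi
    · have h8 : (s ^ 2)⁻¹ * s⁻¹ ^ k * (s ^ 2) ^ i = s⁻¹ ^ (k + 2 - 2 * i) := by
        rw [pow_sub₀ _ (inv_pos.2 hs).ne' (by omega), pow_add]
        simp only [inv_pow, inv_inv, ← pow_mul]
        ring
      rw [← h8, mul_pow]
      ring
    · rw [hP.top q.2 i (by omega)]
      simp
  change (s ^ 2)⁻¹ * u k (s ^ 2 * q.1) (dilate s⁻¹ (c.param q.2)) = _
  beta_reduce
  rw [← Finset.sum_congr rfl h7, ← Finset.mul_sum, ← h3, h2]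
  rw [h1]
  ring

end HermitianMetric

end FormalKRF

end

/-! ### The main theorem -/

theorem proposition7p38 {d : ℕ} {D : Type*} [TopologicalSpace D]
    [ChartedSpace (EuclideanSpace ℂ (Fin d)) D] [IsManifold 𝓘(ℂ, EuclideanSpace ℂ (Fin d)) ω D]
    [CompactSpace D] [T2Space D]
    {E : D → Type*} [∀ x, AddCommGroup (E x)] [∀ x, Module ℂ (E x)] [∀ x, TopologicalSpace (E x)]
    [TopologicalSpace (TotalSpace ℂ E)] [FiberBundle ℂ E] [VectorBundle ℂ ℂ E]
    [ContMDiffVectorBundle ω ℂ E 𝓘(ℂ, EuclideanSpace ℂ (Fin d))]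
    (h : FormalKRF.HermitianMetric d E) (hpos : h.IsPositive) :
    -- the potential equation has a unique formal solution for each initial condition
    (∀ c : ℕ → TotalSpace ℂ E → ℝ,
      (∀ k, FormalKRF.IsSmooth d (c k)) → (∀ k, FormalKRF.HasWeight k (c k)) →
      ∃ u : ℕ → ℝ → TotalSpace ℂ E → ℝ,
        h.IsFormalPotentialFlow u ∧
        (∀ k, ∀ p : TotalSpace ℂ E, p.2 ≠ 0 → u k 0 p = c k p) ∧
        ∀ u' : ℕ → ℝ → TotalSpace ℂ E → ℝ, h.IsFormalPotentialFlow u' →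
          (∀ k, ∀ p : TotalSpace ℂ E, p.2 ≠ 0 → u' k 0 p = c k p) →
          ∀ k, ∀ t : ℝ, 0 ≤ t → ∀ p : TotalSpace ℂ E, p.2 ≠ 0 → u' k t p = u k t p) ∧
    -- the formal gradient expanding soliton `ω_0 - Ric(ω_0) + √-1 ∂∂̄ v` and the blowdown limit
    ∃ (v : ℕ → TotalSpace ℂ E → ℝ) (uinf : ℕ → ℝ → TotalSpace ℂ E → ℝ),
      h.IsFormalExpandingSoliton v ∧ h.IsGradient v ∧
      (∀ v' : ℕ → TotalSpace ℂ E → ℝ, h.IsFormalExpandingSoliton v' →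
        (∀ c : FormalKRF.LocalCoord d E, ∀ x ∈ c.dom, ∀ a,
          h.formalForm c 1 v' a x = h.formalForm c 1 v a x) ∧
        (0 < d → ∀ k, ∀ p : TotalSpace ℂ E, p.2 ≠ 0 → v' k p = v k p)) ∧
      -- the blowdown limit of every formal solution exists and is `uinf`
      (∀ u : ℕ → ℝ → TotalSpace ℂ E → ℝ, h.IsFormalPotentialFlow u → ∀ k,
        FormalKRF.TendstoSmoothly d
          (fun s t p => (s ^ 2)⁻¹ * u k (s ^ 2 * t) (FormalKRF.dilate s⁻¹ p)) (uinf k)) ∧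
      -- `uinf` is the flow generated by the soliton
      h.IsFormalPotentialFlow uinf ∧
      (∀ k, ∀ t : ℝ, 0 < t → ∀ p : TotalSpace ℂ E, p.2 ≠ 0 →
        uinf k t p = t * v k (FormalKRF.dilate (Real.sqrt t) p)) ∧
      (∀ (c : FormalKRF.LocalCoord d E), ∀ x ∈ c.dom, ∀ t : ℝ, 0 < t → ∀ a,
        h.formalForm c t (fun k => uinf k t) a x =
          (t : ℂ) • FormalKRF.dilatePullback (Real.sqrt t) (h.formalForm c 1 v a) x) := by
  have hs := FormalKRF.HermitianMetric.selfSimilarFlow_isFormalExpandingSoliton hpos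
  -- The flow with zero initial data serves as `uinf`, and its value at time `1` as `v`.
  open FormalKRF.HermitianMetric in
  refine ⟨fun c hc hw => ⟨h.flowSol c, ?_, fun k p _ => flowSol_zero c k p, ?_⟩,
    fun k => h.selfSimilarFlow k 1, h.selfSimilarFlow, hs, selfSimilarFlow_isGradient hpos,
    fun v' hv' => ⟨fun c x hx a => formalForm_unique hpos hv' hs c a x hx,
      fun hd k p hp => hv'.potential_unique hpos hd hs k hp⟩,
    fun u hu k => hu.tendstoSmoothly hpos k, selfSimilarFlow_isFormalPotentialFlow hpos,
    fun k t ht p hp => selfSimilarFlow_eq hpos k ht hp,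
    fun c x hx t ht a => formalForm_selfSimilarFlow hpos c hx ht a⟩
  · open FormalKRF.HermitianMetric in
    refine (flowSol_isPotentialFlow hpos hc).isFormalPotentialFlow hpos fun k => ?_
    rw [show h.flowSol c k 0 = c k from funext fun p =>
      FormalKRF.HermitianMetric.flowSol_zero c k p]
    exact hw k
  · intro u' hu' h0 k t ht p hp
    open FormalKRF.HermitianMetric in
    exact hu'.isPotentialFlow.unique hpos (flowSol_isPotentialFlow hpos hc)
      (fun k p hp => by rw [h0 k p hp, flowSol_zero]) k ht hp
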